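/- Let $\mathcal H,\mathcal K$ be separable complex Hilbert spaces, let $\mathcal L(\mathcal K)$ denote the algebra of bounded operators on $\mathcal K$, and let $\mathcal M\subset\mathcal L(\mathcal H)$ and $\mathcal N\subset\mathcal L(\mathcal K)$ be von Neumann algebras. A linear map $\mathcal E:\mathcal M\to\mathcal N$ is *completely positive* (CP) if for every $n$ the map $\mathrm{id}_n\otimes\mathcal E: M_n(\mathcal M)\to M_n(\mathcal N)$ is positive, and *completely bounded* (CB) if there is $C>0$ with $\|(\mathrm{id}_n\otimes\mathcal E)(A)\|\le C\|A\|$ for all $n$ and all $A\in M_n(\mathcal M)$. A positive linear map $\mathcal E$ is *normal* if $\mathcal E(A)$ is the least upper bound of $(\mathcal E(A_n))_n$ in $\mathcal N$ whenever $(A_n)_{n\in\mathbb N}$ is an increasing sequence of positive elements of $\mathcal M$ with least upper bound $A$ in $\mathcal M$. Let $\mathrm{CP}(\mathcal M,\mathcal N)$ be the set of normal CP maps and $\mathrm{CB}(\mathcal M,\mathcal N)$ the complex linear space of weak*-continuous CB maps from $\mathcal M$ to $\mathcal N$. **Theorem.** (1) $\mathrm{CP}(\mathcal M,\mathcal N)\subset\mathrm{CB}(\mathcal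 M,\mathcal N)$, and $\mathrm{CP}(\mathcal M,\mathcal N)$ is a cone: it contains $0$, is closed under sums and under multiplication by nonnegative real numbers, and $\mathcal E,-\mathcal E\in\mathrm{CP}(\mathcal M,\mathcal N)$ implies $\mathcal E=0$. (2) The complex linear span of $\mathrm{CP}(\mathcal M,\mathcal L(\mathcal K))$ is $\mathrm{CB}(\mathcal M,\mathcal L(\mathcal K))$. More precisely, for every $\mathcal E\in\mathrm{CB}(\mathcal M,\mathcal L(\mathcal K))$ there are $\mathcal E_0,\mathcal E_1,\mathcal E_2,\mathcal E_3\in\mathrm{CP}(\mathcal M,\mathcal L(\mathcal K))$ with $\mathcal E=\sum_{k=0}^3 i^k\,\mathcal E_k$. -/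

import Mathlib

open scoped CStarAlgebra InnerProductSpace

namespace VonNeumannAlgebra

universe u v

section Algebra

variable {H : Type u} [NormedAddCommGroup H] [InnerProductSpace ℂ H] [CompleteSpace H]

/-- The algebra of all bounded operators, as a von Neumann algebra on `H`. -/
noncomputable instance instTop : Top (VonNeumannAlgebra H) where
  top :=
    { (⊤ : StarSubalgebra ℂ (H →L[ℂ] H)) with
      centralizer_centralizer' := by
        refine Set.eq_univ_of_forall fun a => ?_
        rw [Set.mem_centralizer_iff]
        intro b hb
        exact ((Set.mem_centralizer_iff.mp hb) a (Set.mem_univ a)).symm }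

theorem mem_top (a : H →L[ℂ] H) : a ∈ (⊤ : VonNeumannAlgebra H) := Set.mem_univ a

instance instSMulMemClass : SMulMemClass (VonNeumannAlgebra H) ℂ (H →L[ℂ] H) where
  smul_mem {s} c _ ha := s.toStarSubalgebra.smul_mem ha c

instance instIsClosed (M : VonNeumannAlgebra H) : IsClosed (M : Set (H →L[ℂ] H)) := by
  rw [← M.centralizer_centralizer]
  exact Set.isClosed_centralizer _

/-- A von Neumann algebra on `H` is a C⋆-algebra for the operations and the norm of `L(H)`. -/
noncomputable instance instCStarAlgebra (M : VonNeumannAlgebra H) : CStarAlgebra M :=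
  StarSubalgebra.cstarAlgebra M

/- The order on a von Neumann algebra is the one inherited from the operators on `H`. It is
the order of a C⋆-algebra, since square roots of positive elements stay in the algebra. -/
instance instStarOrderedRing (M : VonNeumannAlgebra H) : StarOrderedRing M := by
  refine StarOrderedRing.of_nonneg_iff' (fun {x y} hxy z => ?_) (fun x => ⟨fun hx => ?_, ?_⟩)
  · exact add_le_add_right (show (x : H →L[ℂ] H) ≤ y from hxy) (z : H →L[ℂ] H)
  · have hx' : (0 : H →L[ℂ] H) ≤ (x : H →L[ℂ] H) := hx
    have hsa : IsSelfAdjoint x := Subtype.ext (IsSelfAdjoint.of_nonneg hx')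
    have hcl : IsClosed (M.toStarSubalgebra : Set (H →L[ℂ] H)) := instIsClosed M
    have hspec : spectrum ℝ x = spectrum ℝ (x : H →L[ℂ] H) := by
      have h : spectrum ℂ x = spectrum ℂ (x : H →L[ℂ] H) :=
        StarSubalgebra.spectrum_eq M.toStarSubalgebra (hS := hcl)
      ext r
      rw [← spectrum.algebraMap_mem_iff ℂ, h, spectrum.algebraMap_mem_iff ℂ]
    have hq : QuasispectrumRestricts x ContinuousMap.realToNNReal := by
      rw [← SpectrumRestricts, SpectrumRestricts.nnreal_iff]
      intro r hr
      exact spectrum_nonneg_of_nonneg hx' (hspec ▸ hr)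
    obtain ⟨p, hp, -, hpp⟩ :=
      CFC.exists_sqrt_of_isSelfAdjoint_of_quasispectrumRestricts hsa hq
    exact ⟨p, by rw [hp.star_eq, hpp]⟩
  · rintro ⟨s, rfl⟩
    exact star_mul_self_nonneg (s : H →L[ℂ] H)

end Algebra

section WeakStar

/-- The weak* (that is, ultraweak) topology on `L(H)`: the coarsest topology for which all the
functionals `A ↦ ∑ₙ ⟪xₙ, A yₙ⟫` with `(xₙ)`, `(yₙ)` square-summable sequences in `H` are
continuous. These functionals form the predual of `L(H)`. -/
@[reducible] noncomputable def weakStarTopologyOperators (H : Type u) [NormedAddCommGroup H]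
    [InnerProductSpace ℂ H] : TopologicalSpace (H →L[ℂ] H) :=
  ⨅ (x : ℕ → H) (y : ℕ → H) (_ : Summable fun n => ‖x n‖ ^ 2) (_ : Summable fun n => ‖y n‖ ^ 2),
    TopologicalSpace.induced (fun A : H →L[ℂ] H => ∑' n, ⟪x n, A (y n)⟫_ℂ) inferInstance

variable {H : Type u} [NormedAddCommGroup H] [InnerProductSpace ℂ H] [CompleteSpace H]

/-- The weak* topology of a von Neumann algebra `M` on `H`, which is the restriction to `M` of the
weak* topology of `L(H)`. -/
@[reducible] noncomputable def weakStarTopology (M : VonNeumannAlgebra H) : TopologicalSpace M :=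
  TopologicalSpace.induced (Subtype.val : M → (H →L[ℂ] H)) (weakStarTopologyOperators H)

end WeakStar

variable {H : Type u} [NormedAddCommGroup H] [InnerProductSpace ℂ H] [CompleteSpace H]
variable {K : Type v} [NormedAddCommGroup K] [InnerProductSpace ℂ K] [CompleteSpace K]
variable {M : VonNeumannAlgebra H} {N : VonNeumannAlgebra K}

/-- Continuity of a linear map for the weak* topologies. -/
def IsWeakStarContinuous (E : M →ₗ[ℂ] N) : Prop :=
  @Continuous M N M.weakStarTopology N.weakStarTopology E

/-- A linear map is completely positive if it is the underlying linear map of a completely positive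
map in the sense of Mathlib: entrywise application to `n × n` matrices over `M` preserves
positivity, for all `n`. -/
def IsCompletelyPositive (E : M →ₗ[ℂ] N) : Prop :=
  ∃ φ : M →CP N, φ.toLinearMap = E

/-- Complete boundedness: the entrywise applications of `E` to `n × n` matrices over `M` are bounded
for the C⋆-norms, uniformly in `n`. -/
def IsCompletelyBounded (E : M →ₗ[ℂ] N) : Prop :=
  ∃ C : ℝ, 0 < C ∧ ∀ (n : ℕ) (A : CStarMatrix (Fin n) (Fin n) M), ‖A.map E‖ ≤ C * ‖A‖

/-- Normality (used for positive linear maps): `E` preserves the least upper bounds, in the ordered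
spaces `M` and `N`, of bounded increasing sequences of positive elements. -/
def IsNormalMap (E : M →ₗ[ℂ] N) : Prop :=
  ∀ (A : ℕ → M) (a : M), (∀ n, 0 ≤ A n) → Monotone A → IsLUB (Set.range A) a →
    IsLUB (Set.range fun n => E (A n)) (E a)

theorem isWeakStarContinuous_iff (E : M →ₗ[ℂ] N) :
    IsWeakStarContinuous E ↔ ∀ x y : ℕ → K, (Summable fun n => ‖x n‖ ^ 2) →
      (Summable fun n => ‖y n‖ ^ 2) →
      @Continuous M ℂ M.weakStarTopology inferInstance
        (fun a => ∑' n, ⟪x n, (E a : K →L[ℂ] K) (y n)⟫_ℂ) := by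
  unfold IsWeakStarContinuous weakStarTopology
  rw [continuous_induced_rng]
  simp only [continuous_iInf_rng]
  exact forall_congr' fun x => forall_congr' fun y => forall_congr' fun hx =>
    forall_congr' fun hy => continuous_induced_rng

/-- The terms of the series defining the weak* continuous functionals are summable. -/
theorem summable_inner_apply {L : Type v} [NormedAddCommGroup L] [InnerProductSpace ℂ L]
    (A : L →L[ℂ] L) {x y : ℕ → L} (hx : Summable fun n => ‖x n‖ ^ 2)
    (hy : Summable fun n => ‖y n‖ ^ 2) : Summable fun n => ⟪x n, A (y n)⟫_ℂ := by
  refine Summable.of_norm_bounded ((hx.add hy).mul_left ‖A‖) fun n => ?_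
  calc ‖⟪x n, A (y n)⟫_ℂ‖ ≤ ‖x n‖ * (‖A‖ * ‖y n‖) :=
        (norm_inner_le_norm _ _).trans (by gcongr; exact A.le_opNorm _)
    _ = ‖A‖ * (‖x n‖ * ‖y n‖) := by ring
    _ ≤ ‖A‖ * (‖x n‖ ^ 2 + ‖y n‖ ^ 2) := by
        gcongr
        nlinarith [sq_nonneg (‖x n‖ - ‖y n‖), sq_nonneg (‖x n‖), sq_nonneg (‖y n‖)]

variable (M N)

/-- `CP(M, N)`: the set of normal completely positive maps from `M` to `N`. -/
def CP : Set (M →ₗ[ℂ] N) := {E | IsCompletelyPositive E ∧ IsNormalMap E}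

/-- `CB(M, N)`: the linear space of weak*-continuous completely bounded maps from `M` to `N`. -/
def CB : Submodule ℂ (M →ₗ[ℂ] N) where
  carrier := {E | IsWeakStarContinuous E ∧ IsCompletelyBounded E}
  zero_mem' := by
    refine ⟨(isWeakStarContinuous_iff _).2 fun x y hx hy => ?_, 1, one_pos, fun n A => ?_⟩
    · let _ := M.weakStarTopology
      simpa using continuous_const
    · have h : A.map (0 : M →ₗ[ℂ] N) = 0 := rfl
      rw [h, norm_zero, one_mul]
      exact norm_nonneg A
  add_mem' := by
    rintro E F ⟨hE, C, hC, hEC⟩ ⟨hF, D, hD, hFD⟩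
    refine ⟨(isWeakStarContinuous_iff _).2 fun x y hx hy => ?_, C + D, add_pos hC hD, fun n A => ?_⟩
    · let _ := M.weakStarTopology
      have h := ((isWeakStarContinuous_iff _).1 hE x y hx hy).add ((isWeakStarContinuous_iff _).1 hF x y hx hy)
      refine h.congr fun a => ?_
      have := (summable_inner_apply (E a : K →L[ℂ] K) hx hy).tsum_add
        (summable_inner_apply (F a : K →L[ℂ] K) hx hy)
      simpa [inner_add_right] using this.symm
    · have h : A.map ⇑(E + F) = A.map E + A.map F := rfl
      rw [h, add_mul]
      exact (norm_add_le _ _).trans (add_le_add (hEC n A) (hFD n A))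
  smul_mem' := by
    rintro c E ⟨hE, C, hC, hEC⟩
    refine ⟨(isWeakStarContinuous_iff _).2 fun x y hx hy => ?_, (‖c‖ + 1) * C, by positivity,
      fun n A => ?_⟩
    · let _ := M.weakStarTopology
      have h := ((isWeakStarContinuous_iff _).1 hE x y hx hy).const_smul c
      refine h.congr fun a => ?_
      simp [tsum_mul_left]
    · have h : A.map ⇑(c • E) = c • A.map E := rfl
      rw [h, norm_smul, mul_assoc]
      have := hEC n A
      have h0 := norm_nonneg (A.map E)
      nlinarith [norm_nonneg c]

end VonNeumannAlgebra

/-! CP is contained in CB. Splitting an element into four positive parts bounds a positive map `f`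
by `4 * ‖f 1‖`. The entrywise image of an identity matrix over `M` has norm at most `‖E 1‖` whatever
its size, so a completely positive map is completely bounded. For weak* continuity, polarization
reduces the matter to the functionals ω(a) = ∑ ⟪zₙ, E(a) zₙ⟫, which are positive and normal. As `H`
is separable, ω is absolutely continuous with respect to the vector states of a dense sequence
(`exists_re_apply_le`). Hahn–Banach then puts ω in the norm closure of the span of the vector
functionals (`mem_closure_vectorSpan`). Each element of that closure is a series ∑ ⟪xₙ, a yₙ⟫ with
square-summable vectors (`exists_tsum_inner_eq`), because its unit ball lies in the closed ℓ¹-hull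
of countably many vector functionals.

CP spans CB. A completely bounded map into L(K) factors as E(a) = V⋆ π(a) W
(`exists_wittstock_factorization`). To see this, take matrices over `M` indexed by `K ⊕ K` with
scalar diagonal blocks, and prescribe a functional on them: 2C⟪x, y⟫ times the scalar on the
diagonal blocks, the coefficients of `E` off them. Complete boundedness makes its real part
nonnegative on matrices with positive real part (`offDiagonal_nonneg`). The M. Riesz theorem extends
it to all matrices; the extension is a positive kernel, whose Kolmogorov decomposition supplies π, V
and W.

The representation π need not be normal, but the vectors with normal vector state form a closed
invariant subspace. On its orthogonal complement the remaining coefficient of `E` is still normal,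
and there a normal coefficient must vanish (`inner_rep_eq_zero`). Hence V and W may be projected to
the normal vectors, and polarizing V⋆ π(·) W gives four compressions X⋆ π(·) X, which are completely
positive and normal.

The cone properties follow because least upper bounds of increasing sequences are strong limits and
positive elements span `M`. -/

namespace VonNeumannAlgebra

open Filter Topology
open scoped ComplexOrder

/-! ### Operator order, and least upper bounds as strong limits. -/

section Order

variable {H : Type*} [NormedAddCommGroup H] [InnerProductSpace ℂ H] [CompleteSpace H]

omit [CompleteSpace H] in
theorem _root_.ContinuousLinearMap.nonneg_iff_inner_nonneg (T : H →L[ℂ] H) :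
    0 ≤ T ↔ ∀ h, 0 ≤ ⟪h, T h⟫_ℂ := by
  rw [ContinuousLinearMap.nonneg_iff_isPositive]
  refine ⟨fun hT h => hT.inner_nonneg_right h, fun hT => ?_⟩
  rw [ContinuousLinearMap.isPositive_iff_complex]
  intro h
  have h1 := hT h
  have h2 : ⟪T h, h⟫_ℂ = ⟪h, T h⟫_ℂ := by
    rw [← inner_conj_symm]
    exact Complex.conj_eq_iff_im.2 (Complex.nonneg_iff.1 h1).2.symm
  rw [h2]
  exact ⟨by
    apply Complex.ext
    · simp
    · simpa using (Complex.nonneg_iff.1 h1).2, (Complex.nonneg_iff.1 h1).1⟩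

/-- With S = √T one has T h = S (S h), ‖T‖ = ‖S‖² and ⟪h, T h⟫ = ‖S h‖². This upgrades convergence
of quadratic forms to strong convergence. -/
theorem _root_.ContinuousLinearMap.norm_apply_sq_le_of_nonneg {T : H →L[ℂ] H} (hT : 0 ≤ T) (h : H) :
    ‖T h‖ ^ 2 ≤ ‖T‖ * (⟪h, T h⟫_ℂ).re := by
  set S := CFC.sqrt T
  have hS : S * S = T := CFC.sqrt_mul_sqrt_self T hT
  have hSa : IsSelfAdjoint S := IsSelfAdjoint.of_nonneg (CFC.sqrt_nonneg T)
  have h1 : ⟪h, T h⟫_ℂ = ⟪S h, S h⟫_ℂ := by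
    rw [← hS, mul_apply_eq_comp, ← ContinuousLinearMap.adjoint_inner_left]
    rw [← ContinuousLinearMap.star_eq_adjoint, hSa.star_eq]
  have h2 : ‖T‖ = ‖S‖ * ‖S‖ := by
    rw [← hS]
    conv_lhs => rw [← hSa.star_eq]
    rw [hSa.star_eq]
    have := CStarRing.norm_star_mul_self (x := S)
    rwa [hSa.star_eq] at this
  have h3 : T h = S (S h) := by rw [← hS]; rfl
  rw [h1, h2, h3, inner_self_eq_norm_sq_to_K]
  have := S.le_opNorm (S h)
  have e : (((‖S h‖ : ℝ) : ℂ) ^ 2).re = ‖S h‖ ^ 2 := by norm_cast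
  simp only [Complex.coe_algebraMap, e]
  calc _ ≤ (‖S‖ * ‖S h‖) ^ 2 := by gcongr
    _ = _ := by ring

variable {M : VonNeumannAlgebra H}

theorem nonneg_iff (a : M) : 0 ≤ a ↔ ∀ h, 0 ≤ ⟪h, (a : H →L[ℂ] H) h⟫_ℂ :=
  ContinuousLinearMap.nonneg_iff_inner_nonneg (a : H →L[ℂ] H)

theorem le_iff (a b : M) :
    a ≤ b ↔ ∀ h, ⟪h, (a : H →L[ℂ] H) h⟫_ℂ ≤ ⟪h, (b : H →L[ℂ] H) h⟫_ℂ := by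
  rw [← sub_nonneg, nonneg_iff]
  refine forall_congr' fun h => ?_
  rw [← sub_nonneg (b := ⟪h, (a : H →L[ℂ] H) h⟫_ℂ)]
  simp

theorem norm_le_of_nonneg_of_le {a b : M} (ha : 0 ≤ a) (hab : a ≤ b) : ‖a‖ ≤ ‖b‖ :=
  CStarAlgebra.norm_le_norm_of_nonneg_of_le ha hab

/-- Bounded increasing sequences in a von Neumann algebra converge strongly. -/
theorem exists_strong_limit (A : ℕ → M) (hA : Monotone A) (b : M) (hb : ∀ n, A n ≤ b) :
    ∃ a : M, ∀ h, Tendsto (fun n => (A n : H →L[ℂ] H) h) atTop (𝓝 ((a : H →L[ℂ] H) h)) := by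
  have hlim : ∀ h : H, ∃ k, Tendsto (fun n => (A n : H →L[ℂ] H) h) atTop (𝓝 k) := by
    intro h
    apply cauchySeq_tendsto_of_complete
    have hmono : Monotone fun n => (⟪h, (A n : H →L[ℂ] H) h⟫_ℂ).re := fun m n hmn =>
      (Complex.le_def.1 ((le_iff _ _).1 (hA hmn) h)).1
    have hbdd : BddAbove (Set.range fun n => (⟪h, (A n : H →L[ℂ] H) h⟫_ℂ).re) := by
      refine ⟨(⟪h, (b : H →L[ℂ] H) h⟫_ℂ).re, ?_⟩
      rintro _ ⟨n, rfl⟩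
      exact (Complex.le_def.1 ((le_iff _ _).1 (hb n) h)).1
    have hc := (tendsto_atTop_ciSup hmono hbdd).cauchySeq
    rw [Metric.cauchySeq_iff'] at hc ⊢
    intro ε hε
    -- A common bound for all differences `A n - A N`; the added 1 keeps it positive.
    set c := ‖b - A 0‖ + 1
    have hcpos : 0 < c := by positivity
    obtain ⟨N, hN⟩ := hc (ε ^ 2 / c) (by positivity)
    refine ⟨N, fun n hn => ?_⟩
    have h1 : (0 : M) ≤ A n - A N := sub_nonneg.2 (hA hn)
    have h2 := ContinuousLinearMap.norm_apply_sq_le_of_nonneg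
      (T := ((A n - A N : M) : H →L[ℂ] H)) h1 h
    have h3 : ‖((A n - A N : M) : H →L[ℂ] H)‖ ≤ c := by
      have : ‖A n - A N‖ ≤ ‖b - A 0‖ :=
        norm_le_of_nonneg_of_le h1 (sub_le_sub (hb n) (hA (Nat.zero_le N)))
      exact this.trans (by simp [c])
    have h4 : (⟪h, ((A n - A N : M) : H →L[ℂ] H) h⟫_ℂ).re < ε ^ 2 / c := by
      have := hN n hn
      rw [Real.dist_eq] at this
      have h5 := (abs_lt.1 this).2
      simpa [inner_sub_right] using h5
    have h5 : 0 ≤ (⟪h, ((A n - A N : M) : H →L[ℂ] H) h⟫_ℂ).re :=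
      (Complex.le_def.1 ((nonneg_iff _).1 h1 h)).1
    have h6 : ‖((A n - A N : M) : H →L[ℂ] H) h‖ ^ 2 < ε ^ 2 := by
      calc _ ≤ c * (⟪h, ((A n - A N : M) : H →L[ℂ] H) h⟫_ℂ).re := h2.trans (by gcongr)
        _ < c * (ε ^ 2 / c) := by gcongr
        _ = ε ^ 2 := by field_simp
    rw [dist_eq_norm]
    have := lt_of_pow_lt_pow_left₀ 2 hε.le h6
    simpa using this
  choose f hf using hlim
  have hT : Tendsto (fun n h => (A n : H →L[ℂ] H) h) atTop (𝓝 f) := tendsto_pi_nhds.2 hf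
  let T : H →L[ℂ] H := continuousLinearMapOfTendsto (fun n => (A n : H →L[ℂ] H)) hT
  have hTf : ∀ h, T h = f h := fun h => rfl
  -- Strong limits of elements of `M` still commute with the commutant of `M`, so the bicommutant
  -- property applies.
  have hmem : T ∈ M := by
    rw [← SetLike.mem_coe, ← M.centralizer_centralizer, Set.mem_centralizer_iff]
    intro S hS
    rw [Set.mem_centralizer_iff] at hS
    ext h
    simp only [mul_apply_eq_comp, hTf]
    refine tendsto_nhds_unique ((S.continuous.tendsto _).comp (hf h)) ?_
    refine (hf (S h)).congr fun n => ?_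
    exact (DFunLike.congr_fun (hS (A n) (A n).2) h)
  exact ⟨⟨T, hmem⟩, fun h => hf h⟩

theorem isLUB_of_tendsto {A : ℕ → M} (hA : Monotone A) {a : M}
    (ha : ∀ h, Tendsto (fun n => ⟪h, (A n : H →L[ℂ] H) h⟫_ℂ) atTop (𝓝 ⟪h, (a : H →L[ℂ] H) h⟫_ℂ)) :
    IsLUB (Set.range A) a := by
  refine ⟨?_, fun b hb => ?_⟩
  · rintro _ ⟨n, rfl⟩
    rw [le_iff]
    intro h
    refine ge_of_tendsto (ha h) ?_
    filter_upwards [eventually_ge_atTop n] with m hm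
    exact (le_iff _ _).1 (hA hm) h
  · rw [le_iff]
    intro h
    refine le_of_tendsto (ha h) (Eventually.of_forall fun n => ?_)
    exact (le_iff _ _).1 (hb ⟨n, rfl⟩) h

/-- The strong limit exists and is itself a least upper bound, so it equals `a`. Order normality
thereby becomes a statement about strong convergence. -/
theorem tendsto_of_isLUB {A : ℕ → M} (hA : Monotone A) {a : M} (ha : IsLUB (Set.range A) a)
    (h : H) : Tendsto (fun n => (A n : H →L[ℂ] H) h) atTop (𝓝 ((a : H →L[ℂ] H) h)) := by
  obtain ⟨b, hb⟩ := exists_strong_limit A hA a fun n => ha.1 ⟨n, rfl⟩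
  have := isLUB_of_tendsto hA (a := b) fun h => tendsto_const_nhds.inner (hb h)
  rw [ha.unique this]
  exact hb h

end Order

theorem _root_.CStarAlgebra.exists_eq_star_mul_self {A : Type*} [NonUnitalCStarAlgebra A]
    [PartialOrder A] [StarOrderedRing A] {a : A} (ha : 0 ≤ a) : ∃ b, a = star b * b :=
  CStarAlgebra.nonneg_iff_eq_star_mul_self.1 ha

/-- The witnesses are the negative part a⁻ and its square root, and the relation for `a * p` holds
because a⁺a⁻ = 0. Positivity of matrices will be tested through these relations alone. -/
theorem _root_.CStarAlgebra.exists_mul_eq_neg_mul_self {A : Type*} [NonUnitalCStarAlgebra A]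
    [PartialOrder A] [StarOrderedRing A] {a : A} (ha : IsSelfAdjoint a) :
    ∃ p q : A, star p = p ∧ star q = q ∧ q * q = p ∧ a * p = -(p * p) ∧ (p = 0 → 0 ≤ a) := by
  have hp : 0 ≤ a⁻ := CFC.negPart_nonneg a
  refine ⟨a⁻, CFC.sqrt a⁻, (IsSelfAdjoint.of_nonneg hp).star_eq,
    (IsSelfAdjoint.of_nonneg (CFC.sqrt_nonneg _)).star_eq, CFC.sqrt_mul_sqrt_self _ hp, ?_,
    (CFC.negPart_eq_zero_iff a ha).1⟩
  calc a * a⁻ = (a⁺ - a⁻) * a⁻ := by rw [CFC.posPart_sub_negPart a ha]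
    _ = _ := by rw [sub_mul, CFC.posPart_mul_negPart, zero_sub]

/-! ### Norm and positivity of matrices over M through their forms on Hⁿ. -/

section SpatialMatrix

variable {H : Type*} [NormedAddCommGroup H] [InnerProductSpace ℂ H] [CompleteSpace H]
variable {M : VonNeumannAlgebra H} {n : ℕ}

/-- The action of a matrix over `M` on `Hⁿ`. -/
noncomputable def matrixAct (A : CStarMatrix (Fin n) (Fin n) M) (k : Fin n → H) : Fin n → H :=
  fun i => ∑ j, (A i j : H →L[ℂ] H) (k j)

/-- The sesquilinear form on `Hⁿ` defined by a matrix of operators on `H`. -/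
noncomputable def matrixForm (A : CStarMatrix (Fin n) (Fin n) M) (h k : Fin n → H) : ℂ :=
  ∑ i, ∑ j, ⟪h i, (A i j : H →L[ℂ] H) (k j)⟫_ℂ

theorem coe_finset_sum {ι : Type*} (s : Finset ι) (f : ι → M) :
    ((∑ i ∈ s, f i : M) : H →L[ℂ] H) = ∑ i ∈ s, (f i : H →L[ℂ] H) :=
  map_sum (M.toStarSubalgebra.subtype) f s

theorem finset_sum_apply {ι : Type*} (s : Finset ι) (f : ι → M) (h : H) :
    ((∑ i ∈ s, f i : M) : H →L[ℂ] H) h = ∑ i ∈ s, (f i : H →L[ℂ] H) h := by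
  rw [coe_finset_sum, sum_apply]

theorem inner_star_left (a : M) (h k : H) :
    ⟪((star a : M) : H →L[ℂ] H) h, k⟫_ℂ = ⟪h, (a : H →L[ℂ] H) k⟫_ℂ :=
  ContinuousLinearMap.adjoint_inner_left (a : H →L[ℂ] H) k h

theorem inner_star_right (a : M) (h k : H) :
    ⟪h, ((star a : M) : H →L[ℂ] H) k⟫_ℂ = ⟪(a : H →L[ℂ] H) h, k⟫_ℂ :=
  ContinuousLinearMap.adjoint_inner_right (a : H →L[ℂ] H) h k

theorem matrixForm_eq (A : CStarMatrix (Fin n) (Fin n) M) (h k : Fin n → H) :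
    matrixForm A h k = ∑ i, ⟪h i, matrixAct A k i⟫_ℂ := by
  simp [matrixForm, matrixAct]

theorem matrixAct_mul (A B : CStarMatrix (Fin n) (Fin n) M) (k : Fin n → H) :
    matrixAct (A * B) k = matrixAct A (matrixAct B k) := by
  ext i
  simp only [matrixAct, CStarMatrix.mul_apply, finset_sum_apply, map_sum]
  rw [Finset.sum_comm]
  rfl

theorem matrixForm_star (A : CStarMatrix (Fin n) (Fin n) M) (h k : Fin n → H) :
    matrixForm (star A) h k = ∑ i, ⟪matrixAct A h i, k i⟫_ℂ := by
  simp only [matrixForm, matrixAct, sum_inner]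
  rw [Finset.sum_comm]
  refine Finset.sum_congr rfl fun j _ => Finset.sum_congr rfl fun i _ => ?_
  rw [CStarMatrix.star_apply, inner_star_right]

theorem matrixForm_star_mul (A B : CStarMatrix (Fin n) (Fin n) M) (h k : Fin n → H) :
    matrixForm (star A * B) h k = ∑ i, ⟪matrixAct A h i, matrixAct B k i⟫_ℂ := by
  rw [matrixForm_eq, matrixAct_mul, ← matrixForm_eq, matrixForm_star]

theorem matrixForm_star_mul_self (A : CStarMatrix (Fin n) (Fin n) M) (h : Fin n → H) :
    matrixForm (star A * A) h h = ((∑ i, ‖matrixAct A h i‖ ^ 2 : ℝ) : ℂ) := by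
  rw [matrixForm_star_mul]
  push_cast
  exact Finset.sum_congr rfl fun i _ => inner_self_eq_norm_sq_to_K _

-- The norm of a `CStarMatrix` comes from its action on the Hilbert module Mⁿ. This formula for its
-- M-valued coefficients is the bridge to the form on Hⁿ.
open CStarMatrix WithCStarModule in
theorem inner_toCLM_eq (A : CStarMatrix (Fin n) (Fin n) M) (v w : Fin n → M) :
    ⟪(equiv M _).symm w, toCLM A ((equiv M _).symm v)⟫_M
      = ∑ j, ∑ i, v i * A i j * star (w j) := by
  simp only [toCLM_apply_eq_sum, pi_inner, equiv_symm_pi_apply, inner_def, Finset.sum_mul]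

open CStarMatrix WithCStarModule in
theorem norm_equiv_symm_sq (v : Fin n → M) :
    ‖(equiv M _).symm v‖ ^ 2 = ‖∑ i, v i * star (v i)‖ := by
  rw [CStarModule.norm_sq_eq M, pi_inner]
  simp only [inner_def, equiv_symm_pi_apply]

open CStarMatrix WithCStarModule in
theorem sum_norm_star_sq_le (v : Fin n → M) (h : H) :
    ∑ i, ‖((star (v i) : M) : H →L[ℂ] H) h‖ ^ 2 ≤ (‖(equiv M _).symm v‖ * ‖h‖) ^ 2 := by
  rw [mul_pow, norm_equiv_symm_sq]
  set T : M := ∑ i, v i * star (v i) with hT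
  have h2 : ((∑ i, ‖((star (v i) : M) : H →L[ℂ] H) h‖ ^ 2 : ℝ) : ℂ) = ⟪h, (T : H →L[ℂ] H) h⟫_ℂ := by
    rw [hT, finset_sum_apply, inner_sum]
    push_cast
    refine Finset.sum_congr rfl fun i _ => ?_
    change _ = ⟪h, (v i : H →L[ℂ] H) (((star (v i) : M) : H →L[ℂ] H) h)⟫_ℂ
    rw [← inner_star_left, inner_self_eq_norm_sq_to_K]
    rfl
  have h3 : ∑ i, ‖((star (v i) : M) : H →L[ℂ] H) h‖ ^ 2 = ‖⟪h, (T : H →L[ℂ] H) h⟫_ℂ‖ := by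
    rw [← h2, Complex.norm_real, Real.norm_of_nonneg (by positivity)]
  rw [h3]
  calc _ ≤ ‖h‖ * ‖(T : H →L[ℂ] H) h‖ := norm_inner_le_norm _ _
    _ ≤ ‖h‖ * (‖(T : H →L[ℂ] H)‖ * ‖h‖) := by gcongr; exact ContinuousLinearMap.le_opNorm _ _
    _ = ‖T‖ * ‖h‖ ^ 2 := by rw [show ‖(T : H →L[ℂ] H)‖ = ‖T‖ from rfl]; ring

open WithCStarModule in
/-- The C⋆-norm of a matrix over `M` is bounded by the norm of its form on `Hⁿ`. -/
theorem norm_le_of_norm_matrixForm_le (A : CStarMatrix (Fin n) (Fin n) M) {C : ℝ} (hC : 0 ≤ C)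
    (h : ∀ u v : Fin n → H,
      ‖matrixForm A u v‖ ≤ C * √(∑ i, ‖u i‖ ^ 2) * √(∑ i, ‖v i‖ ^ 2)) : ‖A‖ ≤ C := by
  lift C to NNReal using hC
  refine CStarMatrix.norm_le_of_forall_inner_le fun v w => ?_
  obtain ⟨v, rfl⟩ := (equiv M _).symm.surjective v
  obtain ⟨w, rfl⟩ := (equiv M _).symm.surjective w
  rw [inner_toCLM_eq]
  set T : M := ∑ j, ∑ i, v i * A i j * star (w j) with hT
  change ‖(T : H →L[ℂ] H)‖ ≤ _
  refine ContinuousLinearMap.opNorm_le_of_re_inner_le (by positivity) fun y x hy hx => ?_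
  -- A coefficient of the module inner product is the form of `A` at the vectors vᵢ⋆x and wᵢ⋆y,
  -- whose norms in Hⁿ are controlled by the module norms of v and w.
  have e : ⟪x, (T : H →L[ℂ] H) y⟫_ℂ = matrixForm A (fun i => ((star (v i) : M) : H →L[ℂ] H) x)
      (fun i => ((star (w i) : M) : H →L[ℂ] H) y) := by
    rw [hT, finset_sum_apply, inner_sum, matrixForm, Finset.sum_comm]
    refine Finset.sum_congr rfl fun j _ => ?_
    rw [finset_sum_apply, inner_sum]
    refine Finset.sum_congr rfl fun i _ => ?_
    rw [inner_star_left]; rfl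
  rw [← inner_conj_symm, e, RCLike.conj_re]
  refine (RCLike.re_le_norm _).trans ((h _ _).trans ?_)
  have hv := sum_norm_star_sq_le v x
  have hw := sum_norm_star_sq_le w y
  rw [hx, mul_one] at hv
  rw [hy, mul_one] at hw
  gcongr
  · exact Real.sqrt_le_iff.2 ⟨norm_nonneg _, hv⟩
  · exact Real.sqrt_le_iff.2 ⟨norm_nonneg _, hw⟩

-- For a unit vector u, the rank-one operators z ↦ ⟪xᵢ, z⟫ u form a module element of norm at most
-- that of x in Kⁿ, and they recover the form of `A` as a coefficient of the module inner product.
-- They are available because the algebra is all of L(K).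
open WithCStarModule in
theorem norm_matrixForm_le {K : Type*} [NormedAddCommGroup K] [InnerProductSpace ℂ K]
    [CompleteSpace K] (A : CStarMatrix (Fin n) (Fin n) (⊤ : VonNeumannAlgebra K))
    (x y : Fin n → K) :
    ‖matrixForm A x y‖ ≤ ‖A‖ * √(∑ i, ‖x i‖ ^ 2) * √(∑ i, ‖y i‖ ^ 2) := by
  rcases subsingleton_or_nontrivial K with hK | hK
  · rw [Subsingleton.elim x 0]
    simp [matrixForm]
  obtain ⟨u, hu⟩ := exists_norm_eq K (zero_le_one (α := ℝ))
  let r : (Fin n → K) → Fin n → (⊤ : VonNeumannAlgebra K) := fun x i =>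
    ⟨InnerProductSpace.rankOne ℂ u (x i), mem_top _⟩
  have hstar : ∀ (x : Fin n → K) i (z : K),
      ((star (r x i) : (⊤ : VonNeumannAlgebra K)) : K →L[ℂ] K) z = ⟪u, z⟫_ℂ • x i := by
    intro x i z
    refine ext_inner_left ℂ fun t => ?_
    rw [inner_star_right]
    simp [r]
  have hnorm : ∀ x : Fin n → K,
      ‖(equiv (⊤ : VonNeumannAlgebra K) _).symm (r x)‖ ≤ √(∑ i, ‖x i‖ ^ 2) := by
    intro x
    rw [← sq_le_sq₀ (norm_nonneg _) (Real.sqrt_nonneg _), norm_equiv_symm_sq,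
      Real.sq_sqrt (by positivity)]
    refine (norm_sum_le _ _).trans (Finset.sum_le_sum fun i _ => ?_)
    rw [CStarRing.norm_self_mul_star]
    have : ‖r x i‖ = ‖x i‖ := by
      change ‖InnerProductSpace.rankOne ℂ u (x i)‖ = _
      rw [InnerProductSpace.norm_rankOne, hu, one_mul]
    rw [this, sq]
  have key := inner_toCLM_eq A (r x) (r y)
  have hT : matrixForm A x y = ⟪u, (((∑ j, ∑ i, r x i * A i j * star (r y j) :
      (⊤ : VonNeumannAlgebra K))) : K →L[ℂ] K) u⟫_ℂ := by
    rw [finset_sum_apply, inner_sum, matrixForm, Finset.sum_comm]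
    refine Finset.sum_congr rfl fun j _ => ?_
    rw [finset_sum_apply, inner_sum]
    refine Finset.sum_congr rfl fun i _ => ?_
    have e : ((r x i * A i j * star (r y j) : (⊤ : VonNeumannAlgebra K)) : K →L[ℂ] K) u
      = (r x i : K →L[ℂ] K) ((A i j : K →L[ℂ] K)
        (((star (r y j) : (⊤ : VonNeumannAlgebra K)) : K →L[ℂ] K) u)) := rfl
    rw [e, hstar]
    simp [r, inner_smul_right, hu]
  rw [hT, ← key]
  set T := ⟪(equiv (⊤ : VonNeumannAlgebra K) _).symm (r y),
    CStarMatrix.toCLM A ((equiv (⊤ : VonNeumannAlgebra K) _).symm (r x))⟫_(⊤ : VonNeumannAlgebra K)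
  calc _ ≤ ‖u‖ * ‖(T : K →L[ℂ] K) u‖ := norm_inner_le_norm _ _
    _ ≤ ‖u‖ * (‖(T : K →L[ℂ] K)‖ * ‖u‖) := by gcongr; exact ContinuousLinearMap.le_opNorm _ _
    _ = ‖T‖ := by rw [hu, one_mul, mul_one]; rfl
    _ ≤ ‖(equiv (⊤ : VonNeumannAlgebra K) _).symm (r y)‖ *
      ‖CStarMatrix.toCLM A ((equiv (⊤ : VonNeumannAlgebra K) _).symm (r x))‖ :=
        CStarModule.norm_inner_le _
    _ ≤ √(∑ i, ‖y i‖ ^ 2) * (‖A‖ * √(∑ i, ‖x i‖ ^ 2)) := by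
        refine mul_le_mul (hnorm y) (((CStarMatrix.toCLM A).le_opNorm _).trans ?_)
          (norm_nonneg _) (Real.sqrt_nonneg _)
        rw [← CStarMatrix.norm_def]
        gcongr
        exact hnorm x
    _ = _ := by ring

theorem eq_zero_of_matrixAct_eq_zero (A : CStarMatrix (Fin n) (Fin n) M)
    (h : ∀ k, matrixAct A k = 0) : A = 0 := by
  rw [← norm_le_zero_iff]
  refine norm_le_of_norm_matrixForm_le A le_rfl fun u v => ?_
  rw [matrixForm_eq, h]
  simp

/-- Let P be the negative part of A and Q = √P. At the vector P k the form of A equals −‖QPk‖², so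
QP = 0, hence P² = Q(QP) = 0 and P = 0. -/
theorem nonneg_of_matrixForm_nonneg {A : CStarMatrix (Fin n) (Fin n) M} (hA : IsSelfAdjoint A)
    (h : ∀ k, 0 ≤ matrixForm A k k) : 0 ≤ A := by
  obtain ⟨P, Q, hPs, hQs, hQ, hAP, hA0⟩ := CStarAlgebra.exists_mul_eq_neg_mul_self hA
  refine hA0 ?_
  have hQP : Q * P = 0 := by
    refine eq_zero_of_matrixAct_eq_zero _ fun k => ?_
    have h1 : star P * (A * P) = -(star (Q * P) * (Q * P)) := by
      rw [hAP, star_mul, hPs, hQs, mul_neg, mul_assoc P Q, ← mul_assoc Q Q, hQ]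
    have h2 := h (matrixAct P k)
    rw [matrixForm_eq, ← matrixAct_mul, ← matrixForm_star_mul, h1] at h2
    have h3 : matrixForm (-(star (Q * P) * (Q * P))) k k
        = -matrixForm (star (Q * P) * (Q * P)) k k := by
      simp [matrixForm]
    rw [h3, matrixForm_star_mul_self] at h2
    have h4 : ∑ i, ‖matrixAct (Q * P) k i‖ ^ 2 ≤ 0 := by
      have h5 := (Complex.le_def.1 h2).1
      simp only [Complex.zero_re, Complex.neg_re, Complex.ofReal_re] at h5
      linarith
    ext i
    have h6 := (Finset.sum_eq_zero_iff_of_nonneg (fun i _ => sq_nonneg _)).1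
      (le_antisymm h4 (Finset.sum_nonneg fun i _ => sq_nonneg _)) i (Finset.mem_univ i)
    simpa using h6
  have hPP : star P * P = 0 := by
    rw [hPs]
    nth_rewrite 1 [← hQ]
    rw [mul_assoc, hQP, mul_zero]
  exact CStarRing.star_mul_self_eq_zero_iff P |>.1 hPP

end SpatialMatrix

end VonNeumannAlgebra

/-! ### GNS construction for positive kernels of functionals. -/

section Kolmogorov

open UniformSpace Completion
open scoped ComplexOrder

variable {J A : Type*} [CStarAlgebra A]

/-- The sesquilinear form on finitely supported functions `J → A` defined by a kernel on `J` with
values in the linear functionals on `A`. -/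
noncomputable def kernelForm (Ψ : J → J → A →ₗ[ℂ] ℂ) (a b : J →₀ A) : ℂ :=
  a.sum fun i x => b.sum fun j y => Ψ i j (star x * y)

namespace KernelForm

variable (Ψ : J → J → A →ₗ[ℂ] ℂ)

theorem add_left (a b c : J →₀ A) :
    kernelForm Ψ (a + b) c = kernelForm Ψ a c + kernelForm Ψ b c := by
  unfold kernelForm
  rw [Finsupp.sum_add_index']
  · simp
  · intro i x y
    simp [add_mul, Finsupp.sum_add]

theorem add_right (a b c : J →₀ A) :
    kernelForm Ψ a (b + c) = kernelForm Ψ a b + kernelForm Ψ a c := by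
  unfold kernelForm
  rw [← Finsupp.sum_add]
  refine Finsupp.sum_congr fun i _ => ?_
  rw [Finsupp.sum_add_index']
  · simp
  · intro i x y
    simp [mul_add]

theorem smul_left (z : ℂ) (a b : J →₀ A) :
    kernelForm Ψ (z • a) b = star z * kernelForm Ψ a b := by
  unfold kernelForm
  rw [Finsupp.sum_smul_index' (by simp), Finsupp.mul_sum]
  refine Finsupp.sum_congr fun i _ => ?_
  rw [Finsupp.mul_sum]
  simp

theorem smul_right (z : ℂ) (a b : J →₀ A) :
    kernelForm Ψ a (z • b) = z * kernelForm Ψ a b := by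
  unfold kernelForm
  rw [Finsupp.mul_sum]
  refine Finsupp.sum_congr fun i _ => ?_
  rw [Finsupp.sum_smul_index' (by simp), Finsupp.mul_sum]
  simp

/-- Polarization: the values of the form at a + b and a + i b are real. -/
theorem conj_symm (hΨ : ∀ a, 0 ≤ kernelForm Ψ a a) (a b : J →₀ A) :
    star (kernelForm Ψ b a) = kernelForm Ψ a b := by
  have h1 := (Complex.le_def.1 (hΨ (a + b))).2
  have h2 := (Complex.le_def.1 (hΨ (a + Complex.I • b))).2
  have ha := (Complex.le_def.1 (hΨ a)).2
  have hb := (Complex.le_def.1 (hΨ b)).2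
  simp only [add_left, add_right, smul_left, smul_right] at h1 h2
  simp at h1 h2 ha hb
  apply Complex.ext
  · simp; linarith
  · simp; linarith

/-- Left multiplication on finitely supported functions. -/
noncomputable def leftMul (c : A) : (J →₀ A) →ₗ[ℂ] (J →₀ A) :=
  Finsupp.mapRange.linearMap (LinearMap.mulLeft ℂ c)

theorem leftMul_left (c : A) (a b : J →₀ A) :
    kernelForm Ψ (leftMul c a) b = kernelForm Ψ a (leftMul (star c) b) := by
  unfold kernelForm leftMul
  simp only [Finsupp.mapRange.linearMap_apply]
  rw [Finsupp.sum_mapRange_index (by simp)]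
  refine Finsupp.sum_congr fun i _ => ?_
  rw [Finsupp.sum_mapRange_index (by simp)]
  simp [mul_assoc]

theorem leftMul_mul (c d : A) (a : J →₀ A) :
    leftMul (c * d) a = leftMul c (leftMul d a) := by
  ext i
  simp [leftMul]

theorem leftMul_one (a : J →₀ A) : leftMul 1 a = a := by
  ext i
  simp [leftMul]

theorem leftMul_add (c d : A) (a : J →₀ A) :
    leftMul (c + d) a = leftMul c a + leftMul d a := by
  ext i
  simp [leftMul, add_mul]

theorem leftMul_smul (z : ℂ) (c : A) (a : J →₀ A) :
    leftMul (z • c) a = z • leftMul c a := by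
  ext i
  simp [leftMul]

/-- The pre-Hilbert space of a positive kernel. -/
@[nolint unusedArguments]
def Pre (_ : ∀ a, 0 ≤ kernelForm Ψ a a) := J →₀ A

variable {Ψ} (hΨ : ∀ a, 0 ≤ kernelForm Ψ a a)

noncomputable instance : AddCommGroup (Pre Ψ hΨ) := inferInstanceAs (AddCommGroup (J →₀ A))
noncomputable instance : Module ℂ (Pre Ψ hΨ) := inferInstanceAs (Module ℂ (J →₀ A))

noncomputable abbrev core : PreInnerProductSpace.Core ℂ (Pre Ψ hΨ) where
  inner a b := kernelForm Ψ a b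
  conj_inner_symm a b := conj_symm Ψ hΨ a b
  re_inner_nonneg a := (Complex.le_def.1 (hΨ a)).1
  add_left := add_left Ψ
  smul_left a b z := smul_left Ψ z a b

noncomputable instance : SeminormedAddCommGroup (Pre Ψ hΨ) :=
  InnerProductSpace.Core.toSeminormedAddCommGroup (c := core hΨ)
noncomputable instance : InnerProductSpace ℂ (Pre Ψ hΨ) :=
  InnerProductSpace.ofCore (core hΨ)

/-- The identification of finitely supported functions with elements of the pre-Hilbert space. -/
noncomputable def toPre : (J →₀ A) ≃ₗ[ℂ] Pre Ψ hΨ := LinearEquiv.refl ℂ _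

theorem inner_toPre (a b : J →₀ A) : ⟪toPre hΨ a, toPre hΨ b⟫_ℂ = kernelForm Ψ a b := rfl

theorem norm_toPre_sq (a : J →₀ A) : ‖toPre hΨ a‖ ^ 2 = (kernelForm Ψ a a).re := by
  rw [← inner_toPre hΨ]
  exact (inner_self_eq_norm_sq (𝕜 := ℂ) _).symm

/-- Write ‖c‖² − c⋆c = d⋆d; positivity of the form at d·a is the required inequality. -/
theorem norm_leftMul_sq_le (c : A) (a : J →₀ A) :
    ‖toPre hΨ (leftMul c a)‖ ^ 2 ≤ (‖c‖ * ‖toPre hΨ a‖) ^ 2 := by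
  let _ := CStarAlgebra.spectralOrder A
  let _ := CStarAlgebra.spectralOrderedRing A
  have h0 : 0 ≤ algebraMap ℝ A (‖c‖ ^ 2) - star c * c := by
    rw [sub_nonneg, sq, ← CStarRing.norm_star_mul_self]
    exact (IsSelfAdjoint.star_mul_self c).le_algebraMap_norm_self
  obtain ⟨d, hd⟩ := CStarAlgebra.nonneg_iff_eq_star_mul_self.1 h0
  have h1 := hΨ (leftMul d a)
  rw [leftMul_left, ← leftMul_mul, ← hd] at h1
  have h2 : algebraMap ℝ A (‖c‖ ^ 2) - star c * c
      = ((‖c‖ ^ 2 : ℝ) : ℂ) • (1 : A) + (-1 : ℂ) • (star c * c) := by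
    rw [Algebra.algebraMap_eq_smul_one, Complex.coe_smul]
    simp [sub_eq_add_neg]
  rw [h2, leftMul_add, leftMul_smul, leftMul_smul, add_right, smul_right, smul_right, leftMul_one,
    leftMul_mul, ← leftMul_left] at h1
  have h3 := (Complex.le_def.1 h1).1
  rw [mul_pow, norm_toPre_sq, norm_toPre_sq]
  rw [Complex.add_re, Complex.re_ofReal_mul] at h3
  simp at h3
  linarith

/-- Left multiplication as a bounded operator on the pre-Hilbert space of a positive kernel. -/
noncomputable def leftMulL (c : A) : Pre Ψ hΨ →L[ℂ] Pre Ψ hΨ :=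
  LinearMap.mkContinuous ((toPre hΨ).toLinearMap ∘ₗ leftMul c ∘ₗ (toPre hΨ).symm.toLinearMap) ‖c‖
    fun a => by
      rw [← sq_le_sq₀ (norm_nonneg _) (by positivity)]
      exact norm_leftMul_sq_le hΨ c ((toPre hΨ).symm a)

theorem leftMulL_toPre (c : A) (a : J →₀ A) :
    leftMulL hΨ c (toPre hΨ a) = toPre hΨ (leftMul c a) := rfl

theorem completion_ext {S T : Completion (Pre Ψ hΨ) →L[ℂ] Completion (Pre Ψ hΨ)}
    (h : ∀ a : J →₀ A, S (toPre hΨ a : Completion (Pre Ψ hΨ)) = T (toPre hΨ a)) : S = T := by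
  ext x
  induction x using Completion.induction_on with
  | hp => exact isClosed_eq S.continuous T.continuous
  | ih a => exact h ((toPre hΨ).symm a)

theorem completion_leftMulL_toPre (c : A) (a : J →₀ A) :
    (leftMulL hΨ c).completion (toPre hΨ a : Completion (Pre Ψ hΨ)) = toPre hΨ (leftMul c a) := by
  rw [ContinuousLinearMap.completion_apply_coe, leftMulL_toPre]

/-- The representation on the Hilbert space of a positive kernel. -/
noncomputable def rep : A →⋆ₐ[ℂ] (Completion (Pre Ψ hΨ) →L[ℂ] Completion (Pre Ψ hΨ)) where
  toFun c := (leftMulL hΨ c).completion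
  map_one' := completion_ext hΨ fun a => by
    rw [completion_leftMulL_toPre, leftMul_one]; rfl
  map_mul' c d := completion_ext hΨ fun a => by
    rw [mul_apply_eq_comp, completion_leftMulL_toPre,
      completion_leftMulL_toPre, completion_leftMulL_toPre, leftMul_mul]
  map_zero' := completion_ext hΨ fun a => by
    rw [completion_leftMulL_toPre, show (0 : A) = (0 : ℂ) • (0 : A) by simp, leftMul_smul,
      zero_smul, map_zero, Completion.coe_zero]; rfl
  map_add' c d := completion_ext hΨ fun a => by
    rw [add_apply, completion_leftMulL_toPre, completion_leftMulL_toPre,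
      completion_leftMulL_toPre, leftMul_add, ← Completion.coe_add, map_add]
  commutes' z := completion_ext hΨ fun a => by
    rw [completion_leftMulL_toPre, Algebra.algebraMap_eq_smul_one,
      leftMul_smul, leftMul_one, Algebra.algebraMap_eq_smul_one, map_smul]
    exact Completion.coe_smul z _
  map_star' c := by
    refine (ContinuousLinearMap.eq_adjoint_iff _ _).2 fun x y => ?_
    induction x, y using Completion.induction_on₂ with
    | hp => apply isClosed_eq <;> fun_prop
    | ih a b =>
      obtain ⟨a, rfl⟩ := (toPre hΨ).surjective a
      obtain ⟨b, rfl⟩ := (toPre hΨ).surjective b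
      rw [completion_leftMulL_toPre, completion_leftMulL_toPre,
        Completion.inner_coe, Completion.inner_coe, inner_toPre, inner_toPre, leftMul_left, star_star]

end KernelForm

open KernelForm in
/-- **Kolmogorov decomposition** of a positive kernel with values in functionals on a
C⋆-algebra. -/
theorem exists_kolmogorov_decomposition.{w, z} {J : Type w} {A : Type z} [CStarAlgebra A]
    (Ψ : J → J → A →ₗ[ℂ] ℂ) (hΨ : ∀ a, 0 ≤ kernelForm Ψ a a) :
    ∃ (L : Type (max w z)) (_ : NormedAddCommGroup L) (_ : InnerProductSpace ℂ L) (_ : CompleteSpace L)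
      (π : A →⋆ₐ[ℂ] (L →L[ℂ] L)) (e : J → L), ∀ i j a, ⟪e i, π a (e j)⟫_ℂ = Ψ i j a := by
  classical
  -- The vector attached to an index i is the class of the function with value 1 at i and 0
  -- elsewhere.
  refine ⟨Completion (Pre Ψ hΨ), inferInstance, inferInstance, inferInstance, rep hΨ,
    fun i => (toPre hΨ (Finsupp.single i 1) : Completion (Pre Ψ hΨ)), fun i j a => ?_⟩
  change ⟪_, (leftMulL hΨ a).completion _⟫_ℂ = _
  rw [completion_leftMulL_toPre, Completion.inner_coe, inner_toPre]
  simp [kernelForm, leftMul]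

end Kolmogorov

namespace VonNeumannAlgebra

open Filter Topology
open scoped ComplexOrder NNReal

/-! ### Scalar matrices acting on Hⁿ. -/

section ScalarMatrices

variable {H : Type*} [NormedAddCommGroup H] [InnerProductSpace ℂ H] {n : ℕ}

/-- The action of a scalar matrix on `Hⁿ`. -/
def scalarAct (b : Matrix (Fin n) (Fin n) ℂ) (u : Fin n → H) : Fin n → H :=
  fun i => ∑ j, b i j • u j

/-- The form on `Hⁿ` defined by a scalar matrix. -/
noncomputable def scalarForm (B : Matrix (Fin n) (Fin n) ℂ) (u : Fin n → H) : ℂ :=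
  ∑ i, ∑ j, B i j * ⟪u i, u j⟫_ℂ

theorem scalarAct_mul (b c : Matrix (Fin n) (Fin n) ℂ) (u : Fin n → H) :
    scalarAct (b * c) u = scalarAct b (scalarAct c u) := by
  ext i
  simp only [scalarAct, Matrix.mul_apply, Finset.smul_sum, Finset.sum_smul, smul_smul]
  exact Finset.sum_comm

theorem scalarAct_one (u : Fin n → H) : scalarAct 1 u = u := by
  ext i
  simp [scalarAct, Matrix.one_apply]

theorem sum_inner_self (u : Fin n → H) :
    ∑ i, ⟪u i, u i⟫_ℂ = ((∑ i, ‖u i‖ ^ 2 : ℝ) : ℂ) := by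
  push_cast
  exact Finset.sum_congr rfl fun i _ => inner_self_eq_norm_sq_to_K _

theorem scalarForm_conjTranspose_mul_self (b : Matrix (Fin n) (Fin n) ℂ) (u : Fin n → H) :
    scalarForm (b.conjTranspose * b) u = ((∑ i, ‖scalarAct b u i‖ ^ 2 : ℝ) : ℂ) := by
  have e2 : ∀ k, ⟪scalarAct b u k, scalarAct b u k⟫_ℂ
      = ∑ i, ∑ j, star (b k i) * b k j * ⟪u i, u j⟫_ℂ := by
    intro k
    simp only [scalarAct, sum_inner]
    refine Finset.sum_congr rfl fun i _ => ?_
    rw [inner_sum]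
    refine Finset.sum_congr rfl fun j _ => ?_
    rw [inner_smul_left, inner_smul_right, mul_assoc]
    rfl
  rw [← sum_inner_self, Finset.sum_congr rfl fun k _ => e2 k, Finset.sum_comm, scalarForm]
  refine Finset.sum_congr rfl fun i _ => ?_
  rw [Finset.sum_comm]
  refine Finset.sum_congr rfl fun j _ => ?_
  rw [Matrix.mul_apply, Finset.sum_mul]
  rfl

theorem scalarForm_add (B D : Matrix (Fin n) (Fin n) ℂ) (u : Fin n → H) :
    scalarForm (B + D) u = scalarForm B u + scalarForm D u := by
  simp [scalarForm, add_mul, Finset.sum_add_distrib]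

theorem scalarForm_smul (z : ℂ) (B : Matrix (Fin n) (Fin n) ℂ) (u : Fin n → H) :
    scalarForm (z • B) u = z * scalarForm B u := by
  simp [scalarForm, Finset.mul_sum, mul_assoc]

theorem scalarForm_one (u : Fin n → H) : scalarForm 1 u = ((∑ i, ‖u i‖ ^ 2 : ℝ) : ℂ) := by
  have := scalarForm_conjTranspose_mul_self 1 u
  rwa [Matrix.conjTranspose_one, one_mul, scalarAct_one] at this

theorem scalarForm_conjTranspose (B : Matrix (Fin n) (Fin n) ℂ) (u : Fin n → H) :
    scalarForm B.conjTranspose u = star (scalarForm B u) := by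
  simp only [scalarForm, star_sum, star_mul', Matrix.conjTranspose_apply]
  rw [Finset.sum_comm]
  refine Finset.sum_congr rfl fun i _ => Finset.sum_congr rfl fun j _ => ?_
  exact congrArg _ (inner_conj_symm _ _).symm

/-- The real part of the form of `B` is the form of the Hermitian part of `B`. -/
theorem scalarForm_hermitianPart (B : Matrix (Fin n) (Fin n) ℂ) (u : Fin n → H) :
    scalarForm ((1 / 2 : ℂ) • (B + B.conjTranspose)) u = ((scalarForm B u).re : ℂ) := by
  rw [scalarForm_smul, scalarForm_add, scalarForm_conjTranspose, Complex.star_def,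
    Complex.add_conj]
  push_cast
  ring

/-- On multiples of one fixed unit vector of `H` the form is the ordinary quadratic form of the
matrix on ℂⁿ. -/
theorem posSemidef_hermitianPart [Nontrivial H] (B : Matrix (Fin n) (Fin n) ℂ)
    (hB : ∀ u : Fin n → H, 0 ≤ (scalarForm B u).re) :
    ((1 / 2 : ℂ) • (B + B.conjTranspose)).PosSemidef := by
  obtain ⟨e, he⟩ := exists_norm_eq H (zero_le_one (α := ℝ))
  refine Matrix.PosSemidef.of_dotProduct_mulVec_nonneg ?_ fun x => ?_
  · rw [Matrix.IsHermitian, Matrix.conjTranspose_smul, Matrix.conjTranspose_add,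
      Matrix.conjTranspose_conjTranspose, add_comm]
    simp
  · have h1 := scalarForm_hermitianPart B fun i => x i • e
    have h2 : scalarForm ((1 / 2 : ℂ) • (B + B.conjTranspose)) (fun i => x i • e)
        = star x ⬝ᵥ ((1 / 2 : ℂ) • (B + B.conjTranspose)).mulVec x := by
      simp only [scalarForm, dotProduct, Matrix.mulVec, Finset.mul_sum]
      refine Finset.sum_congr rfl fun i _ => Finset.sum_congr rfl fun j _ => ?_
      rw [inner_smul_left, inner_smul_right, inner_self_eq_norm_sq_to_K, he]
      simp
      ring
    rw [← h2, h1]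
    exact_mod_cast hB _

open scoped MatrixOrder Matrix.Norms.L2Operator in
theorem _root_.Matrix.PosDef.exists_conjTranspose_mul_self {B : Matrix (Fin n) (Fin n) ℂ}
    (hB : B.PosDef) : ∃ b c : Matrix (Fin n) (Fin n) ℂ, B = b.conjTranspose * b ∧
      b * c = 1 ∧ c * b = 1 := by
  obtain ⟨b, hb⟩ := CStarAlgebra.nonneg_iff_eq_star_mul_self.mp hB.posSemidef.nonneg
  have hdet : IsUnit b.det := by
    have h1 := hB.isUnit
    rw [hb, Matrix.isUnit_iff_isUnit_det, Matrix.det_mul] at h1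
    exact isUnit_of_mul_isUnit_right h1
  exact ⟨b, b⁻¹, hb, Matrix.mul_nonsing_inv b hdet, Matrix.nonsing_inv_mul b hdet⟩

theorem sum_norm_scalarAct_sq {B b : Matrix (Fin n) (Fin n) ℂ} {ε : ℝ}
    (hb : (1 / 2 : ℂ) • (B + B.conjTranspose) + (ε : ℂ) • (1 : Matrix (Fin n) (Fin n) ℂ)
      = b.conjTranspose * b) (u : Fin n → H) :
    ∑ i, ‖scalarAct b u i‖ ^ 2 = (scalarForm B u).re + ε * ∑ i, ‖u i‖ ^ 2 := by
  have h1 := scalarForm_conjTranspose_mul_self b u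
  rw [← hb, scalarForm_add, scalarForm_hermitianPart, scalarForm_smul, scalarForm_one] at h1
  exact_mod_cast h1.symm

end ScalarMatrices

/-! ### Scalar congruences and domination of forms. -/

section Congruence

variable {H : Type*} [NormedAddCommGroup H] [InnerProductSpace ℂ H] [CompleteSpace H]
variable {K : Type*} [NormedAddCommGroup K] [InnerProductSpace ℂ K] [CompleteSpace K]
variable {M : VonNeumannAlgebra H} {N : VonNeumannAlgebra K} {n : ℕ}

/-- The congruence transform of a matrix over `M` by a scalar matrix. -/
noncomputable def scalarConj (c : Matrix (Fin n) (Fin n) ℂ) (W : CStarMatrix (Fin n) (Fin n) M) :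
    CStarMatrix (Fin n) (Fin n) M :=
  CStarMatrix.ofMatrix fun k l => ∑ i, ∑ j, (star (c i k) * c j l) • W i j

theorem scalarConj_apply (c : Matrix (Fin n) (Fin n) ℂ) (W : CStarMatrix (Fin n) (Fin n) M) (k l) :
    scalarConj c W k l = ∑ i, ∑ j, (star (c i k) * c j l) • W i j := rfl

theorem matrixForm_scalarConj (c : Matrix (Fin n) (Fin n) ℂ) (W : CStarMatrix (Fin n) (Fin n) M)
    (h k : Fin n → H) :
    matrixForm (scalarConj c W) h k = matrixForm W (scalarAct c h) (scalarAct c k) := by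
  simp only [matrixForm, scalarConj_apply, scalarAct, sum_inner, inner_sum, map_sum,
    finset_sum_apply, map_smul, inner_smul_left, inner_smul_right]
  have e : ∀ (z : ℂ) (a : M) (u : H), ((z • a : M) : H →L[ℂ] H) u = z • (a : H →L[ℂ] H) u :=
    fun _ _ _ => rfl
  simp only [e, inner_smul_right, mul_assoc]
  calc _ = ∑ p, ∑ i, ∑ q, ∑ j, star (c i p) * (c j q * ⟪h p, (W i j : H →L[ℂ] H) (k q)⟫_ℂ) :=
        Finset.sum_congr rfl fun p _ => Finset.sum_comm
    _ = ∑ p, ∑ i, ∑ j, ∑ q, star (c i p) * (c j q * ⟪h p, (W i j : H →L[ℂ] H) (k q)⟫_ℂ) :=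
        Finset.sum_congr rfl fun p _ => Finset.sum_congr rfl fun i _ => Finset.sum_comm
    _ = ∑ i, ∑ p, ∑ j, ∑ q, star (c i p) * (c j q * ⟪h p, (W i j : H →L[ℂ] H) (k q)⟫_ℂ) :=
        Finset.sum_comm
    _ = ∑ i, ∑ j, ∑ p, ∑ q, star (c i p) * (c j q * ⟪h p, (W i j : H →L[ℂ] H) (k q)⟫_ℂ) :=
        Finset.sum_congr rfl fun i _ => Finset.sum_comm
    _ = _ := by
      refine Finset.sum_congr rfl fun i _ => Finset.sum_congr rfl fun j _ => ?_
      rw [Finset.sum_comm]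
      refine Finset.sum_congr rfl fun q _ => ?_
      rw [Finset.mul_sum]
      refine Finset.sum_congr rfl fun p _ => ?_
      rw [Complex.star_def]; ring

/-- Linearity lets a scalar congruence pass through `E`, so matrices can be normalized by congruence
before `E` is applied. -/
theorem map_scalarConj (E : M →ₗ[ℂ] N) (c : Matrix (Fin n) (Fin n) ℂ)
    (W : CStarMatrix (Fin n) (Fin n) M) :
    (scalarConj c W).map E = scalarConj c (W.map E) := by
  ext k l
  simp [scalarConj_apply]

theorem matrixForm_smul_smul (W : CStarMatrix (Fin n) (Fin n) M) (s t : ℂ) (h k : Fin n → H) :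
    matrixForm W (s • h) (t • k) = star s * t * matrixForm W h k := by
  simp only [matrixForm, Finset.mul_sum, Pi.smul_apply, map_smul, inner_smul_left, inner_smul_right]
  refine Finset.sum_congr rfl fun i _ => Finset.sum_congr rfl fun j _ => ?_
  rw [Complex.star_def]; ring

/-- The form is unchanged under h ↦ t h, k ↦ t⁻¹ k for t > 0. With t² = ‖k‖ / ‖h‖ the sum of squares
becomes 2‖h‖‖k‖. -/
theorem norm_le_two_of_norm_matrixForm_le_add (Z : CStarMatrix (Fin n) (Fin n) M)
    (hZ : ∀ h k : Fin n → H, ‖matrixForm Z h k‖ ≤ ∑ i, ‖h i‖ ^ 2 + ∑ i, ‖k i‖ ^ 2) : ‖Z‖ ≤ 2 := by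
  refine norm_le_of_norm_matrixForm_le Z zero_le_two fun h k => ?_
  set a := √(∑ i, ‖h i‖ ^ 2) with ha
  set b := √(∑ i, ‖k i‖ ^ 2) with hb
  have ha2 : a ^ 2 = ∑ i, ‖h i‖ ^ 2 := Real.sq_sqrt (by positivity)
  have hb2 : b ^ 2 = ∑ i, ‖k i‖ ^ 2 := Real.sq_sqrt (by positivity)
  have ha0 : 0 ≤ a := Real.sqrt_nonneg _
  have hb0 : 0 ≤ b := Real.sqrt_nonneg _
  have hzero : ∀ u : Fin n → H, ∑ i, ‖u i‖ ^ 2 = 0 → u = 0 := by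
    intro u hu
    ext i
    have h6 := (Finset.sum_eq_zero_iff_of_nonneg (fun i _ => sq_nonneg _)).1 hu i (Finset.mem_univ i)
    simpa using h6
  rcases ha0.eq_or_lt with h0 | hapos
  · have : h = 0 := hzero h (by rw [← ha2, ← h0]; norm_num)
    rw [this]
    simp [matrixForm, ← h0]
  rcases hb0.eq_or_lt with h0 | hbpos
  · have : k = 0 := hzero k (by rw [← hb2, ← h0]; norm_num)
    rw [this]
    simp [matrixForm, ← h0]
  have h1 := hZ (((√(b / a) : ℝ) : ℂ) • h) (((√(b / a))⁻¹ : ℝ) • k)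
  have ht : 0 < √(b / a) := by positivity
  have ht2 : √(b / a) ^ 2 = b / a := Real.sq_sqrt (by positivity)
  rw [show (((√(b / a))⁻¹ : ℝ) • k) = (((√(b / a))⁻¹ : ℝ) : ℂ) • k from rfl,
    matrixForm_smul_smul] at h1
  have h2 : star ((√(b / a) : ℝ) : ℂ) * (((√(b / a))⁻¹ : ℝ) : ℂ) = 1 := by
    rw [Complex.star_def, Complex.conj_ofReal, ← Complex.ofReal_mul, mul_inv_cancel₀ ht.ne',
      Complex.ofReal_one]
  rw [h2, one_mul] at h1
  refine h1.trans (le_of_eq ?_)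
  simp only [Pi.smul_apply, norm_smul, mul_pow, ← Finset.mul_sum, ← ha2, ← hb2,
    Complex.norm_real, Real.norm_eq_abs, sq_abs, inv_pow, ht2]
  field_simp
  ring

/-- The Hermitian part of B may be singular, so ε is added and the sum is written b⋆b. Congruence by
b⁻¹ brings W to norm at most 2, the amplified `E` multiplies this by at most C, and congruence by b
undoes the normalization. Then ε tends to 0. -/
theorem norm_matrixForm_map_le [Nontrivial H] (E : M →ₗ[ℂ] (⊤ : VonNeumannAlgebra K)) {C : ℝ}
    (hE : ∀ (n : ℕ) (A : CStarMatrix (Fin n) (Fin n) M), ‖A.map E‖ ≤ C * ‖A‖) (hC : 0 ≤ C)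
    (W : CStarMatrix (Fin n) (Fin n) M) (B : Matrix (Fin n) (Fin n) ℂ)
    (hW : ∀ u v : Fin n → H, ‖matrixForm W u v‖ ≤ (scalarForm B u).re + (scalarForm B v).re)
    (x : Fin n → K) :
    ‖matrixForm (W.map E) x x‖ ≤ 2 * C * (scalarForm B x).re := by
  have hpos : ∀ u : Fin n → H, 0 ≤ (scalarForm B u).re := by
    intro u
    have h1 := (norm_nonneg _).trans (hW u 0)
    simpa [scalarForm] using h1
  have hpsd := posSemidef_hermitianPart B hpos
  have key : ∀ ε : ℝ, 0 < ε → ‖matrixForm (W.map E) x x‖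
      ≤ 2 * C * ((scalarForm B x).re + ε * ∑ i, ‖x i‖ ^ 2) := by
    intro ε hε
    have hpd : ((1 / 2 : ℂ) • (B + B.conjTranspose) + (ε : ℂ) • (1 : Matrix (Fin n) (Fin n) ℂ)).PosDef := by
      refine Matrix.PosDef.posSemidef_add hpsd ?_
      exact Matrix.PosDef.one.smul (by exact_mod_cast hε)
    obtain ⟨b, c, hb, hbc, hcb⟩ := hpd.exists_conjTranspose_mul_self
    have hZ : ‖scalarConj c W‖ ≤ 2 := by
      refine norm_le_two_of_norm_matrixForm_le_add _ fun h k => ?_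
      have hb' : ∀ u : Fin n → H, (scalarForm B (scalarAct c u)).re ≤ ∑ i, ‖u i‖ ^ 2 := by
        intro u
        have h1 := sum_norm_scalarAct_sq hb (scalarAct c u)
        rw [← scalarAct_mul, hbc, scalarAct_one] at h1
        rw [h1]
        have : 0 ≤ ε * ∑ i, ‖scalarAct c u i‖ ^ 2 := by positivity
        linarith
      rw [matrixForm_scalarConj]
      exact (hW _ _).trans (add_le_add (hb' h) (hb' k))
    have hx : matrixForm (W.map E) x x
        = matrixForm ((scalarConj c W).map E) (scalarAct b x) (scalarAct b x) := by
      rw [map_scalarConj, matrixForm_scalarConj, ← scalarAct_mul, hcb, scalarAct_one]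
    rw [hx, ← sum_norm_scalarAct_sq hb x]
    refine (norm_matrixForm_le _ _ _).trans ?_
    rw [mul_assoc, Real.mul_self_sqrt (by positivity)]
    gcongr
    exact (hE n _).trans (by nlinarith)
  refine le_of_forall_pos_le_add fun δ hδ => ?_
  set R := 2 * C * ∑ i, ‖x i‖ ^ 2 with hR
  have hR0 : 0 ≤ R := by positivity
  refine (key (δ / (R + 1)) (by positivity)).trans ?_
  have h1 : δ / (R + 1) * R ≤ δ := by
    rw [div_mul_eq_mul_div, div_le_iff₀ (by positivity)]
    nlinarith
  calc _ = 2 * C * (scalarForm B x).re + δ / (R + 1) * R := by rw [hR]; ring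
    _ ≤ _ := by linarith

end Congruence

/-! ### The positivity estimate for matrices with scalar diagonal blocks. -/

section OffDiagonal

variable {H : Type*} [NormedAddCommGroup H] [InnerProductSpace ℂ H] [CompleteSpace H]
variable {K : Type*} [NormedAddCommGroup K] [InnerProductSpace ℂ K] [CompleteSpace K]
variable {M : VonNeumannAlgebra H} {n : ℕ}

theorem matrixForm_add (A B : CStarMatrix (Fin n) (Fin n) M) (h k : Fin n → H) :
    matrixForm (A + B) h k = matrixForm A h k + matrixForm B h k := by
  simp [matrixForm, Finset.sum_add_distrib]

theorem matrixForm_star_self (A : CStarMatrix (Fin n) (Fin n) M) (h : Fin n → H) :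
    matrixForm (star A) h h = star (matrixForm A h h) := by
  rw [matrixForm_star, matrixForm_eq, star_sum]
  exact Finset.sum_congr rfl fun i _ => (inner_conj_symm _ _).symm

/-- The block `(s, t)` of a matrix whose indices are coloured by `ℓ`. -/
noncomputable def colourBlock (ℓ : Fin n → Bool) (s t : Bool) (X : CStarMatrix (Fin n) (Fin n) M) :
    CStarMatrix (Fin n) (Fin n) M :=
  CStarMatrix.ofMatrix fun i j => if ℓ i = s ∧ ℓ j = t then X i j else 0

theorem colourBlock_apply (ℓ : Fin n → Bool) (s t : Bool) (X : CStarMatrix (Fin n) (Fin n) M)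
    (i j) : colourBlock ℓ s t X i j = if ℓ i = s ∧ ℓ j = t then X i j else 0 := rfl

/-- The part of a vector supported on the indices of colour `s`. -/
def colourPart (ℓ : Fin n → Bool) (s : Bool) (u : Fin n → H) : Fin n → H :=
  fun i => if ℓ i = s then u i else 0

theorem exists_unimodular_mul_eq_neg_norm (z : ℂ) : ∃ θ : ℂ, star θ * θ = 1 ∧ θ * z = -(‖z‖ : ℂ) := by
  rcases eq_or_ne z 0 with rfl | hz
  · exact ⟨1, by simp⟩
  · have h : (‖z‖ : ℂ) ≠ 0 := by simpa using hz
    have h2 : starRingEnd ℂ z * z = (‖z‖ : ℂ) ^ 2 := by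
      rw [mul_comm]; exact RCLike.mul_conj z
    refine ⟨-(star z / ‖z‖), ?_, ?_⟩
    · simp only [star_neg, star_div₀, Complex.star_def, Complex.conj_ofReal, Complex.conj_conj]
      field_simp
      linear_combination h2
    · rw [Complex.star_def]
      field_simp
      linear_combination -h2

/-- The numerical inequality behind the Wittstock factorization. -/
theorem offDiagonal_nonneg [Nontrivial H] (E : M →ₗ[ℂ] (⊤ : VonNeumannAlgebra K)) {C : ℝ}
    (hE : ∀ (n : ℕ) (A : CStarMatrix (Fin n) (Fin n) M), ‖A.map E‖ ≤ C * ‖A‖) (hC : 0 ≤ C)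
    (ℓ : Fin n → Bool) (X : CStarMatrix (Fin n) (Fin n) M) (B : Matrix (Fin n) (Fin n) ℂ)
    (hXB : ∀ i j, ℓ i = ℓ j → X i j = B i j • (1 : M)) (hB : ∀ i j, ℓ i ≠ ℓ j → B i j = 0)
    (hX : ∀ u, 0 ≤ (matrixForm X u u).re) (x : Fin n → K) :
    0 ≤ (∑ i, ∑ j, if ℓ i = ℓ j then 2 * (C : ℂ) * B i j * ⟪x i, x j⟫_ℂ else if ℓ i then
      ⟪x i, (E (X i j) : K →L[ℂ] K) (x j)⟫_ℂ else ⟪(E (star (X i j)) : K →L[ℂ] K) (x i), x j⟫_ℂ).re := by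
  set T := colourBlock ℓ true false X with hT
  set T' := colourBlock ℓ false true X with hT'
  -- Replacing the block `T'` by its adjoint does not change the real part of the quadratic form,
  -- and leaves a matrix supported in the single block (true, false).
  set W := T + star T' with hW
  have hself : ∀ u : Fin n → H, (matrixForm X u u).re
      = (scalarForm B u).re + (matrixForm W u u).re := by
    intro u
    have h1 : matrixForm X u u = scalarForm B u + (matrixForm T u u + matrixForm T' u u) := by
      simp only [matrixForm, scalarForm, ← Finset.sum_add_distrib]
      refine Finset.sum_congr rfl fun i _ => Finset.sum_congr rfl fun j _ => ?_
      rw [hT, hT', colourBlock_apply, colourBlock_apply]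
      by_cases h : ℓ i = ℓ j
      · rw [hXB i j h]
        cases h1 : ℓ i <;> rw [h1] at h <;> simp [← h]
      · rw [hB i j h]
        cases h1 : ℓ i <;> cases h2 : ℓ j <;> simp_all
    rw [h1, hW, matrixForm_add, matrixForm_star_self]
    simp
  have hWcol : ∀ i j, ¬(ℓ i = true ∧ ℓ j = false) → W i j = 0 := by
    intro i j h
    rw [hW, CStarMatrix.add_apply, CStarMatrix.star_apply, hT, hT', colourBlock_apply,
      colourBlock_apply, if_neg h, if_neg (by tauto)]
    simp
  have hWpart : ∀ u v : Fin n → H,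
      matrixForm W u v = matrixForm W (colourPart ℓ true u) (colourPart ℓ false v) := by
    intro u v
    refine Finset.sum_congr rfl fun i _ => Finset.sum_congr rfl fun j _ => ?_
    by_cases h : ℓ i = true ∧ ℓ j = false
    · simp [colourPart, h.1, h.2]
    · simp [hWcol i j h]
  have hpart0 : ∀ (s : Bool) (u : Fin n → H),
      matrixForm W (colourPart ℓ s u) (colourPart ℓ s u) = 0 := by
    intro s u
    refine Finset.sum_eq_zero fun i _ => Finset.sum_eq_zero fun j _ => ?_
    by_cases h : ℓ i = true ∧ ℓ j = false
    · cases s <;> simp [colourPart, h.1, h.2]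
    · simp [hWcol i j h]
  have hBpart : ∀ (s : Bool) (u : Fin n → H), 0 ≤ (scalarForm B (colourPart ℓ s u)).re := by
    intro s u
    have h1 := hX (colourPart ℓ s u)
    rwa [hself, hpart0, Complex.zero_re, add_zero] at h1
  have hBsum : ∀ (θ : ℂ) (u v : Fin n → H),
      scalarForm B (colourPart ℓ true u + θ • colourPart ℓ false v)
        = scalarForm B (colourPart ℓ true u) + star θ * θ * scalarForm B (colourPart ℓ false v) := by
    intro θ u v
    simp only [scalarForm, Finset.mul_sum, ← Finset.sum_add_distrib]
    refine Finset.sum_congr rfl fun i _ => Finset.sum_congr rfl fun j _ => ?_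
    by_cases h : ℓ i = ℓ j
    · cases h1 : ℓ j <;> rw [h1] at h <;>
        simp [colourPart, h, h1] <;> ring
    · simp [hB i j h]
  -- The test vector combines the true part of u with θ times the false part of v, where the phase θ
  -- turns the W-term into −|W(u, v)|. The parts of u and v not used contribute nonnegative B-terms.
  have hdom : ∀ u v : Fin n → H,
      ‖matrixForm W u v‖ ≤ (scalarForm B u).re + (scalarForm B v).re := by
    intro u v
    obtain ⟨θ, hθ, hθz⟩ := exists_unimodular_mul_eq_neg_norm (matrixForm W u v)
    have h1 := hX (colourPart ℓ true u + θ • colourPart ℓ false v)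
    have h2 : matrixForm W (colourPart ℓ true u + θ • colourPart ℓ false v)
        (colourPart ℓ true u + θ • colourPart ℓ false v) = θ * matrixForm W u v := by
      rw [hWpart u v]
      simp only [matrixForm, Finset.mul_sum]
      refine Finset.sum_congr rfl fun i _ => Finset.sum_congr rfl fun j _ => ?_
      by_cases h : ℓ i = true ∧ ℓ j = false
      · simp [colourPart, h.1, h.2]
      · simp [hWcol i j h]
    rw [hself, hBsum, h2, hθ, hθz, one_mul] at h1
    have hsplit : ∀ w : Fin n → H, (scalarForm B w).re
        = (scalarForm B (colourPart ℓ true w)).re + (scalarForm B (colourPart ℓ false w)).re := by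
      intro w
      have h3 := hBsum 1 w w
      have h4 : colourPart ℓ true w + (1 : ℂ) • colourPart ℓ false w = w := by
        ext i
        cases h : ℓ i <;> simp [colourPart, h]
      rw [h4] at h3
      rw [h3]
      simp
    have h5 := hBpart false u
    have h6 := hBpart true v
    rw [hsplit u, hsplit v]
    simp only [Complex.add_re, Complex.neg_re, Complex.ofReal_re] at h1
    linarith
  have hmain := norm_matrixForm_map_le E hE hC W B hdom x
  -- In the block (false, true) the entry enters through `E (star _)` on the left of the inner
  -- product; this is the conjugate of the form of `E` applied to the adjoint of `T'`.
  have hsum : (∑ i, ∑ j, if ℓ i = ℓ j then 2 * (C : ℂ) * B i j * ⟪x i, x j⟫_ℂ else if ℓ i then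
      ⟪x i, (E (X i j) : K →L[ℂ] K) (x j)⟫_ℂ else ⟪(E (star (X i j)) : K →L[ℂ] K) (x i), x j⟫_ℂ)
      = 2 * C * scalarForm B x + (matrixForm (T.map E) x x
        + star (matrixForm ((star T').map E) x x)) := by
    have h1 : star (matrixForm ((star T').map E) x x)
        = ∑ i, ∑ j, ⟪(E (star (T' i j)) : K →L[ℂ] K) (x i), x j⟫_ℂ := by
      simp only [matrixForm, star_sum]
      rw [Finset.sum_comm]
      exact Finset.sum_congr rfl fun i _ => Finset.sum_congr rfl fun j _ => inner_conj_symm _ _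
    rw [h1]
    simp only [matrixForm, scalarForm, Finset.mul_sum, ← Finset.sum_add_distrib]
    refine Finset.sum_congr rfl fun i _ => Finset.sum_congr rfl fun j _ => ?_
    rw [CStarMatrix.map_apply, hT, hT', colourBlock_apply, colourBlock_apply]
    by_cases h : ℓ i = ℓ j
    · rw [if_pos h, if_neg (by rw [h]; simp), if_neg (by rw [h]; simp)]
      simp [mul_assoc]
    · rw [if_neg h, hB i j h]
      cases h1 : ℓ i <;> cases h2 : ℓ j <;> simp [h1, h2] at h ⊢
  have hWE : matrixForm (W.map E) x x
      = matrixForm (T.map E) x x + matrixForm ((star T').map E) x x := by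
    rw [← matrixForm_add]
    congr 1
    ext i j
    simp [hW]
  rw [hsum]
  have h1 : (2 * (C : ℂ) * scalarForm B x).re = 2 * C * (scalarForm B x).re := by
    rw [show 2 * (C : ℂ) = ((2 * C : ℝ) : ℂ) by push_cast; rfl, Complex.re_ofReal_mul]
  have h2 := Complex.abs_re_le_norm (matrixForm (W.map E) x x)
  rw [hWE] at h2 hmain
  have h3 := (abs_le.1 (h2.trans hmain)).1
  simp only [Complex.add_re, h1, Complex.star_def, Complex.conj_re] at h3 ⊢
  linarith

end OffDiagonal

/-! ### Wittstock factorization by Riesz extension. -/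

section Factorization

variable {H : Type*} [NormedAddCommGroup H] [InnerProductSpace ℂ H] [CompleteSpace H]
variable {K : Type*} [NormedAddCommGroup K] [InnerProductSpace ℂ K] [CompleteSpace K]
variable {M : VonNeumannAlgebra H} {N : VonNeumannAlgebra K}

/-- The functional `a ↦ ⟪h, a k⟫` on a von Neumann algebra. -/
noncomputable def vectorFunctional (M : VonNeumannAlgebra H) (h k : H) : M →ₗ[ℂ] ℂ where
  toFun a := ⟪h, (a : H →L[ℂ] H) k⟫_ℂ
  map_add' a b := by simp
  map_smul' z a := inner_smul_right _ _ _

theorem vectorFunctional_apply (h k : H) (a : M) :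
    vectorFunctional M h k a = ⟪h, (a : H →L[ℂ] H) k⟫_ℂ := rfl

/-- The functional `a ↦ ⟪E(a⋆) x, y⟫`. -/
noncomputable def adjointFunctional (E : M →ₗ[ℂ] N) (x y : K) : M →ₗ[ℂ] ℂ where
  toFun a := ⟪(E (star a) : K →L[ℂ] K) x, y⟫_ℂ
  map_add' a b := by simp
  map_smul' z a := by
    rw [star_smul, map_smul]
    refine (inner_smul_left _ _ _).trans ?_
    simp

/-- The vector underlying an element of `K ⊕ K`. -/
def sumVal {K : Type*} : K ⊕ K → K := Sum.elim id id

/-- The functionals which the Wittstock factorization of `E` extends. -/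
noncomputable def wittstockKernel (E : M →ₗ[ℂ] N) (C : ℝ) (τ : M →ₗ[ℂ] ℂ)
    (p : (K ⊕ K) × (K ⊕ K)) : M →ₗ[ℂ] ℂ :=
  if p.1.isLeft = p.2.isLeft then (2 * (C : ℂ) * ⟪sumVal p.1, sumVal p.2⟫_ℂ) • τ
  else if p.1.isLeft then vectorFunctional N (sumVal p.1) (sumVal p.2) ∘ₗ E
  else adjointFunctional E (sumVal p.1) (sumVal p.2)

/-- Row and column indices of the support are merged into one finite set, so that the family becomes
a square matrix. Injectivity of `p` lets vectors indexed by `Fin n` be extended to `J`. -/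
theorem exists_fin_lsum_eq {J : Type*} (X : (J × J) →₀ M) : ∃ (n : ℕ) (p : Fin n → J),
    Function.Injective p ∧ ∀ g : J × J → M →ₗ[ℂ] ℂ,
      Finsupp.lsum ℂ g X = ∑ i, ∑ j, g (p i, p j) (X (p i, p j)) := by
  classical
  set s : Finset J := X.support.image Prod.fst ∪ X.support.image Prod.snd
  refine ⟨s.card, fun i => s.equivFin.symm i, ?_, fun g => ?_⟩
  · exact Subtype.val_injective.comp s.equivFin.symm.injective
  · have hs : X.support ⊆ s ×ˢ s := by
      intro p hp
      rw [Finset.mem_product]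
      exact ⟨Finset.mem_union_left _ (Finset.mem_image_of_mem _ hp),
        Finset.mem_union_right _ (Finset.mem_image_of_mem _ hp)⟩
    rw [Finsupp.lsum_apply, Finsupp.sum_of_support_subset _ hs _ (by simp), Finset.sum_product]
    rw [← Finset.sum_coe_sort s, ← s.equivFin.symm.sum_comp]
    refine Finset.sum_congr rfl fun i _ => ?_
    rw [← Finset.sum_coe_sort s, ← s.equivFin.symm.sum_comp]

/-- The form on vectors indexed by `J` defined by a finitely supported matrix over `M`. -/
noncomputable def supportedForm {J : Type*} (h : J → H) : ((J × J) →₀ M) →ₗ[ℂ] ℂ :=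
  Finsupp.lsum ℂ fun p => vectorFunctional M (h p.1) (h p.2)

/-- The finitely supported matrices over `M` with positive real part. -/
def accretiveCone (M : VonNeumannAlgebra H) (J : Type*) : PointedCone ℝ ((J × J) →₀ M) where
  carrier := {X | ∀ h : J → H, 0 ≤ (supportedForm h X).re}
  zero_mem' h := by simp
  add_mem' hX hY h := by
    rw [map_add, Complex.add_re]
    exact add_nonneg (hX h) (hY h)
  smul_mem' c X hX h := by
    have e : c • X = ((c : ℝ) : ℂ) • X := rfl
    rw [e, map_smul, smul_eq_mul, Complex.re_ofReal_mul]
    exact mul_nonneg c.2 (hX h)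

theorem mem_accretiveCone {J : Type*} (X : (J × J) →₀ M) :
    X ∈ accretiveCone M J ↔ ∀ h : J → H, 0 ≤ (supportedForm h X).re := Iff.rfl

/-- The matrices indexed by `K ⊕ K` with scalar entries in the two diagonal blocks. -/
def scalarDiagonal (M : VonNeumannAlgebra H) (K : Type*) :
    Submodule ℂ (((K ⊕ K) × (K ⊕ K)) →₀ M) where
  carrier := {X | ∀ p q, p.isLeft = q.isLeft → ∃ c : ℂ, X (p, q) = c • (1 : M)}
  zero_mem' p q _ := ⟨0, by simp⟩
  add_mem' := by
    intro X Y hX hY p q h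
    obtain ⟨c, hc⟩ := hX p q h
    obtain ⟨d, hd⟩ := hY p q h
    exact ⟨c + d, by rw [Finsupp.add_apply, hc, hd, add_smul]⟩
  smul_mem' := by
    intro z X hX p q h
    obtain ⟨c, hc⟩ := hX p q h
    exact ⟨z * c, by rw [Finsupp.smul_apply, hc, smul_smul]⟩

theorem lsum_wittstockKernel_nonneg [Nontrivial H] (E : M →ₗ[ℂ] (⊤ : VonNeumannAlgebra K)) {C : ℝ}
    (hE : ∀ (n : ℕ) (A : CStarMatrix (Fin n) (Fin n) M), ‖A.map E‖ ≤ C * ‖A‖) (hC : 0 ≤ C)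
    (τ : M →ₗ[ℂ] ℂ) (hτ : τ 1 = 1) (X : ((K ⊕ K) × (K ⊕ K)) →₀ M) (hX : X ∈ scalarDiagonal M K)
    (hpos : X ∈ accretiveCone M (K ⊕ K)) :
    0 ≤ (Finsupp.lsum ℂ (wittstockKernel E C τ) X).re := by
  obtain ⟨n, p, hp, hsum⟩ := exists_fin_lsum_eq X
  rw [hsum]
  -- On the diagonal blocks the entries are c • 1, and τ reads off the scalar c because τ(1) = 1.
  have key := offDiagonal_nonneg E hE hC (fun i => (p i).isLeft)
    (CStarMatrix.ofMatrix fun i j => X (p i, p j))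
    (fun i j => if (p i).isLeft = (p j).isLeft then τ (X (p i, p j)) else 0) ?_ ?_ ?_
    (fun i => sumVal (p i))
  · refine key.trans_eq (congrArg Complex.re (Finset.sum_congr rfl fun i _ =>
      Finset.sum_congr rfl fun j _ => Eq.symm ?_))
    rw [wittstockKernel]
    dsimp only
    split_ifs with h1 h2
    · rw [LinearMap.smul_apply, smul_eq_mul]; ring
    · rfl
    · rfl
  · intro i j h
    obtain ⟨c, hc⟩ := hX (p i) (p j) h
    change X (p i, p j) = (if _ then _ else _ : ℂ) • _
    rw [if_pos h, hc, map_smul, hτ, smul_eq_mul, mul_one]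
  · intro i j h
    exact if_neg h
  · intro u
    have h1 := (mem_accretiveCone X).1 hpos (Function.extend p u 0)
    rw [supportedForm, hsum] at h1
    simp only [hp.extend_apply] at h1
    exact h1

-- This is the cofinality condition of the Riesz extension theorem. An entry m at (p, q) is
-- compensated by ‖m‖ placed at (p, p) and at (q, q), since ‖hₚ‖‖h_q‖ ≤ ‖hₚ‖² + ‖h_q‖².
omit [NormedAddCommGroup K] [InnerProductSpace ℂ K] [CompleteSpace K] in
theorem exists_scalarDiagonal_add_mem (Y : ((K ⊕ K) × (K ⊕ K)) →₀ M) :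
    ∃ X ∈ scalarDiagonal M K, X + Y ∈ accretiveCone M (K ⊕ K) := by
  classical
  induction Y using Finsupp.induction_linear with
  | zero => exact ⟨0, zero_mem _, by simp⟩
  | add Y Z hY hZ =>
    obtain ⟨X, hX, hXY⟩ := hY
    obtain ⟨W, hW, hWZ⟩ := hZ
    refine ⟨X + W, add_mem hX hW, ?_⟩
    rw [add_add_add_comm]
    exact add_mem hXY hWZ
  | single pq m =>
    obtain ⟨p, q⟩ := pq
    refine ⟨Finsupp.single (p, p) ((‖m‖ : ℂ) • (1 : M)) + Finsupp.single (q, q) ((‖m‖ : ℂ) • (1 : M)),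
      add_mem ?_ ?_, ?_⟩
    · intro a b _
      rw [Finsupp.single_apply]
      split_ifs
      exacts [⟨_, rfl⟩, ⟨0, by simp⟩]
    · intro a b _
      rw [Finsupp.single_apply]
      split_ifs
      exacts [⟨_, rfl⟩, ⟨0, by simp⟩]
    · rw [mem_accretiveCone]
      intro h
      have e : ∀ u : H, (vectorFunctional M u u ((‖m‖ : ℂ) • (1 : M))).re = ‖m‖ * ‖u‖ ^ 2 := by
        intro u
        rw [map_smul, smul_eq_mul, Complex.re_ofReal_mul]
        congr 1
        exact inner_self_eq_norm_sq (𝕜 := ℂ) u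
      have h1 : |(vectorFunctional M (h p) (h q) m).re| ≤ ‖h p‖ * (‖m‖ * ‖h q‖) := by
        refine (Complex.abs_re_le_norm _).trans ((norm_inner_le_norm _ _).trans ?_)
        gcongr
        exact (m : H →L[ℂ] H).le_opNorm _
      rw [supportedForm, map_add, map_add, Finsupp.lsum_single, Finsupp.lsum_single,
        Finsupp.lsum_single, Complex.add_re, Complex.add_re, e, e]
      have h2 := (abs_le.1 h1).1
      have h3 := mul_nonneg (norm_nonneg m) (sq_nonneg (‖h p‖ - ‖h q‖))
      have h4 := mul_nonneg (norm_nonneg m) (add_nonneg (sq_nonneg ‖h p‖) (sq_nonneg ‖h q‖))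
      nlinarith

/-- The Gram matrix of a finitely supported function `J → M`. -/
noncomputable def gramMatrix {J : Type*} (a : J →₀ M) : (J × J) →₀ M :=
  a.sum fun i x => a.sum fun j y => Finsupp.single (i, j) (star x * y)

omit [CompleteSpace H] in
theorem inner_self_eq_ofReal_norm_sq (v : H) : ⟪v, v⟫_ℂ = ((‖v‖ ^ 2 : ℝ) : ℂ) := by
  push_cast
  exact inner_self_eq_norm_sq_to_K v

theorem supportedForm_gramMatrix {J : Type*} (a : J →₀ M) (h : J → H) :
    supportedForm h (gramMatrix a)
      = ((‖a.sum fun i x => (x : H →L[ℂ] H) (h i)‖ ^ 2 : ℝ) : ℂ) := by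
  rw [← inner_self_eq_ofReal_norm_sq]
  simp only [gramMatrix, Finsupp.sum, map_sum, supportedForm, Finsupp.lsum_single, sum_inner,
    inner_sum, vectorFunctional_apply]
  rw [Finset.sum_comm]
  refine Finset.sum_congr rfl fun i _ => Finset.sum_congr rfl fun j _ => ?_
  rw [← inner_star_right]
  rfl

-- Additivity and homogeneity are automatic: the squared norm of e(x + y) − e(x) − e(y) expands into
-- inner products, which cancel as they do in `K`.
omit [CompleteSpace K] in
theorem exists_linear_of_inner_eq {L : Type*} [NormedAddCommGroup L] [InnerProductSpace ℂ L]
    (e : K → L) {c : ℝ} (he : ∀ x y, ⟪e x, e y⟫_ℂ = c * ⟪x, y⟫_ℂ) :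
    ∃ V : K →L[ℂ] L, ∀ x, V x = e x := by
  have hadd : ∀ x y, e (x + y) = e x + e y := by
    intro x y
    rw [← sub_eq_zero, ← inner_self_eq_zero (𝕜 := ℂ)]
    simp only [inner_sub_left, inner_sub_right, inner_add_left, inner_add_right, he]
    ring
  have hsmul : ∀ (z : ℂ) x, e (z • x) = z • e x := by
    intro z x
    rw [← sub_eq_zero, ← inner_self_eq_zero (𝕜 := ℂ)]
    simp only [inner_sub_left, inner_sub_right, inner_smul_left, inner_smul_right, he]
    ring
  have hnorm : ∀ x, ‖e x‖ ≤ √|c| * ‖x‖ := by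
    intro x
    have h2 : ‖e x‖ ^ 2 = c * ‖x‖ ^ 2 := by
      have h1 := congrArg Complex.re (he x x)
      rw [Complex.re_ofReal_mul] at h1
      rw [← inner_self_eq_norm_sq (𝕜 := ℂ), ← inner_self_eq_norm_sq (𝕜 := ℂ)]
      exact h1
    rw [← sq_le_sq₀ (norm_nonneg _) (by positivity), mul_pow, Real.sq_sqrt (abs_nonneg c), h2]
    gcongr
    exact le_abs_self c
  exact ⟨LinearMap.mkContinuous ⟨⟨e, hadd⟩, hsmul⟩ _ hnorm, fun x => rfl⟩

/-- **Wittstock factorization** of completely bounded maps into `L(K)`. -/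
theorem exists_wittstock_factorization.{w, z} {H : Type w} [NormedAddCommGroup H]
    [InnerProductSpace ℂ H] [CompleteSpace H] [Nontrivial H] {K : Type z} [NormedAddCommGroup K]
    [InnerProductSpace ℂ K] [CompleteSpace K] {M : VonNeumannAlgebra H}
    (E : M →ₗ[ℂ] (⊤ : VonNeumannAlgebra K))
    (hE : IsCompletelyBounded E) :
    ∃ (L : Type (max w z)) (_ : NormedAddCommGroup L) (_ : InnerProductSpace ℂ L) (_ : CompleteSpace L)
      (π : M →⋆ₐ[ℂ] (L →L[ℂ] L)) (V W : K →L[ℂ] L),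
      ∀ a x y, ⟪x, (E a : K →L[ℂ] K) y⟫_ℂ = ⟪V x, π a (W y)⟫_ℂ := by
  classical
  obtain ⟨C, hC, hE⟩ := hE
  obtain ⟨u, hu⟩ := exists_norm_eq H (zero_le_one (α := ℝ))
  set τ := vectorFunctional M u u
  have hτ : τ 1 = 1 := by
    have h1 := inner_self_eq_norm_sq_to_K (𝕜 := ℂ) u
    rw [hu] at h1
    exact h1.trans (by simp)
  set F := Finsupp.lsum ℂ (wittstockKernel E C τ) with hF
  -- The extension is made for the real part of `F`, as a real functional; `G` below restores
  -- complex linearity.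
  let f : (((K ⊕ K) × (K ⊕ K)) →₀ M) →ₗ.[ℝ] ℝ :=
    ⟨(scalarDiagonal M K).restrictScalars ℝ,
      (Complex.reLm ∘ₗ F.restrictScalars ℝ).domRestrict _⟩
  obtain ⟨g, hgf, hg⟩ := riesz_extension (accretiveCone M (K ⊕ K)) f
    (fun X hX => lsum_wittstockKernel_nonneg E hE hC.le τ hτ X.1 X.2 hX)
    (fun Y => by
      obtain ⟨X, hX, hXY⟩ := exists_scalarDiagonal_add_mem (K := K) Y
      exact ⟨⟨X, hX⟩, hXY⟩)
  have hgF : ∀ X ∈ scalarDiagonal M K, g X = (F X).re := fun X hX => hgf ⟨X, hX⟩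
  set G : (((K ⊕ K) × (K ⊕ K)) →₀ M) →ₗ[ℂ] ℂ := Module.Dual.extendRCLike (𝕜 := ℂ) g with hG
  have hGre : ∀ X, (G X).re = g X := fun X => Module.Dual.re_extendRCLike_apply (𝕜 := ℂ) g X
  have hGim : ∀ X, (G X).im = -g (Complex.I • X) :=
    fun X => Module.Dual.im_extendRCLike_apply (𝕜 := ℂ) g X
  have hGF : ∀ X ∈ scalarDiagonal M K, G X = F X := by
    intro X hX
    apply Complex.ext
    · rw [hGre, hgF X hX]
    · rw [hGim, hgF _ (Submodule.smul_mem _ _ hX), map_smul]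
      simp
  let Ψ : K ⊕ K → K ⊕ K → M →ₗ[ℂ] ℂ := fun p q => G ∘ₗ Finsupp.lsingle (p, q)
  have hΨ : ∀ a, 0 ≤ kernelForm Ψ a a := by
    intro a
    have h1 : kernelForm Ψ a a = G (gramMatrix a) := by
      simp only [kernelForm, gramMatrix, Finsupp.sum, map_sum]
      rfl
    -- The form of a Gram matrix is real and nonnegative, so its multiples by i and by −i both lie
    -- in the cone. This forces `G` to be real on Gram matrices.
    have hmem : ∀ z : ℂ, 0 ≤ z.re → z • gramMatrix a ∈ accretiveCone M (K ⊕ K) := by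
      intro z hz
      rw [mem_accretiveCone]
      intro h
      rw [map_smul, supportedForm_gramMatrix, smul_eq_mul, Complex.re_mul_ofReal]
      positivity
    rw [h1, Complex.nonneg_iff, hGre, hGim]
    refine ⟨by simpa using hg _ (hmem 1 (by simp)), ?_⟩
    have h2 := hg _ (hmem Complex.I (by simp))
    have h3 := hg _ (hmem (-Complex.I) (by simp))
    rw [neg_smul, map_neg] at h3
    linarith
  obtain ⟨L, i1, i2, i3, π, e, he⟩ := exists_kolmogorov_decomposition Ψ hΨ
  -- Within one copy of `K` the inner products of the vectors `e p` are 2C times those of `K`, so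
  -- each copy yields a bounded linear map.
  have hdiag : ∀ p q : K ⊕ K, p.isLeft = q.isLeft →
      ⟪e p, e q⟫_ℂ = ((2 * C : ℝ) : ℂ) * ⟪sumVal p, sumVal q⟫_ℂ := by
    intro p q hpq
    have h1 := he p q 1
    rw [map_one] at h1
    refine h1.trans ((hGF _ ?_).trans ?_)
    · intro a b _
      rw [Finsupp.lsingle_apply, Finsupp.single_apply]
      split_ifs
      exacts [⟨1, by simp⟩, ⟨0, by simp⟩]
    · rw [hF, Finsupp.lsingle_apply, Finsupp.lsum_single, wittstockKernel, if_pos hpq,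
        LinearMap.smul_apply, hτ]
      simp
  obtain ⟨V, hV⟩ := exists_linear_of_inner_eq (fun x => e (Sum.inl x))
    fun x y => hdiag (Sum.inl x) (Sum.inl y) rfl
  obtain ⟨W, hW⟩ := exists_linear_of_inner_eq (fun x => e (Sum.inr x))
    fun x y => hdiag (Sum.inr x) (Sum.inr y) rfl
  refine ⟨L, i1, i2, i3, π, V, W, fun a x y => ?_⟩
  rw [hV, hW, he]
  -- A single off-diagonal entry, with arbitrary a in `M`, has zero diagonal blocks, so the
  -- extension keeps the prescribed value there.
  refine Eq.symm ((hGF _ ?_).trans ?_)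
  · intro p q hpq
    refine ⟨0, ?_⟩
    rw [Finsupp.lsingle_apply, Finsupp.single_apply, if_neg, zero_smul]
    rintro h
    rw [Prod.mk.injEq] at h
    rw [← h.1, ← h.2] at hpq
    simp at hpq
  · rw [hF, Finsupp.lsingle_apply, Finsupp.lsum_single]
    rfl

end Factorization

/-! ### Normal vectors of a representation. -/

section NormalPart

variable {H : Type*} [NormedAddCommGroup H] [InnerProductSpace ℂ H] [CompleteSpace H]
variable {K : Type*} [NormedAddCommGroup K] [InnerProductSpace ℂ K] [CompleteSpace K]
variable {L : Type*} [NormedAddCommGroup L] [InnerProductSpace ℂ L] [CompleteSpace L]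
variable {M : VonNeumannAlgebra H} {N : VonNeumannAlgebra K}

/-- `A` is an increasing sequence of positive elements with least upper bound `a`. -/
structure IncreasesTo (A : ℕ → M) (a : M) : Prop where
  nonneg : ∀ n, 0 ≤ A n
  mono : Monotone A
  isLUB : IsLUB (Set.range A) a

namespace IncreasesTo

variable {A : ℕ → M} {a : M}

theorem sub_nonneg (h : IncreasesTo A a) (n : ℕ) : 0 ≤ a - A n :=
  _root_.sub_nonneg.2 (h.isLUB.1 ⟨n, rfl⟩)

theorem norm_sub_le (h : IncreasesTo A a) (n : ℕ) : ‖a - A n‖ ≤ ‖a‖ :=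
  norm_le_of_nonneg_of_le (h.sub_nonneg n) (sub_le_self a (h.nonneg n))

theorem tendsto_apply (h : IncreasesTo A a) (k : H) :
    Tendsto (fun n => (A n : H →L[ℂ] H) k) atTop (𝓝 ((a : H →L[ℂ] H) k)) :=
  tendsto_of_isLUB h.mono h.isLUB k

theorem tendsto_sub_apply (h : IncreasesTo A a) (k : H) :
    Tendsto (fun n => ((a - A n : M) : H →L[ℂ] H) k) atTop (𝓝 0) := by
  have := (tendsto_const_nhds (x := (a : H →L[ℂ] H) k)).sub (h.tendsto_apply k)
  simpa using this

theorem conj (h : IncreasesTo A a) (b : M) :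
    IncreasesTo (fun n => star b * A n * b) (star b * a * b) where
  nonneg n := star_left_conjugate_nonneg (h.nonneg n) b
  mono m n hmn := star_left_conjugate_le_conjugate (h.mono hmn) b
  isLUB := by
    refine isLUB_of_tendsto (fun m n hmn => star_left_conjugate_le_conjugate (h.mono hmn) b)
      fun k => ?_
    have e : ∀ c : M, ⟪k, ((star b * c * b : M) : H →L[ℂ] H) k⟫_ℂ
        = ⟪(b : H →L[ℂ] H) k, (c : H →L[ℂ] H) ((b : H →L[ℂ] H) k)⟫_ℂ := by
      intro c
      rw [← inner_star_right]
      rfl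
    simp only [e]
    exact tendsto_const_nhds.inner (h.tendsto_apply _)

end IncreasesTo

theorem sqrt_mul_sqrt {d : M} (hd : 0 ≤ d) : CFC.sqrt d * CFC.sqrt d = d :=
  CFC.sqrt_mul_sqrt_self d hd

theorem star_sqrt (d : M) : star (CFC.sqrt d) = CFC.sqrt d :=
  (IsSelfAdjoint.of_nonneg (CFC.sqrt_nonneg d)).star_eq

theorem norm_sqrt_sq {d : M} (hd : 0 ≤ d) : ‖CFC.sqrt d‖ ^ 2 = ‖d‖ := by
  have h := CStarRing.norm_star_mul_self (x := CFC.sqrt d)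
  rw [star_sqrt, sqrt_mul_sqrt hd] at h
  rw [h, sq]

theorem inner_rep_star_mul (π : M →⋆ₐ[ℂ] (L →L[ℂ] L)) (b c : M) (ξ η : L) :
    ⟪ξ, π (star b * c) η⟫_ℂ = ⟪π b ξ, π c η⟫_ℂ := by
  rw [map_mul, map_star, mul_apply_eq_comp, ContinuousLinearMap.star_eq_adjoint,
    ContinuousLinearMap.adjoint_inner_right]

theorem inner_rep_of_nonneg (π : M →⋆ₐ[ℂ] (L →L[ℂ] L)) {d : M} (hd : 0 ≤ d) (ξ η : L) :
    ⟪ξ, π d η⟫_ℂ = ⟪π (CFC.sqrt d) ξ, π (CFC.sqrt d) η⟫_ℂ := by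
  rw [← inner_rep_star_mul, star_sqrt, sqrt_mul_sqrt hd]

theorem norm_rep_sqrt_sq (π : M →⋆ₐ[ℂ] (L →L[ℂ] L)) {d : M} (hd : 0 ≤ d) (ξ : L) :
    ((‖π (CFC.sqrt d) ξ‖ ^ 2 : ℝ) : ℂ) = ⟪ξ, π d ξ⟫_ℂ := by
  rw [inner_rep_of_nonneg π hd, inner_self_eq_ofReal_norm_sq]

theorem norm_rep_apply_le (π : M →⋆ₐ[ℂ] (L →L[ℂ] L)) (b : M) (ξ : L) :
    ‖π b ξ‖ ≤ ‖b‖ * ‖ξ‖ :=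
  ((π b).le_opNorm ξ).trans (by gcongr; exact NonUnitalStarAlgHom.norm_apply_le π b)

theorem norm_rep_sqrt_le (π : M →⋆ₐ[ℂ] (L →L[ℂ] L)) {A : ℕ → M} {a : M} (h : IncreasesTo A a)
    (n : ℕ) (ξ : L) : ‖π (CFC.sqrt (a - A n)) ξ‖ ≤ √‖a‖ * ‖ξ‖ := by
  refine (norm_rep_apply_le π _ ξ).trans ?_
  gcongr
  refine Real.le_sqrt_of_sq_le ?_
  rw [norm_sqrt_sq (h.sub_nonneg n)]
  exact h.norm_sub_le n

/-- The vectors of a representation whose vector state is normal. -/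
def normalVectors (π : M →⋆ₐ[ℂ] (L →L[ℂ] L)) : Submodule ℂ L where
  carrier := {ξ | ∀ (A : ℕ → M) (a : M), IncreasesTo A a →
    Tendsto (fun n => ‖π (CFC.sqrt (a - A n)) ξ‖) atTop (𝓝 0)}
  zero_mem' A a h := by simp
  add_mem' := by
    intro ξ η hξ hη A a h
    refine squeeze_zero (fun n => norm_nonneg _) (fun n => ?_)
      (by simpa using (hξ A a h).add (hη A a h))
    rw [map_add]
    exact norm_add_le _ _
  smul_mem' := by
    intro z ξ hξ A a h
    simp only [map_smul, norm_smul]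
    simpa using (hξ A a h).const_mul ‖z‖

variable (π : M →⋆ₐ[ℂ] (L →L[ℂ] L))

/-- The squared norm for π(b)ξ is ⟪ξ, π(b⋆(a − Aₙ)b) ξ⟫, and b⋆Aₙb increases to b⋆ab. -/
theorem rep_mem_normalVectors (b : M) {ξ : L} (hξ : ξ ∈ normalVectors π) :
    π b ξ ∈ normalVectors π := by
  intro A a h
  have e : ∀ n, ‖π (CFC.sqrt (a - A n)) (π b ξ)‖
      = ‖π (CFC.sqrt (star b * a * b - star b * A n * b)) ξ‖ := by
    intro n
    have e1 := norm_rep_sqrt_sq π (h.sub_nonneg n) (π b ξ)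
    have e2 := norm_rep_sqrt_sq π ((h.conj b).sub_nonneg n) ξ
    have e3 : star b * a * b - star b * A n * b = star b * ((a - A n) * b) := by
      noncomm_ring
    have e4 : ⟪ξ, π (star b * a * b - star b * A n * b) ξ⟫_ℂ
        = ⟪π b ξ, π (a - A n) (π b ξ)⟫_ℂ := by
      rw [e3, inner_rep_star_mul, map_mul]
      rfl
    rw [e4, ← e1] at e2
    have e5 := Complex.ofReal_injective e2
    exact ((pow_left_inj₀ (norm_nonneg _) (norm_nonneg _) two_ne_zero).1 e5).symm
  simp only [e]
  exact hξ _ _ (h.conj b)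

theorem isClosed_normalVectors : IsClosed (normalVectors π : Set L) := by
  rw [← closure_subset_iff_isClosed]
  intro ξ hξ A a h
  rw [Metric.tendsto_atTop]
  intro ε hε
  obtain ⟨η, hη, hd⟩ := Metric.mem_closure_iff.1 hξ (ε / 2 / (√‖a‖ + 1)) (by positivity)
  obtain ⟨n₀, hn₀⟩ := Metric.tendsto_atTop.1 (hη A a h) (ε / 2) (by positivity)
  refine ⟨n₀, fun n hn => ?_⟩
  have h1 := hn₀ n hn
  rw [dist_zero_right, norm_norm] at h1 ⊢
  have h2 := norm_rep_sqrt_le π h n (ξ - η)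
  rw [map_sub] at h2
  rw [dist_eq_norm, lt_div_iff₀ (by positivity)] at hd
  have h3 := norm_sub_norm_le (π (CFC.sqrt (a - A n)) ξ) (π (CFC.sqrt (a - A n)) η)
  nlinarith [norm_nonneg (ξ - η)]

theorem tendsto_inner_rep {u v : L} (hu : u ∈ normalVectors π) (hv : v ∈ normalVectors π)
    {A : ℕ → M} {a : M} (h : IncreasesTo A a) :
    Tendsto (fun n => ⟪u, π (a - A n) v⟫_ℂ) atTop (𝓝 0) := by
  rw [tendsto_zero_iff_norm_tendsto_zero]
  refine squeeze_zero (fun n => norm_nonneg _) (fun n => ?_)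
    (by simpa using (hu A a h).mul (hv A a h))
  rw [inner_rep_of_nonneg π (h.sub_nonneg n)]
  exact norm_inner_le_norm _ _

theorem rep_mem_orthogonal (b : M) {ξ : L} (hξ : ξ ∈ (normalVectors π)ᗮ) :
    π b ξ ∈ (normalVectors π)ᗮ := by
  rw [Submodule.mem_orthogonal] at hξ ⊢
  intro u hu
  have h1 := inner_rep_star_mul π (star b) 1 u ξ
  rw [star_star, mul_one, map_one] at h1
  rw [h1]
  exact hξ _ (rep_mem_normalVectors π _ hu)

/-- A normal coefficient of a representation without normal vectors vanishes. -/
theorem inner_rep_eq_zero {η ξ : L} (hξ : ξ ∈ (normalVectors π)ᗮ)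
    (hf : ∀ (A : ℕ → M) (a b : M), IncreasesTo A a →
      Tendsto (fun n => ⟪η, π ((a - A n) * b) ξ⟫_ℂ) atTop (𝓝 0)) (c : M) :
    ⟪η, π c ξ⟫_ℂ = 0 := by
  let ev : M →ₗ[ℂ] L :=
    { toFun := fun b => π b ξ
      map_add' := fun b c => by simp
      map_smul' := fun z b => by simp }
  set S := (LinearMap.range ev).topologicalClosure with hS
  have hSclosed : IsClosed (S : Set L) := Submodule.isClosed_topologicalClosure _
  have : CompleteSpace S := hSclosed.completeSpace_coe
  have hmem : ∀ b, π b ξ ∈ S := fun b =>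
    Submodule.le_topologicalClosure _ ⟨b, rfl⟩
  -- Projecting η to the cyclic subspace of ξ preserves all the coefficients considered.
  set η' : L := S.starProjection η with hη'
  have hη'S : η' ∈ S := Submodule.starProjection_apply_mem S η
  have hinner : ∀ b, ⟪η, π b ξ⟫_ℂ = ⟪η', π b ξ⟫_ℂ := by
    intro b
    have h1 : ⟪η - η', π b ξ⟫_ℂ = 0 :=
      Submodule.inner_left_of_mem_orthogonal (hmem b) (Submodule.sub_starProjection_mem_orthogonal η)
    rwa [inner_sub_left, sub_eq_zero] at h1
  -- Approximating the right-hand η' by some π(b)ξ turns ⟪η', π(a − Aₙ) η'⟫ into the coefficient of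
  -- the hypothesis, up to an error uniform in n.
  have hnormal : η' ∈ normalVectors π := by
    intro A a h
    rw [Metric.tendsto_atTop]
    intro ε hε
    set R := ‖η'‖ * ‖a‖ + 1 with hR
    have hR0 : 0 < R := by positivity
    have hδ : 0 < ε ^ 2 / 2 / R := by positivity
    obtain ⟨_, ⟨b, rfl⟩, hb⟩ := Metric.mem_closure_iff.1
      (show η' ∈ closure (LinearMap.range ev : Set L) from hη'S) _ hδ
    obtain ⟨n₀, hn₀⟩ := Metric.tendsto_atTop.1 (hf A a b h) (ε ^ 2 / 2) (by positivity)
    refine ⟨n₀, fun n hn => ?_⟩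
    have h1 := hn₀ n hn
    rw [dist_zero_right] at h1
    rw [dist_zero_right, norm_norm]
    refine lt_of_pow_lt_pow_left₀ 2 hε.le ?_
    have h2 := norm_rep_sqrt_sq π (h.sub_nonneg n) η'
    have h3 : ⟪η', π (a - A n) η'⟫_ℂ
        = ⟪η, π ((a - A n) * b) ξ⟫_ℂ + ⟪η', π (a - A n) (η' - π b ξ)⟫_ℂ := by
      rw [hinner, (π (a - A n)).map_sub, inner_sub_right, map_mul, mul_apply_eq_comp]
      ring
    have h4 : ‖⟪η', π (a - A n) (η' - π b ξ)⟫_ℂ‖ ≤ ‖η'‖ * (‖a‖ * ‖η' - π b ξ‖) := by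
      refine (norm_inner_le_norm _ _).trans ?_
      gcongr
      refine (norm_rep_apply_le π _ _).trans ?_
      gcongr
      exact h.norm_sub_le n
    have h5 : ‖π (CFC.sqrt (a - A n)) η'‖ ^ 2 = ‖⟪η', π (a - A n) η'⟫_ℂ‖ := by
      rw [← h2, Complex.norm_real, Real.norm_of_nonneg (by positivity)]
    have h6 : ‖η' - π b ξ‖ * R < ε ^ 2 / 2 := by
      rw [dist_eq_norm, lt_div_iff₀ hR0] at hb
      exact hb
    rw [h5, h3]
    refine (norm_add_le _ _).trans_lt ?_
    nlinarith [norm_nonneg (η' - π b ξ)]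
  -- The cyclic subspace stays in the complement, so η' is a normal vector orthogonal to itself.
  have hSle : S ≤ (normalVectors π)ᗮ := by
    refine Submodule.topologicalClosure_minimal _ ?_ (Submodule.isClosed_orthogonal _)
    rintro _ ⟨b, rfl⟩
    exact rep_mem_orthogonal π b hξ
  have hzero : η' = 0 := by
    have := (Submodule.mem_orthogonal _ _).1 (hSle hη'S) η' hnormal
    exact inner_self_eq_zero.1 this
  rw [hinner, hzero, inner_zero_left]

end NormalPart

/-! ### Compressions of representations are completely positive. -/

section Compression

variable {H : Type*} [NormedAddCommGroup H] [InnerProductSpace ℂ H] [CompleteSpace H]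
variable {K : Type*} [NormedAddCommGroup K] [InnerProductSpace ℂ K] [CompleteSpace K]
variable {L : Type*} [NormedAddCommGroup L] [InnerProductSpace ℂ L] [CompleteSpace L]
variable {M : VonNeumannAlgebra H} {N : VonNeumannAlgebra K}

/-- The map `a ↦ X⋆ π(a) X` defined by a representation `π` of `M`. -/
noncomputable def compression (π : M →⋆ₐ[ℂ] (L →L[ℂ] L)) (X : K →L[ℂ] L) :
    M →ₗ[ℂ] (⊤ : VonNeumannAlgebra K) where
  toFun a := ⟨X.adjoint ∘L π a ∘L X, mem_top _⟩
  map_add' a b := Subtype.ext <| by ext; simp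
  map_smul' z a := Subtype.ext <| by
    ext
    change _ = z • ((X.adjoint ∘L π a ∘L X : K →L[ℂ] K) _)
    simp

theorem inner_compression (π : M →⋆ₐ[ℂ] (L →L[ℂ] L)) (X : K →L[ℂ] L) (a : M) (x y : K) :
    ⟪x, (compression π X a : K →L[ℂ] K) y⟫_ℂ = ⟪X x, π a (X y)⟫_ℂ :=
  ContinuousLinearMap.adjoint_inner_right X x (π a (X y))

theorem compression_star (π : M →⋆ₐ[ℂ] (L →L[ℂ] L)) (X : K →L[ℂ] L) (a : M) :
    compression π X (star a) = star (compression π X a) := by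
  refine Subtype.ext (ContinuousLinearMap.ext fun y => ext_inner_left ℂ fun x => ?_)
  rw [inner_compression, inner_star_right, map_star, ContinuousLinearMap.star_eq_adjoint,
    ContinuousLinearMap.adjoint_inner_right, ← inner_conj_symm, ← inner_conj_symm _ y,
    inner_compression]

/-- A positive matrix is B⋆B, and the form of its image at k is ∑ₗ ‖∑ᵢ π(Bₗᵢ) X kᵢ‖². -/
theorem isCompletelyPositive_compression (π : M →⋆ₐ[ℂ] (L →L[ℂ] L)) (X : K →L[ℂ] L) :
    IsCompletelyPositive (compression π X) := by
  refine ⟨⟨compression π X, fun n A hA => ?_⟩, rfl⟩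
  refine nonneg_of_matrixForm_nonneg ?_ fun k => ?_
  · rw [IsSelfAdjoint]
    ext i j
    rw [CStarMatrix.star_apply, CStarMatrix.map_apply, CStarMatrix.map_apply, ← compression_star,
      ← CStarMatrix.star_apply, (IsSelfAdjoint.of_nonneg hA).star_eq]
  · obtain ⟨B, rfl⟩ := CStarAlgebra.exists_eq_star_mul_self hA
    have e : matrixForm ((star B * B).map (compression π X)) k k
        = ∑ l, ⟪∑ i, π (B l i) (X (k i)), ∑ j, π (B l j) (X (k j))⟫_ℂ := by
      have e1 : ∀ i j, ⟪k i, (compression π X ((star B * B) i j) : K →L[ℂ] K) (k j)⟫_ℂ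
          = ∑ l, ⟪π (B l i) (X (k i)), π (B l j) (X (k j))⟫_ℂ := by
        intro i j
        rw [inner_compression, CStarMatrix.mul_apply, map_sum, sum_apply, inner_sum]
        refine Finset.sum_congr rfl fun l _ => ?_
        rw [CStarMatrix.star_apply, inner_rep_star_mul]
      simp only [matrixForm, CStarMatrix.map_apply]
      change ∑ i, ∑ j, ⟪k i, (compression π X ((star B * B) i j) : K →L[ℂ] K) (k j)⟫_ℂ = _
      simp only [e1, sum_inner, inner_sum]
      rw [Finset.sum_congr rfl fun i _ => Finset.sum_comm, Finset.sum_comm]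
      exact Finset.sum_congr rfl fun l _ => Finset.sum_comm
    rw [e]
    refine Finset.sum_nonneg fun l _ => ?_
    rw [inner_self_eq_ofReal_norm_sq, Complex.zero_le_real]
    positivity

theorem map_nonneg_of_isCompletelyPositive {E : M →ₗ[ℂ] N} (hE : IsCompletelyPositive E) {a : M}
    (ha : 0 ≤ a) : 0 ≤ E a := by
  obtain ⟨φ, rfl⟩ := hE
  exact map_nonneg φ ha

theorem monotone_of_isCompletelyPositive {E : M →ₗ[ℂ] N} (hE : IsCompletelyPositive E) :
    Monotone E := by
  intro a b hab
  rw [← sub_nonneg, ← map_sub]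
  exact map_nonneg_of_isCompletelyPositive hE (sub_nonneg.2 hab)

theorem isNormalMap_compression (π : M →⋆ₐ[ℂ] (L →L[ℂ] L)) (X : K →L[ℂ] L)
    (hX : ∀ x, X x ∈ normalVectors π) : IsNormalMap (compression π X) := by
  intro A a hA0 hA ha
  refine isLUB_of_tendsto
    ((monotone_of_isCompletelyPositive (isCompletelyPositive_compression π X)).comp hA) fun x => ?_
  have h1 := tendsto_inner_rep π (hX x) (hX x) (A := A) (a := a) ⟨hA0, hA, ha⟩
  have h2 := (tendsto_const_nhds (x := ⟪X x, π a (X x)⟫_ℂ)).sub h1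
  rw [sub_zero] at h2
  simp only [inner_compression]
  refine h2.congr fun n => ?_
  rw [map_sub, sub_apply, inner_sub_right, sub_sub_cancel]
  exact (inner_compression π X (A n) x x).symm

end Compression

/-! ### Decomposition of a weak*-continuous completely bounded map. -/

section WeakStar

variable {H : Type*} [NormedAddCommGroup H] [InnerProductSpace ℂ H] [CompleteSpace H]
variable {K : Type*} [NormedAddCommGroup K] [InnerProductSpace ℂ K] [CompleteSpace K]
variable {M : VonNeumannAlgebra H} {N : VonNeumannAlgebra K}

/-- Bounded strongly null sequences are weak* null. -/
theorem tendsto_weakStar_zero {c : ℕ → M} {R : ℝ} (hR : ∀ n, ‖c n‖ ≤ R)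
    (hc : ∀ h, Tendsto (fun n => (c n : H →L[ℂ] H) h) atTop (𝓝 0)) :
    Tendsto c atTop (@nhds M M.weakStarTopology 0) := by
  rw [weakStarTopology, @nhds_induced _ _ (weakStarTopologyOperators H), tendsto_comap_iff,
    weakStarTopologyOperators]
  simp only [nhds_iInf, tendsto_iInf]
  intro x y hx hy
  rw [@nhds_induced _ _ inferInstance, tendsto_comap_iff]
  have h0 : ∑' n, ⟪x n, ((0 : M) : H →L[ℂ] H) (y n)⟫_ℂ = ∑' n : ℕ, (0 : ℂ) := by simp
  rw [h0]
  refine tendsto_tsum_of_dominated_convergence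
    (bound := fun k => R * (‖x k‖ ^ 2 + ‖y k‖ ^ 2)) ((hx.add hy).mul_left R) (fun k => ?_)
    (Eventually.of_forall fun n k => ?_)
  · have := (tendsto_const_nhds (x := x k)).inner (𝕜 := ℂ) (hc (y k))
    simpa using this
  · have hR0 : 0 ≤ R := (norm_nonneg _).trans (hR 0)
    calc ‖⟪x k, (c n : H →L[ℂ] H) (y k)⟫_ℂ‖ ≤ ‖x k‖ * (R * ‖y k‖) := by
          refine (norm_inner_le_norm _ _).trans ?_
          gcongr
          refine ((c n : H →L[ℂ] H).le_opNorm _).trans ?_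
          gcongr
          exact hR n
      _ ≤ R * (‖x k‖ ^ 2 + ‖y k‖ ^ 2) := by
          nlinarith [mul_nonneg hR0 (sq_nonneg (‖x k‖ - ‖y k‖)),
            mul_nonneg hR0 (sq_nonneg (‖x k‖)), mul_nonneg hR0 (sq_nonneg (‖y k‖))]

theorem continuous_inner_of_isWeakStarContinuous {E : M →ₗ[ℂ] N} (hE : IsWeakStarContinuous E)
    (x y : K) : @Continuous M ℂ M.weakStarTopology inferInstance
      fun a => ⟪x, (E a : K →L[ℂ] K) y⟫_ℂ := by
  have hs : ∀ x : K, Summable fun n : ℕ => ‖(Pi.single 0 x : ℕ → K) n‖ ^ 2 := fun x =>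
    summable_of_ne_finset_zero (s := {0}) fun n hn => by
      rw [Finset.mem_singleton] at hn
      simp [hn]
  have h := (isWeakStarContinuous_iff E).1 hE (Pi.single 0 x) (Pi.single 0 y) (hs x) (hs y)
  have e : ∀ a : M, ∑' n, ⟪(Pi.single 0 x : ℕ → K) n,
      (E a : K →L[ℂ] K) ((Pi.single 0 y : ℕ → K) n)⟫_ℂ = ⟪x, (E a : K →L[ℂ] K) y⟫_ℂ := by
    intro a
    rw [tsum_eq_single 0 fun n hn => by simp [hn]]
    simp
  simpa only [e] using h

/-- The sequence (a − Aₙ)b is bounded and strongly null. The factor b is what `inner_rep_eq_zero`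
requires. -/
theorem tendsto_inner_map_sub_mul {E : M →ₗ[ℂ] N} (hE : IsWeakStarContinuous E) {A : ℕ → M} {a : M}
    (h : IncreasesTo A a) (b : M) (x y : K) :
    Tendsto (fun n => ⟪x, (E ((a - A n) * b) : K →L[ℂ] K) y⟫_ℂ) atTop (𝓝 0) := by
  have h1 : Tendsto (fun n => (a - A n) * b) atTop (@nhds M M.weakStarTopology 0) := by
    refine tendsto_weakStar_zero (R := ‖a‖ * ‖b‖) (fun n => ?_) fun k => ?_
    · refine (norm_mul_le _ _).trans ?_
      gcongr
      exact h.norm_sub_le n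
    · exact h.tendsto_sub_apply ((b : H →L[ℂ] H) k)
  have h2 := (@Continuous.tendsto M ℂ M.weakStarTopology _ _
    (continuous_inner_of_isWeakStarContinuous hE x y) 0).comp h1
  simpa [Function.comp_def] using h2

/-- Every weak*-continuous completely bounded map into `L(K)` is a combination of four normal
completely positive maps. -/
theorem exists_eq_sum_pow_I_smul (E : M →ₗ[ℂ] (⊤ : VonNeumannAlgebra K))
    (hE : E ∈ CB M (⊤ : VonNeumannAlgebra K)) :
    ∃ F : Fin 4 → (M →ₗ[ℂ] (⊤ : VonNeumannAlgebra K)),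
      (∀ k, F k ∈ CP M (⊤ : VonNeumannAlgebra K)) ∧ E = ∑ k : Fin 4, Complex.I ^ (k : ℕ) • F k := by
  -- The factorization uses a unit vector of `H`; if there is none, `M` is zero and so is every map
  -- from it.
  rcases subsingleton_or_nontrivial H with hH | hH
  · have hM : ∀ a : M, a = 0 := fun a =>
      Subtype.ext (ContinuousLinearMap.ext fun h => Subsingleton.elim _ _)
    have h0 : ∀ G : M →ₗ[ℂ] (⊤ : VonNeumannAlgebra K), G = 0 := fun G =>
      LinearMap.ext fun a => by rw [hM a, map_zero, map_zero]
    refine ⟨fun _ => compression (M.toStarSubalgebra.subtype) (0 : K →L[ℂ] H), fun k =>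
      ⟨isCompletelyPositive_compression _ _, isNormalMap_compression _ _ fun x => ?_⟩, ?_⟩
    · exact zero_mem _
    · rw [h0 E]
      exact (h0 _).symm
  obtain ⟨hEc, hEb⟩ := hE
  obtain ⟨L, _, _, _, π, V, W, hVW⟩ := exists_wittstock_factorization E hEb
  set U := normalVectors π with hU
  have hUc : CompleteSpace U := (isClosed_normalVectors π).completeSpace_coe
  set P := U.starProjection with hP
  have hPU : ∀ ξ, P ξ ∈ U := Submodule.starProjection_apply_mem U
  have hQU : ∀ ξ, ξ - P ξ ∈ Uᗮ := Submodule.sub_starProjection_mem_orthogonal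
  -- The cross terms vanish because the normal vectors and their complement are both invariant.
  have hsplit : ∀ a ξ η, ⟪ξ, π a η⟫_ℂ = ⟪P ξ, π a (P η)⟫_ℂ + ⟪ξ - P ξ, π a (η - P η)⟫_ℂ := by
    intro a ξ η
    have h1 : ⟪P ξ, π a (η - P η)⟫_ℂ = 0 :=
      Submodule.inner_right_of_mem_orthogonal (hPU ξ) (rep_mem_orthogonal π a (hQU η))
    have h2 : ⟪ξ - P ξ, π a (P η)⟫_ℂ = 0 :=
      Submodule.inner_left_of_mem_orthogonal (rep_mem_normalVectors π a (hPU η)) (hQU ξ)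
    calc ⟪ξ, π a η⟫_ℂ = ⟪P ξ + (ξ - P ξ), π a (P η + (η - P η))⟫_ℂ := by simp
      _ = _ := by rw [map_add, inner_add_left, inner_add_right, inner_add_right, h1, h2]; ring
  -- The singular coefficient is the coefficient of `E` minus that of the normal part; both are
  -- normal, so it is a normal coefficient in the complement.
  have hsing : ∀ a x y, ⟪V x - P (V x), π a (W y - P (W y))⟫_ℂ = 0 := by
    intro a x y
    refine inner_rep_eq_zero π (hQU _) (fun A a b h => ?_) a
    have h1 := tendsto_inner_map_sub_mul hEc h b x y
    have h2 := tendsto_inner_rep π (hPU (V x)) (rep_mem_normalVectors π b (hPU (W y))) h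
    have h3 := h1.sub h2
    rw [sub_zero] at h3
    refine h3.congr fun n => ?_
    rw [hVW, hsplit, map_mul, mul_apply_eq_comp]
    ring
  have hE' : ∀ a x y, ⟪x, (E a : K →L[ℂ] K) y⟫_ℂ = ⟪P (V x), π a (P (W y))⟫_ℂ := by
    intro a x y
    rw [hVW, hsplit, hsing, add_zero]
  -- Polarization of V⋆ π(·) W: in ∑ iᵏ Xₖ⋆ π(·) Xₖ only this term survives, four times, and the
  -- factor 1/2 in each Xₖ compensates the 4.
  let X : Fin 4 → K →L[ℂ] L := fun k =>
    (1 / 2 : ℂ) • (P ∘L W + Complex.I ^ (k : ℕ) • P ∘L V)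
  refine ⟨fun k => compression π (X k), fun k => ⟨isCompletelyPositive_compression _ _,
    isNormalMap_compression _ _ fun x => ?_⟩, ?_⟩
  · exact U.smul_mem _ (U.add_mem (hPU _) (U.smul_mem _ (hPU _)))
  · refine LinearMap.ext fun a => Subtype.ext (ContinuousLinearMap.ext fun y =>
      ext_inner_left ℂ fun x => ?_)
    have e : ∀ k : Fin 4, ⟪x, ((Complex.I ^ (k : ℕ) • compression π (X k)) a : K →L[ℂ] K) y⟫_ℂ
        = Complex.I ^ (k : ℕ) * ⟪X k x, π a (X k y)⟫_ℂ := by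
      intro k
      rw [← inner_compression]
      exact inner_smul_right _ _ _
    rw [hE', LinearMap.sum_apply, finset_sum_apply, inner_sum, Finset.sum_congr rfl fun k _ => e k]
    have hXa : ∀ k z, X k z = (1 / 2 : ℂ) • (P (W z) + Complex.I ^ (k : ℕ) • P (V z)) :=
      fun k z => rfl
    simp only [hXa, map_smul, map_add, inner_smul_left, inner_smul_right, inner_add_left,
      inner_add_right, Fin.sum_univ_four]
    simp [pow_succ]
    ring_nf
    simp
    rw [Complex.conj_ofNat]
    ring

end WeakStar

/-! ### Absolute continuity of normal positive functionals. -/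

section AbsoluteContinuity

variable {H : Type*} [NormedAddCommGroup H] [InnerProductSpace ℂ H] [CompleteSpace H]
variable {M : VonNeumannAlgebra H}

/-- The operator `S (1 + S)⁻¹`. -/
noncomputable def truncation (S : M) : M := cfcₙ (fun x : ℝ≥0 => 1 - (1 + x)⁻¹) S

theorem continuous_one_sub_one_add_inv : Continuous fun x : ℝ≥0 => 1 - (1 + x)⁻¹ := by
  refine continuous_const.sub (Continuous.inv₀ (by fun_prop) fun x => by positivity)

/-- The function t/(1 + t) is operator monotone, unlike min(t, 1); this dictates the choice of
truncation. -/
theorem truncation_mono {S T : M} (hS : 0 ≤ S) (hST : S ≤ T) : truncation S ≤ truncation T :=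
  CFC.monotoneOn_one_sub_one_add_inv (A := M) hS (hS.trans hST) hST

theorem truncation_nonneg (S : M) : 0 ≤ truncation S := cfcₙ_nonneg_of_predicate

theorem truncation_le_one (S : M) : truncation S ≤ 1 :=
  (CStarAlgebra.norm_le_one_iff_of_nonneg _ (truncation_nonneg S)).1
    (norm_cfcₙ_one_sub_one_add_inv_lt_one S).le

theorem truncation_le_self {S : M} (hS : 0 ≤ S) : truncation S ≤ S := by
  conv_rhs => rw [← cfcₙ_id ℝ≥0 S]
  refine cfcₙ_mono (fun x _ => ?_) continuous_one_sub_one_add_inv.continuousOn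
    continuous_id.continuousOn (by simp) rfl
  rw [id, tsub_le_iff_right, ← NNReal.coe_le_coe]
  push_cast
  have hx := x.2
  have h1 : (0 : ℝ) < 1 + x := by positivity
  rw [← sub_nonneg]
  have : (x : ℝ) + (1 + (x : ℝ))⁻¹ - 1 = x ^ 2 / (1 + x) := by field_simp; ring
  rw [this]
  positivity

theorem le_two_smul_truncation {S : M} (hS : 0 ≤ S) (hS1 : S ≤ 1) : S ≤ (2 : ℝ≥0) • truncation S := by
  have hn : ‖S‖ ≤ 1 := (CStarAlgebra.norm_le_one_iff_of_nonneg S hS).2 hS1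
  have hc := continuous_one_sub_one_add_inv
  rw [truncation, ← cfcₙ_smul (2 : ℝ≥0) (fun x : ℝ≥0 => 1 - (1 + x)⁻¹) S hc.continuousOn (by simp)]
  conv_lhs => rw [← cfcₙ_id ℝ≥0 S]
  refine cfcₙ_mono (fun x hx => ?_) continuous_id.continuousOn (hc.const_smul (2 : ℝ≥0)).continuousOn rfl
    (by simp)
  have hx1 : x ≤ 1 := (CStarAlgebra.le_nnnorm_of_mem_quasispectrum hx).trans hn
  have h2 : (1 + x)⁻¹ ≤ 1 := inv_le_one_of_one_le₀ (by simp)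
  rw [id, ← NNReal.coe_le_coe, smul_eq_mul, NNReal.coe_mul, NNReal.coe_sub h2]
  push_cast
  have hx0 := x.2
  have hx1' : (x : ℝ) ≤ 1 := hx1
  rw [← sub_nonneg]
  have : 2 * (1 - (1 + (x : ℝ))⁻¹) - x = x * (1 - x) / (1 + x) := by
    have : (1 : ℝ) + x ≠ 0 := by positivity
    field_simp; ring
  rw [this]
  have := sub_nonneg.2 hx1'
  positivity

theorem re_inner_le {a b : M} (h : a ≤ b) (k : H) :
    (⟪k, (a : H →L[ℂ] H) k⟫_ℂ).re ≤ (⟪k, (b : H →L[ℂ] H) k⟫_ℂ).re :=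
  (Complex.le_def.1 ((le_iff a b).1 h k)).1

/-- A contractive family of operators tending to zero on a dense set tends strongly to zero. -/
theorem tendsto_apply_zero_of_denseRange {c : ℕ → M} (hc : ∀ n, ‖c n‖ ≤ 1) {ι : Type*} {h : ι → H}
    (hd : DenseRange h) (hh : ∀ j, Tendsto (fun n => (c n : H →L[ℂ] H) (h j)) atTop (𝓝 0)) (k : H) :
    Tendsto (fun n => (c n : H →L[ℂ] H) k) atTop (𝓝 0) := by
  rw [Metric.tendsto_atTop]
  intro ε hε
  obtain ⟨j, hj⟩ := hd.exists_dist_lt k (half_pos hε)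
  obtain ⟨N, hN⟩ := Metric.tendsto_atTop.1 (hh j) (ε / 2) (half_pos hε)
  refine ⟨N, fun n hn => ?_⟩
  have h1 := hN n hn
  rw [dist_zero_right] at h1 ⊢
  have h2 : ‖(c n : H →L[ℂ] H) (k - h j)‖ ≤ ‖k - h j‖ :=
    (ContinuousLinearMap.le_of_opNorm_le _ (hc n) _).trans_eq (one_mul _)
  rw [dist_eq_norm] at hj
  have h3 : (c n : H →L[ℂ] H) k = (c n : H →L[ℂ] H) (k - h j) + (c n : H →L[ℂ] H) (h j) := by simp
  rw [h3]
  exact (norm_add_le _ _).trans_lt (by linarith)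

/-- A normal positive functional is absolutely continuous with respect to the vector states of a
dense sequence. -/
theorem exists_re_apply_le (ω : M →ₗ[ℂ] ℂ) (hω : ∀ a, 0 ≤ a → 0 ≤ ω a)
    (hn : ∀ (A : ℕ → M) (a : M), IncreasesTo A a → Tendsto (fun n => ω (A n)) atTop (𝓝 (ω a)))
    {h : ℕ → H} (hd : DenseRange h) {ε : ℝ} (hε : 0 < ε) :
    ∃ (m : ℕ) (δ : ℝ), 0 < δ ∧ ∀ a : M, 0 ≤ a → a ≤ 1 →
      (∀ j < m, (⟪h j, (a : H →L[ℂ] H) (h j)⟫_ℂ).re ≤ δ) → (ω a).re ≤ ε := by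
  by_contra! hcon
  -- The tolerances 2⁻ᵏ are summable, so tails of ∑ aₖ are small on each hⱼ. The partial sums may be
  -- unbounded in norm, whence the truncation.
  choose a ha0 ha1 hah haω using fun k : ℕ => hcon k ((1 / 2) ^ k) (by positivity)
  have hmono : ∀ {a b : M}, a ≤ b → (ω a).re ≤ (ω b).re := by
    intro a b hab
    have h1 := (Complex.le_def.1 (hω _ (sub_nonneg.2 hab))).1
    simpa using h1
  let S : ℕ → ℕ → M := fun m n => ∑ k ∈ Finset.Ico m n, a k
  have hS0 : ∀ m n, 0 ≤ S m n := fun m n => Finset.sum_nonneg fun k _ => ha0 k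
  have hSn : ∀ m, Monotone (S m) := fun m n n' hnn =>
    Finset.sum_le_sum_of_subset_of_nonneg (Finset.Ico_subset_Ico_right hnn) fun k _ _ => ha0 k
  have hSm : ∀ n, Antitone fun m => S m n := fun n m m' hmm =>
    Finset.sum_le_sum_of_subset_of_nonneg (Finset.Ico_subset_Ico_left hmm) fun k _ _ => ha0 k
  have hbn : ∀ m, Monotone fun n => truncation (S m n) := fun m n n' hnn =>
    truncation_mono (hS0 m n) (hSn m hnn)
  choose c hc using fun m => exists_strong_limit (fun n => truncation (S m n)) (hbn m) 1
    fun n => truncation_le_one _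
  have hlub : ∀ m, IsLUB (Set.range fun n => truncation (S m n)) (c m) := fun m =>
    isLUB_of_tendsto (hbn m) fun k => tendsto_const_nhds.inner (hc m k)
  have hbc : ∀ m n, truncation (S m n) ≤ c m := fun m n => (hlub m).1 ⟨n, rfl⟩
  have hc0 : ∀ m, 0 ≤ c m := fun m => (truncation_nonneg _).trans (hbc m 0)
  have hc1 : ∀ m, c m ≤ 1 := fun m => (hlub m).2 <| by
    rintro _ ⟨n, rfl⟩
    exact truncation_le_one _
  have hcn : ∀ m, ‖c m‖ ≤ 1 := fun m =>
    (CStarAlgebra.norm_le_one_iff_of_nonneg _ (hc0 m)).2 (hc1 m)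
  have hcanti : Antitone c := fun m m' hmm => (hlub m').2 <| by
    rintro _ ⟨n, rfl⟩
    exact (truncation_mono (hS0 m' n) (hSm n hmm)).trans (hbc m n)
  -- From t ≤ 2t/(1 + t) on [0, 1] one gets aₘ ≤ 2cₘ, while ω(aₘ) exceeds ε.
  have hcω : ∀ m, ε / 2 < (ω (c m)).re := by
    intro m
    have h1 : a m ≤ (2 : ℝ≥0) • c m := by
      refine (le_two_smul_truncation (ha0 m) (ha1 m)).trans ?_
      have h2 := hbc m (m + 1)
      have h3 : S m (m + 1) = a m := by simp [S]
      rw [h3] at h2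
      exact smul_le_smul_of_nonneg_left h2 zero_le_two
    have h2 := hmono h1
    have h3 : ω ((2 : ℝ≥0) • c m) = 2 * ω (c m) := by
      have : (2 : ℝ≥0) • c m = (2 : ℂ) • c m := by
        rw [two_smul, two_smul]
      rw [this, map_smul, smul_eq_mul]
    rw [h3] at h2
    have h4 := haω m
    simp at h2
    linarith
  have hch : ∀ j m, j < m → ‖(c m : H →L[ℂ] H) (h j)‖ ^ 2 ≤ 2 * (1 / 2) ^ m := by
    intro j m hjm
    have h1 := ContinuousLinearMap.norm_apply_sq_le_of_nonneg
      (show (0 : H →L[ℂ] H) ≤ (c m : H →L[ℂ] H) from hc0 m) (h j)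
    have h2 : (⟪h j, (c m : H →L[ℂ] H) (h j)⟫_ℂ).re ≤ 2 * (1 / 2) ^ m := by
      refine le_of_tendsto ((Complex.continuous_re.tendsto _).comp
        (tendsto_const_nhds.inner (hc m (h j)))) (Eventually.of_forall fun n => ?_)
      refine (re_inner_le (truncation_le_self (hS0 m n)) (h j)).trans ?_
      rw [finset_sum_apply, inner_sum, Complex.re_sum]
      refine (Finset.sum_le_sum (g := fun k => (1 / 2 : ℝ) ^ k) fun k hk => ?_).trans ?_
      · exact hah k j (hjm.trans_le (Finset.mem_Ico.1 hk).1)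
      · rw [Finset.sum_Ico_eq_sum_range]
        simp only [pow_add]
        rw [← Finset.mul_sum, mul_comm]
        gcongr
        have := (summable_geometric_two).sum_le_tsum (Finset.range (n - m)) fun i _ => by positivity
        rwa [tsum_geometric_two] at this
    have h3 : 0 ≤ (⟪h j, (c m : H →L[ℂ] H) (h j)⟫_ℂ).re :=
      (Complex.le_def.1 ((nonneg_iff _).1 (hc0 m) (h j))).1
    refine h1.trans ((mul_le_of_le_one_left h3 (hcn m)).trans h2)
  have hcstrong := tendsto_apply_zero_of_denseRange hcn hd fun j => by
    rw [tendsto_zero_iff_norm_tendsto_zero]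
    have h1 : Tendsto (fun m => ‖(c m : H →L[ℂ] H) (h j)‖ ^ 2) atTop (𝓝 0) := by
      refine squeeze_zero' (Eventually.of_forall fun n => by positivity)
        ((eventually_gt_atTop j).mono fun m hm => hch j m hm) ?_
      simpa using (tendsto_pow_atTop_nhds_zero_of_lt_one (r := (1 / 2 : ℝ)) (by norm_num)
        (by norm_num)).const_mul 2
    have h2 := (Real.continuous_sqrt.tendsto _).comp h1
    simpa [Function.comp_def] using h2
  -- The cₘ decrease strongly to 0, so normality gives ω(cₘ) → 0, against the lower bound ε/2.
  have hinc : IncreasesTo (fun m => 1 - c m) 1 :=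
    { nonneg := fun m => sub_nonneg.2 (hc1 m)
      mono := fun m m' hmm => sub_le_sub_left (hcanti hmm) 1
      isLUB := by
        refine isLUB_of_tendsto (fun m m' hmm => sub_le_sub_left (hcanti hmm) 1) fun k => ?_
        have h1 := (tendsto_const_nhds (x := ⟪k, ((1 : M) : H →L[ℂ] H) k⟫_ℂ)).sub
          ((tendsto_const_nhds (x := k)).inner (𝕜 := ℂ) (hcstrong k))
        simp only [inner_zero_right, sub_zero] at h1
        refine h1.congr fun n => ?_
        rw [← inner_sub_right]
        rfl }
  have h1 := (tendsto_const_nhds (x := ω 1)).sub (hn _ _ hinc)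
  simp only [map_sub, sub_sub_cancel, sub_self] at h1
  have h2 := (Complex.continuous_re.tendsto _).comp h1
  have h3 := ge_of_tendsto h2 (Eventually.of_forall fun m => (hcω m).le)
  simp at h3
  linarith

end AbsoluteContinuity

/-! ### Approximation of normal functionals by vector functionals. -/

section VectorDual

variable {H : Type*} [NormedAddCommGroup H] [InnerProductSpace ℂ H] [CompleteSpace H]

/-- The bounded functional `a ↦ ⟪h, a k⟫` on a von Neumann algebra. -/
noncomputable def vectorDual (M : VonNeumannAlgebra H) (h k : H) : StrongDual ℂ M :=
  (vectorFunctional M h k).mkContinuous (‖h‖ * ‖k‖) fun a => by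
    rw [vectorFunctional_apply, mul_assoc]
    refine (norm_inner_le_norm _ _).trans ?_
    gcongr
    rw [mul_comm]
    exact (a : H →L[ℂ] H).le_opNorm k

variable {M : VonNeumannAlgebra H}

theorem vectorDual_apply (h k : H) (a : M) : vectorDual M h k a = ⟪h, (a : H →L[ℂ] H) k⟫_ℂ := rfl

theorem norm_vectorDual_le (h k : H) : ‖vectorDual M h k‖ ≤ ‖h‖ * ‖k‖ :=
  LinearMap.mkContinuous_norm_le _ (by positivity) _

variable (M) in
/-- The linear span of the vector functionals. -/
noncomputable def vectorSpan : Submodule ℂ (StrongDual ℂ M) :=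
  Submodule.span ℂ {f | ∃ h k, f = vectorDual M h k}

theorem vectorDual_mem_vectorSpan (h k : H) : vectorDual M h k ∈ vectorSpan M :=
  Submodule.subset_span ⟨h, k, rfl⟩

/-- Cauchy–Schwarz: positivity at (a − z)⋆(a − z) with z = t ω(a), t real, gives a quadratic in t of
nonpositive discriminant. -/
theorem norm_sq_apply_le_of_positive (ω : StrongDual ℂ M) (hω : ∀ a, 0 ≤ a → 0 ≤ ω a) (a : M) :
    ‖ω a‖ ^ 2 ≤ (ω 1).re * (ω (star a * a)).re := by
  have h1 : 0 ≤ (ω 1).re := (Complex.le_def.1 (hω 1 zero_le_one)).1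
  have hsa : ∀ b : M, ω (star b) = starRingEnd ℂ (ω b) := by
    intro b
    let φ : M →ₚ[ℂ] ℂ := PositiveLinearMap.mk₀ (ω : M →ₗ[ℂ] ℂ) hω
    exact map_star φ b
  have key : ∀ z : ℂ, 0 ≤ (ω (star a * a)).re - 2 * (starRingEnd ℂ z * ω a).re
      + ‖z‖ ^ 2 * (ω 1).re := by
    intro z
    have h2 := (Complex.le_def.1 (hω _ (star_mul_self_nonneg (a - z • (1 : M))))).1
    have h3 : star (a - z • (1 : M)) * (a - z • (1 : M))
        = star a * a - z • star a - (starRingEnd ℂ z) • a + (starRingEnd ℂ z * z) • (1 : M) := by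
      simp only [star_sub, star_smul, star_one, sub_mul, mul_sub, smul_mul_assoc, mul_smul_comm,
        mul_one, one_mul, smul_sub, smul_smul, starRingEnd_apply, mul_comm (star z) z]
      abel
    rw [h3, map_add, map_sub, map_sub, map_smul, map_smul, map_smul, hsa] at h2
    have h4 : (z * starRingEnd ℂ (ω a)).re = (starRingEnd ℂ z * ω a).re := by
      simp [Complex.mul_re]
    have h5 : (starRingEnd ℂ z * z * ω 1).re = ‖z‖ ^ 2 * (ω 1).re := by
      rw [Complex.conj_mul', ← Complex.ofReal_pow, Complex.re_ofReal_mul]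
    simp only [smul_eq_mul, Complex.add_re, Complex.sub_re, h4, h5, Complex.zero_re] at h2
    linarith
  have key2 : ∀ t : ℝ, 0 ≤ ‖ω a‖ ^ 2 * (ω 1).re * (t * t) + -(2 * ‖ω a‖ ^ 2) * t
      + (ω (star a * a)).re := by
    intro t
    have h2 := key ((t : ℂ) * ω a)
    have h3 : (starRingEnd ℂ ((t : ℂ) * ω a) * ω a).re = t * ‖ω a‖ ^ 2 := by
      rw [map_mul, Complex.conj_ofReal, mul_assoc, Complex.re_ofReal_mul, Complex.conj_mul',
        ← Complex.ofReal_pow, Complex.ofReal_re]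
    rw [h3, norm_mul, Complex.norm_real, mul_pow, Real.norm_eq_abs, sq_abs] at h2
    nlinarith
  have h6 := discrim_le_zero key2
  rw [discrim] at h6
  rcases eq_or_ne (ω a) 0 with h0 | h0
  · rw [h0, norm_zero, zero_pow two_ne_zero]
    exact mul_nonneg h1 (Complex.le_def.1 (hω _ (star_mul_self_nonneg a))).1
  · have h7 : 0 < ‖ω a‖ ^ 2 := by positivity
    nlinarith

/-- A functional dominated by the norm and finitely many vectors is close to the span of the vector
functionals. -/
theorem exists_norm_sub_le_of_le (ω : StrongDual ℂ M) {m : ℕ} (h : Fin m → H) {ε C : ℝ}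
    (hε : 0 < ε) (hC : 0 < C)
    (hω : ∀ a : M, ‖ω a‖ ≤ ε * ‖a‖ + C * ‖fun j => (a : H →L[ℂ] H) (h j)‖) :
    ∃ g ∈ vectorSpan M, ‖ω - g‖ ≤ 2 * ε := by
  -- The hypothesis says that ω, transported to the range of `J`, is bounded by 2 for the maximum
  -- norm. A Hahn–Banach extension splits into a part on `M`, of norm at most 2ε after scaling, and
  -- a part on Hᵐ.
  let J : M →ₗ[ℂ] M × (Fin m → H) :=
    { toFun := fun a => ((ε : ℂ) • a, (C : ℂ) • fun j => (a : H →L[ℂ] H) (h j))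
      map_add' := fun a b => by
        ext <;> simp
      map_smul' := fun z a => by
        refine Prod.ext (smul_comm _ _ _) ?_
        exact smul_comm (C : ℂ) z fun j => (a : H →L[ℂ] H) (h j) }
  have hJ : ∀ a, ‖ω a‖ ≤ 2 * ‖J a‖ := by
    intro a
    have h1 : ε * ‖a‖ ≤ ‖J a‖ := by
      refine le_trans ?_ (norm_fst_le (J a))
      change _ ≤ ‖(ε : ℂ) • a‖
      rw [norm_smul, Complex.norm_real, Real.norm_of_nonneg hε.le]
    have h2 : C * ‖fun j => (a : H →L[ℂ] H) (h j)‖ ≤ ‖J a‖ := by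
      refine le_trans ?_ (norm_snd_le (J a))
      change _ ≤ ‖(C : ℂ) • fun j => (a : H →L[ℂ] H) (h j)‖
      rw [norm_smul, Complex.norm_real, Real.norm_of_nonneg hC.le]
    linarith [hω a]
  have hinj : Function.Injective J := by
    intro a b hab
    have h1 : (ε : ℂ) • a = (ε : ℂ) • b := congrArg Prod.fst hab
    exact smul_right_injective M (Complex.ofReal_ne_zero.2 hε.ne') h1
  let e := LinearEquiv.ofInjective J hinj
  let ℓ : StrongDual ℂ (LinearMap.range J) :=
    ((ω : M →ₗ[ℂ] ℂ) ∘ₗ (e.symm : LinearMap.range J →ₗ[ℂ] M)).mkContinuous 2 fun y => by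
      have h1 := hJ (e.symm y)
      have h2 : J (e.symm y) = y := congrArg Subtype.val (e.apply_symm_apply y)
      rw [h2] at h1
      exact h1
  obtain ⟨Λ, hΛ, hΛn⟩ := exists_extension_norm_eq (𝕜 := ℂ) (LinearMap.range J) ℓ
  have hΛ2 : ‖Λ‖ ≤ 2 := hΛn.trans_le (LinearMap.mkContinuous_norm_le _ zero_le_two _)
  have hΛJ : ∀ a, Λ (J a) = ω a := by
    intro a
    have h1 := hΛ (e a)
    have h2 : ℓ (e a) = ω a := congrArg ω (e.symm_apply_apply a)
    rw [h2] at h1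
    exact h1
  -- By Riesz representation the part on Hᵐ is given by vectors, so it becomes a sum of vector
  -- functionals.
  let q : Fin m → StrongDual ℂ H := fun j =>
    Λ ∘L ContinuousLinearMap.inr ℂ M (Fin m → H) ∘L ContinuousLinearMap.single ℂ (fun _ => H) j
  let k : Fin m → H := fun j => (InnerProductSpace.toDual ℂ H).symm (q j)
  refine ⟨∑ j, (C : ℂ) • vectorDual M (k j) (h j), ?_, ?_⟩
  · exact Submodule.sum_mem _ fun j _ =>
      Submodule.smul_mem _ _ (vectorDual_mem_vectorSpan _ _)
  · refine ContinuousLinearMap.opNorm_le_bound _ (by positivity) fun a => ?_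
    have h1 : (ω - ∑ j, (C : ℂ) • vectorDual M (k j) (h j)) a = Λ ((ε : ℂ) • a, 0) := by
      have h2 : ∀ j, vectorDual M (k j) (h j) a
          = Λ (0, Pi.single j ((a : H →L[ℂ] H) (h j))) := fun j =>
        InnerProductSpace.toDual_symm_apply
      have h3 : J a = ((ε : ℂ) • a, 0)
          + ∑ j, (C : ℂ) • ((0 : M), (Pi.single j ((a : H →L[ℂ] H) (h j)) : Fin m → H)) := by
        refine Prod.ext ?_ ?_
        · simp [J, Prod.fst_sum]
        · simp only [J, Prod.snd_add, Prod.snd_sum, Prod.smul_snd, zero_add]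
          rw [← Finset.smul_sum, Finset.univ_sum_single]
          rfl
      rw [sub_apply, sum_apply, ← hΛJ, h3, map_add, map_sum]
      simp only [smul_apply, h2, map_smul, add_sub_cancel_right]
    rw [h1]
    refine (Λ.le_of_opNorm_le hΛ2 _).trans ?_
    rw [mul_assoc]
    gcongr
    rw [Prod.norm_mk, norm_zero, norm_smul, Complex.norm_real, Real.norm_of_nonneg hε.le]
    exact max_le le_rfl (by positivity)

/-- Normal positive functionals are norm limits of sums of vector functionals. -/
theorem mem_closure_vectorSpan [TopologicalSpace.SeparableSpace H] (ω : StrongDual ℂ M)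
    (hω : ∀ a, 0 ≤ a → 0 ≤ ω a)
    (hn : ∀ (A : ℕ → M) (a : M), IncreasesTo A a → Tendsto (fun n => ω (A n)) atTop (𝓝 (ω a))) :
    ω ∈ (vectorSpan M).topologicalClosure := by
  change ω ∈ closure (vectorSpan M : Set (StrongDual ℂ M))
  rw [Metric.mem_closure_iff]
  intro ε hε
  have h1 : 0 ≤ (ω 1).re := (Complex.le_def.1 (hω 1 zero_le_one)).1
  -- The approximation costs 2η, which must be strictly less than ε.
  set η := ε / 3 with hη
  have hη0 : 0 < η := by positivity
  obtain ⟨m, δ, hδ, hm⟩ := exists_re_apply_le (ω : M →ₗ[ℂ] ℂ) hω hn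
    (TopologicalSpace.denseRange_denseSeq H) (ε := η ^ 2 / ((ω 1).re + 1)) (by positivity)
  set h : Fin m → H := fun j => TopologicalSpace.denseSeq H j
  suffices hbound : ∀ a : M,
      ‖ω a‖ ≤ η * ‖a‖ + (‖ω‖ / √δ + 1) * ‖fun j => (a : H →L[ℂ] H) (h j)‖ by
    obtain ⟨g, hg, hgn⟩ := exists_norm_sub_le_of_le ω h hη0 (by positivity) hbound
    refine ⟨g, hg, ?_⟩
    rw [dist_eq_norm]
    linarith
  intro a
  -- If the vectors a hⱼ are small relative to ‖a‖, absolute continuity for a⋆a/‖a‖² and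
  -- Cauchy–Schwarz give the bound η‖a‖. Otherwise they dominate ‖a‖ itself.
  rcases le_or_gt ‖fun j => (a : H →L[ℂ] H) (h j)‖ (√δ * ‖a‖) with hle | hgt
  · refine le_trans ?_ (le_add_of_nonneg_right (by positivity))
    rcases eq_or_ne a 0 with rfl | ha
    · simp
    have ha0 : 0 < ‖a‖ := norm_pos_iff.2 ha
    set r : ℝ := (‖a‖ ^ 2)⁻¹ with hr
    have hr0 : 0 < r := by positivity
    have e1 : ∀ b : M, r • b = (r : ℂ) • b := fun b => rfl
    have h2 : (0 : M) ≤ r • (star a * a) := smul_nonneg hr0.le (star_mul_self_nonneg a)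
    have h3 := hm (r • (star a * a)) h2 ?_ fun j hj => ?_
    · rw [e1] at h3
      have e2 : ((ω : M →ₗ[ℂ] ℂ) ((r : ℂ) • (star a * a))).re = r * (ω (star a * a)).re := by
        rw [map_smul, smul_eq_mul, Complex.re_ofReal_mul]
        rfl
      rw [e2, hr, inv_mul_le_iff₀ (by positivity)] at h3
      have h4 := norm_sq_apply_le_of_positive ω hω a
      refine le_of_sq_le_sq ?_ (by positivity)
      calc ‖ω a‖ ^ 2 ≤ (ω 1).re * (ω (star a * a)).re := h4
        _ ≤ (ω 1).re * (‖a‖ ^ 2 * (η ^ 2 / ((ω 1).re + 1))) := by gcongr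
        _ = ((ω 1).re / ((ω 1).re + 1)) * (η * ‖a‖) ^ 2 := by ring
        _ ≤ 1 * (η * ‖a‖) ^ 2 := by
          gcongr
          rw [div_le_one (by positivity)]
          linarith
        _ = _ := one_mul _
    · rw [← CStarAlgebra.norm_le_one_iff_of_nonneg _ h2, norm_smul, Real.norm_of_nonneg hr0.le,
        CStarRing.norm_star_mul_self, hr]
      rw [← sq, inv_mul_cancel₀ (by positivity)]
    · have e2 : ⟪TopologicalSpace.denseSeq H j,
          ((r • (star a * a) : M) : H →L[ℂ] H) (TopologicalSpace.denseSeq H j)⟫_ℂ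
          = (r : ℂ) * ((‖(a : H →L[ℂ] H) (h ⟨j, hj⟩)‖ ^ 2 : ℝ) : ℂ) := by
        rw [← inner_self_eq_ofReal_norm_sq, ← inner_star_right]
        exact inner_smul_right _ _ _
      rw [e2, Complex.re_ofReal_mul, Complex.ofReal_re, hr, inv_mul_le_iff₀ (by positivity)]
      have h4 := (norm_le_pi_norm (fun j => (a : H →L[ℂ] H) (h j)) ⟨j, hj⟩).trans hle
      calc _ ≤ (√δ * ‖a‖) ^ 2 := by gcongr
        _ = _ := by rw [mul_pow, Real.sq_sqrt hδ.le, mul_comm]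
  · refine le_trans ?_ (le_add_of_nonneg_left (by positivity))
    have hδ0 : 0 < √δ := Real.sqrt_pos.2 hδ
    calc ‖ω a‖ ≤ ‖ω‖ * ‖a‖ := ω.le_opNorm a
      _ = ‖ω‖ / √δ * (√δ * ‖a‖) := by field_simp
      _ ≤ ‖ω‖ / √δ * ‖fun j => (a : H →L[ℂ] H) (h j)‖ := by gcongr
      _ ≤ _ := by
        gcongr
        linarith

end VectorDual

/-! ### Successive approximation and ℓ¹ series. -/

section Series

/-- A bounded operator on a Banach space whose range contains, up to half the norm, all elements
of a subspace, has that subspace in its range. -/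
theorem _root_.ContinuousLinearMap.exists_apply_eq_of_approx {X Y : Type*} [NormedAddCommGroup X]
    [NormedSpace ℂ X] [CompleteSpace X] [NormedAddCommGroup Y] [NormedSpace ℂ Y] (T : X →L[ℂ] Y)
    (S : Set Y)
    (h : ∀ y ∈ S, ∃ x, y - T x ∈ S ∧ ‖x‖ ≤ ‖y‖ ∧ ‖y - T x‖ ≤ ‖y‖ / 2) {y : Y} (hy : y ∈ S) :
    ∃ x, T x = y := by
  choose g hgS hgx hgy using fun y : S => h y y.2
  -- The remainder after n corrections; its norm is at most ‖y‖ / 2ⁿ.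
  let r : ℕ → S := fun n => (fun y : S => (⟨y - T (g y), hgS y⟩ : S))^[n] ⟨y, hy⟩
  have hr : ∀ n, (r (n + 1) : Y) = r n - T (g (r n)) := fun n => by
    simp only [r, Function.iterate_succ_apply']
  have hrn : ∀ n, ‖(r n : Y)‖ ≤ ‖y‖ * (1 / 2) ^ n := by
    intro n
    induction n with
    | zero => simp [r]
    | succ n ih =>
      rw [hr, pow_succ]
      linarith [hgy (r n)]
  have hs : Summable fun n => g (r n) := by
    refine Summable.of_norm_bounded (summable_geometric_two.mul_left ‖y‖) fun n => ?_
    exact (hgx _).trans (hrn n)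
  refine ⟨∑' n, g (r n), ?_⟩
  rw [T.map_tsum hs]
  have h1 : Tendsto (fun n => ∑ k ∈ Finset.range n, T (g (r k))) atTop (𝓝 (∑' n, T (g (r n)))) :=
    (T.summable hs).hasSum.tendsto_sum_nat
  have h2 : ∀ n, ∑ k ∈ Finset.range n, T (g (r k)) = y - r n := by
    intro n
    induction n with
    | zero => simp [r]
    | succ n ih => rw [Finset.sum_range_succ, ih, hr]; abel
  have h3 : Tendsto (fun n => (r n : Y)) atTop (𝓝 0) := by
    refine squeeze_zero_norm hrn ?_
    simpa using (tendsto_pow_atTop_nhds_zero_of_lt_one (r := (1 / 2 : ℝ)) (by norm_num)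
      (by norm_num)).const_mul ‖y‖
  have h4 := (tendsto_const_nhds (x := y)).sub h3
  simp only [h2] at h1
  rw [sub_zero] at h4
  exact tendsto_nhds_unique h1 h4

theorem summable_norm_lp_one (c : lp (fun _ : ℕ => ℂ) 1) : Summable fun n => ‖c n‖ := by
  have := lp.memℓp c
  rw [memℓp_gen_iff (by simp)] at this
  simpa using this

theorem norm_lp_one (c : lp (fun _ : ℕ => ℂ) 1) : ‖c‖ = ∑' n, ‖c n‖ := by
  rw [lp.norm_eq_tsum_rpow (by simp)]
  simp

variable {Y : Type*} [NormedAddCommGroup Y] [NormedSpace ℂ Y] [CompleteSpace Y]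

theorem summable_lp_smul {F : ℕ → Y} (hF : ∀ n, ‖F n‖ ≤ 1) (c : lp (fun _ : ℕ => ℂ) 1) :
    Summable fun n => c n • F n := by
  refine Summable.of_norm_bounded (summable_norm_lp_one c) fun n => ?_
  rw [norm_smul]
  exact mul_le_of_le_one_right (norm_nonneg _) (hF n)

/-- The map `c ↦ ∑ cₙ Fₙ` on `ℓ¹` defined by a bounded sequence of vectors. -/
noncomputable def lpSeries (F : ℕ → Y) (hF : ∀ n, ‖F n‖ ≤ 1) : lp (fun _ : ℕ => ℂ) 1 →L[ℂ] Y :=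
  LinearMap.mkContinuous
    { toFun := fun c => ∑' n, c n • F n
      map_add' := fun c d => by
        rw [← (summable_lp_smul hF c).tsum_add (summable_lp_smul hF d)]
        simp [add_smul]
      map_smul' := fun z c => by
        rw [RingHom.id_apply, ← (summable_lp_smul hF c).tsum_const_smul]
        simp [smul_smul] } 1 fun c => by
    rw [one_mul, norm_lp_one]
    refine tsum_of_norm_bounded (summable_norm_lp_one c).hasSum fun n => ?_
    rw [norm_smul]
    exact mul_le_of_le_one_right (norm_nonneg _) (hF n)

theorem lpSeries_apply (F : ℕ → Y) (hF : ∀ n, ‖F n‖ ≤ 1) (c : lp (fun _ : ℕ => ℂ) 1) :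
    lpSeries F hF c = ∑' n, c n • F n := rfl

theorem lpSeries_single (F : ℕ → Y) (hF : ∀ n, ‖F n‖ ≤ 1) (n : ℕ) (z : ℂ) :
    lpSeries F hF (lp.single 1 n z) = z • F n := by
  rw [lpSeries_apply, tsum_eq_single n fun k hk => ?_]
  · simp
  · simp [lp.single_apply, Pi.single_eq_of_ne hk]

end Series

/-! ### Series representation of the closed span of the vector functionals. -/

section Predual

variable {H : Type*} [NormedAddCommGroup H] [InnerProductSpace ℂ H] [CompleteSpace H]
variable {M : VonNeumannAlgebra H}

/-- Every bounded functional on the space of functionals on `M` agrees with the evaluation at an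
element of `M` on the closed span of the vector functionals. -/
theorem exists_eq_apply (φ : StrongDual ℂ (StrongDual ℂ M)) :
    ∃ a : M, ∀ f ∈ (vectorSpan M).topologicalClosure, φ f = f a := by
  have hbound : ∀ u v : H, ‖φ (vectorDual M u v)‖ ≤ ‖φ‖ * ‖u‖ * ‖v‖ := by
    intro u v
    refine (φ.le_opNorm _).trans ?_
    rw [mul_assoc]
    gcongr
    exact norm_vectorDual_le u v
  let B₀ : H →ₗ⋆[ℂ] H →ₗ[ℂ] ℂ := LinearMap.mk₂'ₛₗ (starRingEnd ℂ) (RingHom.id ℂ)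
    (fun u v => φ (vectorDual M u v))
    (fun u u' v => by
      rw [← map_add]
      refine congrArg φ (ContinuousLinearMap.ext fun a => ?_)
      exact inner_add_left _ _ _)
    (fun z u v => by
      rw [← map_smul]
      refine congrArg φ (ContinuousLinearMap.ext fun a => ?_)
      exact inner_smul_left _ _ _)
    (fun u v v' => by
      rw [← map_add]
      refine congrArg φ (ContinuousLinearMap.ext fun a => ?_)
      simp [vectorDual_apply])
    (fun z u v => by
      rw [← map_smul]
      refine congrArg φ (ContinuousLinearMap.ext fun a => ?_)
      simp [vectorDual_apply])
  let B : H →L⋆[ℂ] H →L[ℂ] ℂ := B₀.mkContinuous₂ ‖φ‖ hbound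
  set X : H →L[ℂ] H := (InnerProductSpace.continuousLinearMapOfBilin B).adjoint with hX
  have hXi : ∀ u v, ⟪u, X v⟫_ℂ = φ (vectorDual M u v) := by
    intro u v
    rw [hX, ContinuousLinearMap.adjoint_inner_right,
      InnerProductSpace.continuousLinearMapOfBilin_apply]
    rfl
  -- For T in the commutant of `M`, the vector functionals of (T⋆u, v) and (u, T v) coincide on `M`,
  -- so X commutes with T.
  have hmem : X ∈ M := by
    rw [← SetLike.mem_coe, ← M.centralizer_centralizer, Set.mem_centralizer_iff]
    intro T hT
    rw [Set.mem_centralizer_iff] at hT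
    refine ContinuousLinearMap.ext fun v => ext_inner_left ℂ fun u => ?_
    rw [mul_apply_eq_comp, mul_apply_eq_comp, ← ContinuousLinearMap.adjoint_inner_left, hXi, hXi]
    refine congrArg φ (ContinuousLinearMap.ext fun a => ?_)
    rw [vectorDual_apply, vectorDual_apply, ContinuousLinearMap.adjoint_inner_left]
    exact congrArg (fun w => ⟪u, w⟫_ℂ) (DFunLike.congr_fun (hT a a.2) v).symm
  refine ⟨⟨X, hmem⟩, fun f hf => ?_⟩
  let ψ : StrongDual ℂ (StrongDual ℂ M) :=
    φ - ContinuousLinearMap.apply ℂ ℂ (⟨X, hmem⟩ : M)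
  have hle : (vectorSpan M).topologicalClosure ≤ LinearMap.ker (ψ : StrongDual ℂ M →ₗ[ℂ] ℂ) := by
    refine Submodule.topologicalClosure_minimal _ ?_ (ContinuousLinearMap.isClosed_ker ψ)
    refine Submodule.span_le.2 ?_
    rintro _ ⟨u, v, rfl⟩
    change φ (vectorDual M u v) - vectorDual M u v ⟨X, hmem⟩ = 0
    rw [← hXi, vectorDual_apply, sub_self]
  exact sub_eq_zero.1 (hle hf)

omit [CompleteSpace H] in
theorem norm_le_of_norm_inner_le {a : H →L[ℂ] H} {s : ℝ} (hs : 0 ≤ s)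
    (h : ∀ u v : H, ‖u‖ ≤ 1 → ‖v‖ ≤ 1 → ‖⟪u, a v⟫_ℂ‖ ≤ s) : ‖a‖ ≤ s := by
  have hscale : ∀ w : H, ∃ u : H, ‖u‖ ≤ 1 ∧ w = (‖w‖ : ℂ) • u := by
    intro w
    rcases eq_or_ne w 0 with rfl | hw
    · exact ⟨0, by simp, by simp⟩
    · have hw' : (‖w‖ : ℂ) ≠ 0 := by simpa using hw
      exact ⟨(‖w‖ : ℂ)⁻¹ • w, (norm_smul_inv_norm hw).le, by rw [smul_inv_smul₀ hw']⟩
  refine ContinuousLinearMap.opNorm_le_bound _ hs fun w => ?_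
  obtain ⟨v, hv, hwv⟩ := hscale w
  obtain ⟨u, hu, huv⟩ := hscale (a w)
  rcases eq_or_ne (a w) 0 with h0 | h0
  · rw [h0, norm_zero]; positivity
  have h1 : ‖⟪a w, a w⟫_ℂ‖ ≤ ‖a w‖ * (‖w‖ * s) := by
    have e : ⟪a w, a w⟫_ℂ = ⟪(‖a w‖ : ℂ) • u, a ((‖w‖ : ℂ) • v)⟫_ℂ := by rw [← huv, ← hwv]
    rw [e, map_smul, inner_smul_left, inner_smul_right, norm_mul, norm_mul, Complex.conj_ofReal,
      Complex.norm_real, Complex.norm_real, norm_norm, norm_norm]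
    gcongr
    exact h u v hu hv
  rw [inner_self_eq_ofReal_norm_sq, Complex.norm_real, norm_pow, norm_norm, sq] at h1
  have h2 := le_of_mul_le_mul_left h1 (norm_pos_iff.2 h0)
  linarith

variable [TopologicalSpace.SeparableSpace H]

instance separableSpace_unitBallProd : TopologicalSpace.SeparableSpace
    (Metric.closedBall (0 : H) 1 × Metric.closedBall (0 : H) 1) := by
  have := UniformSpace.secondCountable_of_separable H
  infer_instance

instance nonempty_unitBallProd :
    Nonempty (Metric.closedBall (0 : H) 1 × Metric.closedBall (0 : H) 1) :=
  ⟨⟨⟨0, by simp⟩, ⟨0, by simp⟩⟩⟩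

variable (H) in
/-- A dense sequence of pairs of vectors in the unit ball. -/
noncomputable def densePair :
    ℕ → Metric.closedBall (0 : H) 1 × Metric.closedBall (0 : H) 1 :=
  TopologicalSpace.denseSeq (Metric.closedBall (0 : H) 1 × Metric.closedBall (0 : H) 1)

omit [InnerProductSpace ℂ H] [CompleteSpace H] in
theorem norm_densePair_fst_le (n : ℕ) : ‖((densePair H n).1 : H)‖ ≤ 1 :=
  mem_closedBall_zero_iff.1 (densePair H n).1.2

omit [InnerProductSpace ℂ H] [CompleteSpace H] in
theorem norm_densePair_snd_le (n : ℕ) : ‖((densePair H n).2 : H)‖ ≤ 1 :=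
  mem_closedBall_zero_iff.1 (densePair H n).2.2

variable (M) in
/-- The vector functionals of a dense sequence of pairs of vectors. -/
noncomputable def denseDual (n : ℕ) : StrongDual ℂ M :=
  vectorDual M (densePair H n).1 (densePair H n).2

theorem norm_denseDual_le (n : ℕ) : ‖denseDual M n‖ ≤ 1 :=
  (norm_vectorDual_le _ _).trans
    (mul_le_one₀ (norm_densePair_fst_le n) (norm_nonneg _) (norm_densePair_snd_le n))

/-- Otherwise Hahn–Banach separates f by some φ with Re φ < s on the image of the ℓ¹ ball and Re
φ(f) > s. On the closed span φ is evaluation at some a in `M`. The bound on a dense family of vector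
functionals gives ‖a‖ ≤ s, hence Re φ(f) ≤ s, a contradiction. -/
theorem mem_closure_lpSeries {f : StrongDual ℂ M} (hf : f ∈ (vectorSpan M).topologicalClosure)
    (hf1 : ‖f‖ ≤ 1) : f ∈ closure
      (lpSeries (denseDual M) norm_denseDual_le '' Metric.closedBall 0 1) := by
  by_contra hcon
  have hconv : Convex ℝ (closure
      (lpSeries (denseDual M) norm_denseDual_le '' Metric.closedBall 0 1)) := by
    refine Convex.closure ?_
    exact (convex_closedBall (0 : lp (fun _ : ℕ => ℂ) 1) 1).is_linear_image
      ((lpSeries (denseDual M) norm_denseDual_le).restrictScalars ℝ).toLinearMap.isLinear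
  obtain ⟨φ, s, hφs, hφf⟩ := RCLike.geometric_hahn_banach_closed_point (𝕜 := ℂ) hconv isClosed_closure
    hcon
  obtain ⟨a, ha⟩ := exists_eq_apply φ
  have hs0 : 0 < s := by
    have := hφs 0 (subset_closure ⟨0, by simp, by simp⟩)
    simpa using this
  have hn : ∀ n, ‖φ (denseDual M n)‖ ≤ s := by
    intro n
    obtain ⟨z, hz, hzφ⟩ : ∃ z : ℂ, ‖z‖ = 1 ∧ z * φ (denseDual M n) = ‖φ (denseDual M n)‖ := by
      obtain ⟨z, hz, h⟩ := RCLike.exists_norm_mul_eq_self (φ (denseDual M n))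
      rcases eq_or_ne (φ (denseDual M n)) 0 with h0 | h0
      · exact ⟨1, by simp, by simp [h0]⟩
      · have hz0 : z ≠ 0 := by
          rintro rfl
          simp at hz
        refine ⟨z⁻¹, by rw [norm_inv, hz, inv_one], ?_⟩
        rw [inv_mul_eq_iff_eq_mul₀ hz0]
        exact h.symm
    have h1 := hφs (z • denseDual M n) (subset_closure ⟨lp.single 1 n z, ?_, lpSeries_single _ _ _ _⟩)
    · rw [map_smul, smul_eq_mul, hzφ] at h1
      simpa using h1.le
    · rw [mem_closedBall_zero_iff, lp.norm_single (by simp), hz]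
  have hall : ∀ p : Metric.closedBall (0 : H) 1 × Metric.closedBall (0 : H) 1,
      ‖⟪(p.1 : H), (a : H →L[ℂ] H) p.2⟫_ℂ‖ ≤ s := by
    intro p
    refine (TopologicalSpace.denseRange_denseSeq
      (Metric.closedBall (0 : H) 1 × Metric.closedBall (0 : H) 1)).induction_on
      (p := fun p => ‖⟪(p.1 : H), (a : H →L[ℂ] H) p.2⟫_ℂ‖ ≤ s) p ?_ fun n => ?_
    · exact isClosed_le (by fun_prop) continuous_const
    · have h1 := hn n
      rw [ha (denseDual M n) (Submodule.le_topologicalClosure _ (vectorDual_mem_vectorSpan _ _))] at h1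
      exact h1
  have hanorm : ‖a‖ ≤ s := norm_le_of_norm_inner_le (a := (a : H →L[ℂ] H)) hs0.le fun u v hu hv =>
    hall ⟨⟨u, mem_closedBall_zero_iff.2 hu⟩, ⟨v, mem_closedBall_zero_iff.2 hv⟩⟩
  have h1 : RCLike.re (φ f) ≤ s := by
    rw [ha f hf]
    refine (RCLike.re_le_norm _).trans ((f.le_opNorm a).trans ?_)
    calc ‖f‖ * ‖a‖ ≤ 1 * s := by gcongr
      _ = s := one_mul s
  linarith

/-- As in the open mapping theorem, approximating the unit ball by images of the ℓ¹ ball to within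
1/2 yields exact representations. -/
theorem exists_lpSeries_eq {f : StrongDual ℂ M} (hf : f ∈ (vectorSpan M).topologicalClosure) :
    ∃ c, lpSeries (denseDual M) norm_denseDual_le c = f := by
  refine ContinuousLinearMap.exists_apply_eq_of_approx _
    ((vectorSpan M).topologicalClosure : Set (StrongDual ℂ M)) (fun f hf => ?_) hf
  have hrange : ∀ c, lpSeries (denseDual M) norm_denseDual_le c ∈ (vectorSpan M).topologicalClosure := by
    intro c
    have h1 := (summable_lp_smul (norm_denseDual_le (M := M)) c).hasSum
    refine (Submodule.isClosed_topologicalClosure _).mem_of_tendsto h1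
      (Eventually.of_forall fun s => ?_)
    exact Submodule.sum_mem _ fun n _ => Submodule.smul_mem _ _
      (Submodule.le_topologicalClosure _ (vectorDual_mem_vectorSpan _ _))
  rcases eq_or_ne f 0 with rfl | hf0
  · exact ⟨0, by simpa using hf, by simp, by simp⟩
  have hn : 0 < ‖f‖ := norm_pos_iff.2 hf0
  have hn' : (‖f‖ : ℂ) ≠ 0 := by simpa using hf0
  have h1 := mem_closure_lpSeries (f := (‖f‖ : ℂ)⁻¹ • f) (Submodule.smul_mem _ _ hf)
    (norm_smul_inv_norm hf0).le
  obtain ⟨_, ⟨c, hc, rfl⟩, hcd⟩ := Metric.mem_closure_iff.1 h1 (1 / 2) (by norm_num)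
  refine ⟨(‖f‖ : ℂ) • c, Submodule.sub_mem _ hf (hrange _), ?_, ?_⟩
  · rw [norm_smul, Complex.norm_real, norm_norm]
    exact mul_le_of_le_one_right (norm_nonneg _) (mem_closedBall_zero_iff.1 hc)
  · rw [map_smul]
    have h2 : f - (‖f‖ : ℂ) • lpSeries (denseDual M) norm_denseDual_le c
        = (‖f‖ : ℂ) • ((‖f‖ : ℂ)⁻¹ • f - lpSeries (denseDual M) norm_denseDual_le c) := by
      rw [smul_sub, smul_inv_smul₀ hn']
    rw [h2, norm_smul, Complex.norm_real, norm_norm, ← dist_eq_norm]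
    have := hcd.le
    nlinarith

/-- The functionals in the closed span of the vector functionals are those of the form
`a ↦ ∑ ⟪xₙ, a yₙ⟫` with square-summable sequences. -/
theorem exists_tsum_inner_eq {f : StrongDual ℂ M} (hf : f ∈ (vectorSpan M).topologicalClosure) :
    ∃ x y : ℕ → H, (Summable fun n => ‖x n‖ ^ 2) ∧ (Summable fun n => ‖y n‖ ^ 2) ∧
      ∀ a : M, f a = ∑' n, ⟪x n, (a : H →L[ℂ] H) (y n)⟫_ℂ := by
  obtain ⟨c, hc⟩ := exists_lpSeries_eq hf
  -- Each coefficient is split as √|cₙ| · (cₙ/√|cₙ|), so both squared norms are at most |cₙ|. For cₙ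
  -- = 0 the quotient is 0 by convention.
  refine ⟨fun n => ((√‖c n‖ : ℝ) : ℂ) • (densePair H n).1,
    fun n => (c n / (√‖c n‖ : ℝ)) • (densePair H n).2, ?_, ?_, fun a => ?_⟩
  · refine Summable.of_nonneg_of_le (fun n => by positivity) (fun n => ?_) (summable_norm_lp_one c)
    rw [norm_smul, Complex.norm_real, Real.norm_of_nonneg (Real.sqrt_nonneg _), mul_pow,
      Real.sq_sqrt (norm_nonneg _)]
    exact mul_le_of_le_one_right (norm_nonneg _)
      (pow_le_one₀ (norm_nonneg _) (norm_densePair_fst_le n))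
  · refine Summable.of_nonneg_of_le (fun n => by positivity) (fun n => ?_) (summable_norm_lp_one c)
    rw [norm_smul, norm_div, Complex.norm_real, Real.norm_of_nonneg (Real.sqrt_nonneg _),
      Real.div_sqrt, mul_pow, Real.sq_sqrt (norm_nonneg _)]
    exact mul_le_of_le_one_right (norm_nonneg _)
      (pow_le_one₀ (norm_nonneg _) (norm_densePair_snd_le n))
  · rw [← hc, lpSeries_apply]
    have h1 := (ContinuousLinearMap.apply ℂ ℂ a).map_tsum (summable_lp_smul norm_denseDual_le c)
    refine h1.trans (tsum_congr fun n => ?_)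
    change c n * ⟪((densePair H n).1 : H), (a : H →L[ℂ] H) (densePair H n).2⟫_ℂ = _
    rw [map_smul, inner_smul_left, inner_smul_right, Complex.conj_ofReal]
    rcases eq_or_ne (c n) 0 with h0 | h0
    · simp [h0]
    · have h2 : ((√‖c n‖ : ℝ) : ℂ) ≠ 0 := by
        rw [Complex.ofReal_ne_zero, Real.sqrt_ne_zero (norm_nonneg _), norm_ne_zero_iff]
        exact h0
      rw [← mul_assoc, mul_div_cancel₀ _ h2]

end Predual

/-! ### Normal completely positive maps are weak*-continuous. -/

section NormalMaps

variable {H : Type*} [NormedAddCommGroup H] [InnerProductSpace ℂ H] [CompleteSpace H]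
variable {K : Type*} [NormedAddCommGroup K] [InnerProductSpace ℂ K] [CompleteSpace K]
variable {M : VonNeumannAlgebra H} {N : VonNeumannAlgebra K}

theorem exists_norm_le_of_isCompletelyPositive {E : M →ₗ[ℂ] N} (hE : IsCompletelyPositive E) :
    ∃ C : ℝ, 0 ≤ C ∧ ∀ a, ‖E a‖ ≤ C * ‖a‖ := by
  obtain ⟨C, hC⟩ := PositiveLinearMap.exists_norm_apply_le
    (PositiveLinearMap.mk₀ E fun a => map_nonneg_of_isCompletelyPositive hE)
  exact ⟨C, C.2, hC⟩

theorem continuous_tsum_inner {x y : ℕ → H} (hx : Summable fun n => ‖x n‖ ^ 2)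
    (hy : Summable fun n => ‖y n‖ ^ 2) : @Continuous M ℂ M.weakStarTopology inferInstance
      fun a => ∑' n, ⟪x n, (a : H →L[ℂ] H) (y n)⟫_ℂ := by
  have h1 : @Continuous (H →L[ℂ] H) ℂ (weakStarTopologyOperators H) inferInstance
      fun A => ∑' n, ⟪x n, A (y n)⟫_ℂ :=
    continuous_iInf_dom (i := x) <| continuous_iInf_dom (i := y) <|
      continuous_iInf_dom (i := hx) <| continuous_iInf_dom (i := hy) continuous_induced_dom
  have h2 : @Continuous M (H →L[ℂ] H) M.weakStarTopology (weakStarTopologyOperators H)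
      Subtype.val := continuous_induced_dom
  exact @Continuous.comp M _ ℂ M.weakStarTopology (weakStarTopologyOperators H) _ _ _ h1 h2

/-- Normal positive functionals are weak*-continuous. -/
theorem continuous_of_normal [TopologicalSpace.SeparableSpace H] (ω : StrongDual ℂ M)
    (hω : ∀ a, 0 ≤ a → 0 ≤ ω a)
    (hn : ∀ (A : ℕ → M) (a : M), IncreasesTo A a → Tendsto (fun n => ω (A n)) atTop (𝓝 (ω a))) :
    @Continuous M ℂ M.weakStarTopology inferInstance ω := by
  obtain ⟨x, y, hx, hy, h⟩ := exists_tsum_inner_eq (mem_closure_vectorSpan ω hω hn)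
  rw [funext h]
  exact continuous_tsum_inner hx hy

theorem norm_inner_apply_self_le (b : N) (z : K) :
    ‖⟪z, (b : K →L[ℂ] K) z⟫_ℂ‖ ≤ ‖b‖ * ‖z‖ ^ 2 := by
  refine (norm_inner_le_norm _ _).trans ?_
  have := (b : K →L[ℂ] K).le_opNorm z
  calc ‖z‖ * ‖(b : K →L[ℂ] K) z‖ ≤ ‖z‖ * (‖b‖ * ‖z‖) := by gcongr; exact this
    _ = _ := by ring

/-- The functional is positive, and normal by dominated convergence: for 0 ≤ Aₙ ≤ a the k-th term is
at most ‖E a‖‖zₖ‖². -/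
theorem continuous_tsum_inner_map_self [TopologicalSpace.SeparableSpace H] {E : M →ₗ[ℂ] N}
    (hE : E ∈ CP M N) {z : ℕ → K} (hz : Summable fun n => ‖z n‖ ^ 2) :
    @Continuous M ℂ M.weakStarTopology inferInstance
      fun a => ∑' n, ⟪z n, (E a : K →L[ℂ] K) (z n)⟫_ℂ := by
  obtain ⟨hcp, hnor⟩ := hE
  obtain ⟨C, hC0, hC⟩ := exists_norm_le_of_isCompletelyPositive hcp
  have hs : ∀ a, Summable fun n => ⟪z n, (E a : K →L[ℂ] K) (z n)⟫_ℂ := fun a =>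
    summable_inner_apply _ hz hz
  let ω : StrongDual ℂ M := LinearMap.mkContinuous
    { toFun := fun a => ∑' n, ⟪z n, (E a : K →L[ℂ] K) (z n)⟫_ℂ
      map_add' := fun a b => by
        rw [← (hs a).tsum_add (hs b)]
        simp
      map_smul' := fun c a => by
        rw [RingHom.id_apply, ← (hs a).tsum_const_smul]
        refine tsum_congr fun n => ?_
        rw [map_smul]
        exact inner_smul_right _ _ _ } (C * ∑' n, ‖z n‖ ^ 2) fun a => by
    have h1 : HasSum (fun n => C * ‖a‖ * ‖z n‖ ^ 2) (C * (∑' n, ‖z n‖ ^ 2) * ‖a‖) := by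
      rw [mul_right_comm]
      exact hz.hasSum.mul_left (C * ‖a‖)
    refine tsum_of_norm_bounded h1 fun n => ?_
    refine (norm_inner_apply_self_le _ _).trans ?_
    gcongr
    exact hC a
  refine continuous_of_normal ω (fun a ha => ?_) fun A a hA => ?_
  · exact tsum_nonneg fun n => (nonneg_iff _).1 (map_nonneg_of_isCompletelyPositive hcp ha) (z n)
  · have hmono := monotone_of_isCompletelyPositive hcp
    have hlub := hnor A a hA.nonneg hA.mono hA.isLUB
    refine tendsto_tsum_of_dominated_convergence (hz.mul_left ‖E a‖)
      (fun k => tendsto_const_nhds.inner (tendsto_of_isLUB (hmono.comp hA.mono) hlub (z k)))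
      (Eventually.of_forall fun n k => ?_)
    refine (norm_inner_apply_self_le _ _).trans ?_
    gcongr
    exact norm_le_of_nonneg_of_le (map_nonneg_of_isCompletelyPositive hcp (hA.nonneg n))
      (hlub.1 ⟨n, rfl⟩)

omit [CompleteSpace K] in
theorem _root_.ContinuousLinearMap.inner_apply_eq_sum_pow_I (T : K →L[ℂ] K) (x y : K) :
    ⟪x, T y⟫_ℂ = ∑ k : Fin 4, (1 / 4 * Complex.I ^ (k : ℕ)) *
      ⟪y + Complex.I ^ (k : ℕ) • x, T (y + Complex.I ^ (k : ℕ) • x)⟫_ℂ := by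
  simp only [map_smul, map_add, inner_smul_left, inner_smul_right, inner_add_left,
    inner_add_right, Fin.sum_univ_four]
  simp [pow_succ]
  ring_nf
  simp
  ring

/-- Normal completely positive maps are weak*-continuous. -/
theorem isWeakStarContinuous_of_mem_CP [TopologicalSpace.SeparableSpace H] {E : M →ₗ[ℂ] N}
    (hE : E ∈ CP M N) : IsWeakStarContinuous E := by
  rw [isWeakStarContinuous_iff]
  intro x y hx hy
  let z : Fin 4 → ℕ → K := fun k n => y n + Complex.I ^ (k : ℕ) • x n
  have hz : ∀ k, Summable fun n => ‖z k n‖ ^ 2 := fun k => by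
    refine Summable.of_nonneg_of_le (fun n => by positivity) (fun n => ?_)
      ((hy.add hx).mul_left 2)
    have h1 : ‖z k n‖ ≤ ‖y n‖ + ‖x n‖ := by
      refine (norm_add_le _ _).trans_eq ?_
      rw [norm_smul, norm_pow, Complex.norm_I, one_pow, one_mul]
    calc ‖z k n‖ ^ 2 ≤ (‖y n‖ + ‖x n‖) ^ 2 := by gcongr
      _ ≤ 2 * (‖y n‖ ^ 2 + ‖x n‖ ^ 2) := by nlinarith [sq_nonneg (‖y n‖ - ‖x n‖)]
  have e : ∀ a : M, ∑' n, ⟪x n, (E a : K →L[ℂ] K) (y n)⟫_ℂ = ∑ k : Fin 4,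
      (1 / 4 * Complex.I ^ (k : ℕ)) * ∑' n, ⟪z k n, (E a : K →L[ℂ] K) (z k n)⟫_ℂ := by
    intro a
    simp only [ContinuousLinearMap.inner_apply_eq_sum_pow_I (E a : K →L[ℂ] K) (x _) (y _)]
    rw [Summable.tsum_finsetSum fun k _ => (summable_inner_apply _ (hz k) (hz k)).mul_left _]
    exact Finset.sum_congr rfl fun k _ => tsum_mul_left
  simp only [e]
  let _ := M.weakStarTopology
  exact continuous_finsetSum _ fun k _ =>
    continuous_const.mul (continuous_tsum_inner_map_self hE (hz k))

end NormalMaps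

/-! ### Complete boundedness of completely positive maps. -/

section CompleteBoundedness

/-- The element is a combination of four positive elements of norm at most `‖a‖`. The constant 4 is
not sharp, but it does not depend on the algebra, hence not on the matrix size. -/
theorem _root_.PositiveLinearMap.norm_apply_le_four_mul {A B : Type*} [CStarAlgebra A]
    [CStarAlgebra B] [PartialOrder A] [PartialOrder B] [StarOrderedRing A] [StarOrderedRing B]
    (f : A →ₚ[ℂ] B) (a : A) : ‖f a‖ ≤ 4 * ‖f 1‖ * ‖a‖ := by
  obtain ⟨y, hy0, hyn, hy⟩ := CStarAlgebra.exists_sum_four_nonneg a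
  conv_lhs => rw [hy]
  rw [map_sum]
  refine (norm_sum_le _ _).trans ((Finset.sum_le_sum fun k _ => ?_).trans_eq
    (b := ∑ _k : Fin 4, ‖f 1‖ * ‖a‖) ?_)
  · rw [map_smul, norm_smul, norm_pow, Complex.norm_I, one_pow, one_mul]
    refine (f.norm_apply_le_of_nonneg _ (hy0 k)).trans ?_
    gcongr
    exact hyn k
  · simp [mul_assoc]

variable {H : Type*} [NormedAddCommGroup H] [InnerProductSpace ℂ H] [CompleteSpace H]
variable {K : Type*} [NormedAddCommGroup K] [InnerProductSpace ℂ K] [CompleteSpace K]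
variable {M : VonNeumannAlgebra H} {N : VonNeumannAlgebra K}

/-- The image is diagonal with all diagonal entries `E 1`, so the bound is uniform in n. -/
theorem norm_one_map_le (E : M →ₗ[ℂ] N) (n : ℕ) :
    ‖(1 : CStarMatrix (Fin n) (Fin n) M).map E‖ ≤ ‖E 1‖ := by
  refine norm_le_of_norm_matrixForm_le _ (norm_nonneg _) fun u v => ?_
  have h1 : matrixForm ((1 : CStarMatrix (Fin n) (Fin n) M).map E) u v
      = ∑ i, ⟪u i, (E 1 : K →L[ℂ] K) (v i)⟫_ℂ := by
    refine Finset.sum_congr rfl fun i _ => ?_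
    rw [Finset.sum_eq_single i (fun j _ hj => ?_) (by simp)]
    · rw [CStarMatrix.map_apply, CStarMatrix.one_apply_eq]
    · rw [CStarMatrix.map_apply, CStarMatrix.one_apply_ne hj.symm, map_zero]
      simp
  rw [h1, mul_assoc]
  refine (norm_sum_le _ _).trans ((Finset.sum_le_sum
    (g := fun i => ‖E 1‖ * (‖u i‖ * ‖v i‖)) fun i _ => ?_).trans ?_)
  · refine (norm_inner_le_norm _ _).trans ?_
    calc ‖u i‖ * ‖(E 1 : K →L[ℂ] K) (v i)‖ ≤ ‖u i‖ * (‖E 1‖ * ‖v i‖) := by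
          gcongr
          exact (E 1 : K →L[ℂ] K).le_opNorm (v i)
      _ = _ := by ring
  · rw [← Finset.mul_sum]
    gcongr
    exact Real.sum_mul_le_sqrt_mul_sqrt _ _ _

/-- Completely positive maps are completely bounded. -/
theorem isCompletelyBounded_of_isCompletelyPositive {E : M →ₗ[ℂ] N} (hE : IsCompletelyPositive E) :
    IsCompletelyBounded E := by
  refine ⟨4 * ‖E 1‖ + 1, by positivity, fun n A => ?_⟩
  obtain ⟨φ, rfl⟩ := hE
  let f : CStarMatrix (Fin n) (Fin n) M →ₚ[ℂ] CStarMatrix (Fin n) (Fin n) N :=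
    PositiveLinearMap.mk₀ (CStarMatrix.mapₗ φ.toLinearMap) fun A hA =>
      φ.map_cstarMatrix_nonneg' n A hA
  have h1 : ‖A.map φ.toLinearMap‖ ≤ 4 * ‖(1 : CStarMatrix (Fin n) (Fin n) M).map φ.toLinearMap‖ * ‖A‖ :=
    f.norm_apply_le_four_mul A
  refine h1.trans ?_
  gcongr
  have := norm_one_map_le φ.toLinearMap n
  linarith

end CompleteBoundedness

/-! ### The cone of normal completely positive maps and its span. -/

section Cone

variable {H : Type*} [NormedAddCommGroup H] [InnerProductSpace ℂ H] [CompleteSpace H]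
variable {K : Type*} [NormedAddCommGroup K] [InnerProductSpace ℂ K] [CompleteSpace K]

theorem CP_subset_CB [TopologicalSpace.SeparableSpace H] (M : VonNeumannAlgebra H)
    (N : VonNeumannAlgebra K) : CP M N ⊆ (CB M N : Set (M →ₗ[ℂ] N)) := fun _ hE =>
  ⟨isWeakStarContinuous_of_mem_CP hE, isCompletelyBounded_of_isCompletelyPositive hE.1⟩

variable {M : VonNeumannAlgebra H} {N : VonNeumannAlgebra K}

theorem zero_mem_CP : (0 : M →ₗ[ℂ] N) ∈ CP M N := by
  refine ⟨⟨⟨0, fun n A _ => le_of_eq rfl⟩, rfl⟩, fun A a _ _ _ => ?_⟩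
  exact isLUB_of_tendsto monotone_const fun h => tendsto_const_nhds

theorem add_mem_CP {E F : M →ₗ[ℂ] N} (hE : E ∈ CP M N) (hF : F ∈ CP M N) : E + F ∈ CP M N := by
  obtain ⟨hE, hEn⟩ := hE
  obtain ⟨hF, hFn⟩ := hF
  have hEm := monotone_of_isCompletelyPositive hE
  have hFm := monotone_of_isCompletelyPositive hF
  refine ⟨?_, fun A a hA0 hA ha => isLUB_of_tendsto ((hEm.comp hA).add (hFm.comp hA)) fun h => ?_⟩
  · obtain ⟨φ, rfl⟩ := hE
    obtain ⟨ψ, rfl⟩ := hF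
    exact ⟨⟨φ.toLinearMap + ψ.toLinearMap, fun n A hA =>
      add_nonneg (φ.map_cstarMatrix_nonneg' n A hA) (ψ.map_cstarMatrix_nonneg' n A hA)⟩, rfl⟩
  · have h1 := (tendsto_of_isLUB (hEm.comp hA) (hEn A a hA0 hA ha) h).add
      (tendsto_of_isLUB (hFm.comp hA) (hFn A a hA0 hA ha) h)
    exact tendsto_const_nhds.inner h1

theorem smul_mem_CP {E : M →ₗ[ℂ] N} (hE : E ∈ CP M N) {r : ℝ} (hr : 0 ≤ r) : r • E ∈ CP M N := by
  obtain ⟨hE, hEn⟩ := hE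
  have hEm := monotone_of_isCompletelyPositive hE
  refine ⟨?_, fun A a hA0 hA ha => isLUB_of_tendsto
    (fun m n hmn => smul_le_smul_of_nonneg_left (hEm (hA hmn)) hr) fun h => ?_⟩
  · obtain ⟨φ, rfl⟩ := hE
    exact ⟨⟨r • φ.toLinearMap, fun n A hA =>
      smul_nonneg hr (φ.map_cstarMatrix_nonneg' n A hA)⟩, rfl⟩
  · have h1 := (tendsto_of_isLUB (hEm.comp hA) (hEn A a hA0 hA ha) h).const_smul r
    exact tendsto_const_nhds.inner h1

theorem eq_zero_of_neg_mem_CP {E : M →ₗ[ℂ] N} (hE : E ∈ CP M N) (hE' : -E ∈ CP M N) : E = 0 := by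
  have h0 : ∀ a, 0 ≤ a → E a = 0 := fun a ha =>
    le_antisymm (neg_nonneg.1 (map_nonneg_of_isCompletelyPositive hE'.1 ha))
      (map_nonneg_of_isCompletelyPositive hE.1 ha)
  refine LinearMap.ext fun a => ?_
  obtain ⟨y, hy0, -, hy⟩ := CStarAlgebra.exists_sum_four_nonneg a
  rw [hy, map_sum]
  refine Finset.sum_eq_zero fun k _ => ?_
  rw [map_smul, h0 _ (hy0 k), smul_zero]

variable (M N) in
/-- The cone of normal completely positive maps. -/
def coneCP : PointedCone ℝ (M →ₗ[ℂ] N) where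
  carrier := CP M N
  zero_mem' := zero_mem_CP
  add_mem' := add_mem_CP
  smul_mem' c _ hE := smul_mem_CP hE c.property

theorem span_CP_top [TopologicalSpace.SeparableSpace H] (M : VonNeumannAlgebra H) :
    Submodule.span ℂ (CP M (⊤ : VonNeumannAlgebra K)) = CB M (⊤ : VonNeumannAlgebra K) := by
  refine le_antisymm (Submodule.span_le.2 (CP_subset_CB M _)) fun E hE => ?_
  obtain ⟨F, hF, rfl⟩ := exists_eq_sum_pow_I_smul E hE
  exact Submodule.sum_mem _ fun k _ =>
    Submodule.smul_mem _ _ (Submodule.subset_span (hF k))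

end Cone

end VonNeumannAlgebra
theorem mainTheorem5
    {H : Type*} [NormedAddCommGroup H] [InnerProductSpace ℂ H] [CompleteSpace H]
    [TopologicalSpace.SeparableSpace H]
    {K : Type*} [NormedAddCommGroup K] [InnerProductSpace ℂ K] [CompleteSpace K]
    [TopologicalSpace.SeparableSpace K]
    (M : VonNeumannAlgebra H) :
    (∀ N : VonNeumannAlgebra K,
      VonNeumannAlgebra.CP M N ⊆ (VonNeumannAlgebra.CB M N : Set (M →ₗ[ℂ] N)) ∧
      (∃ P : PointedCone ℝ (M →ₗ[ℂ] N),
        (P : Set (M →ₗ[ℂ] N)) = VonNeumannAlgebra.CP M N ∧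
        ∀ E ∈ P, -E ∈ P → E = 0)) ∧
    Submodule.span ℂ (VonNeumannAlgebra.CP M (⊤ : VonNeumannAlgebra K)) =
      VonNeumannAlgebra.CB M (⊤ : VonNeumannAlgebra K) ∧
    ∀ E ∈ VonNeumannAlgebra.CB M (⊤ : VonNeumannAlgebra K),
      ∃ F : Fin 4 → (M →ₗ[ℂ] (⊤ : VonNeumannAlgebra K)),
        (∀ k, F k ∈ VonNeumannAlgebra.CP M (⊤ : VonNeumannAlgebra K)) ∧
        E = ∑ k : Fin 4, Complex.I ^ (k : ℕ) • F k := by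
  refine ⟨fun N => ⟨VonNeumannAlgebra.CP_subset_CB M N, VonNeumannAlgebra.coneCP M N, rfl,
    fun E hE hE' => VonNeumannAlgebra.eq_zero_of_neg_mem_CP hE hE'⟩,
    VonNeumannAlgebra.span_CP_top M, fun E hE => VonNeumannAlgebra.exists_eq_sum_pow_I_smul E hE⟩
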